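/- Let $p,q\ge 2$ be integers. Let $M$ be a complex manifold with a $(p,q)$ paraconformal structure: holomorphic vector bundles $U,V$ over $M$ of ranks $p$ and $q$, a holomorphic isomorphism $\alpha: TM\to U\otimes V$, and a holomorphic isomorphism $\Lambda^pU\cong\Lambda^qV$. Let $\epsilon$ be a scale (a nowhere vanishing holomorphic section of $\Lambda^pU$) and $\epsilon'$ the corresponding section of $\Lambda^qV$. Let $\nabla$ denote the scale-preserving holomorphic connections on $U$ and $V$: $\nabla\epsilon=0$, $\nabla\epsilon'=0$, and all traces of the torsion $\mathbf T$ of the connection induced on $TM\cong U\otimes V$ vanish. Let $\mathbf T^+$ be the component of $\mathbf T$ in $TM\otimes\Lambda^2U^*\otimes S^2V^*$. Let $W^+$ be the trace-free part of the tensor obtained from the $\Lambda^2U^*\otimes(V\otimes V^*\otimes S^2V^*)$ component of the curvature of $V$ by completely symmetrising the three lower $V$ indices. The structure is right-flat over a subset of $M$ if, at each of its points, $\mathbf T^+=0$ when $p>2$, and $W^+=0$ when $p=2$; it is right-flat if this holds over $M$. For $\pi\in V_x$ let $T_{(x,\pi)}$ be the space of horizontal lifts to $(x,\pi)$ of the vectors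 $\alpha^{-1}(u\otimes\pi)$, $u\in U_x$; in local frames, $T$ is spanned by $v_A=\pi^{A'}D_{AA'}$, $A=1,\dots,p$. A distribution is called involutive if the Lie bracket of any two of its local holomorphic sections again takes values in it. Then: 1. $T$ is involutive on the total space of $V$ if and only if the structure is right-flat. 2. The projection of $T$ to the projective bundle $P(V)$ is involutive if and only if the structure is right-flat. 3. Let $(s_A)$ and $(t_{A'})$ be holomorphic frames of $U$ and $V$ over an open set $O\subseteq M$, let $e_{AA'}=\alpha^{-1}(s_A\otimes t_{A'})$, and write $\nabla_{e_{AA'}}t_j=\sum_i\gamma_{AA'}{}^i{}_j\,t_i$. Fix $k\in\{1,\dots,q\}$, and let $\lambda^i=\pi^i/\pi^k$ ($i\ne k$) be the affine coordinates on the part $\pi^k\neq0$ of $P(V)|_O$, with $\lambda^k=1$. Put $$A_{AA'}{}^i=\sum_j\gamma_{AA'}{}^i{}_j\lambda^j-\lambda^i\sum_j\gamma_{AA'}{}^k{}_j\lambda^j,\qquad D_{AA'}=e_{AA'}-\sum_{i\ne k}A_{AA'}{}^i\frac{\partial}{\partial\lambda^i},\qquad \mathbf v_A=\sum_{A'=1}^q\lambda^{A'}D_{AA'}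 .$$ Then the structure is right-flat over $O$ if and only if there are functions $C_{AB}{}^C$ on $O\times\mathbb C^{q-1}$ such that $$[\mathbf v_A,\mathbf v_B]=\sum_{C=1}^pC_{AB}{}^C\,\mathbf v_C,\qquad A,B=1,\dots,p.$$ Moreover, any such functions $C_{AB}{}^C(x,\lambda)$ are polynomials of degree at most $2$ in the $\lambda^i$, with coefficients that are holomorphic functions of $x\in O$. -/

import Mathlib

open Bundle Set Filter Topology Module TensorProduct
open scoped Manifold ContDiff

set_option linter.unusedSectionVars false

noncomputable section

namespace Paraconformal

/-- A (possibly singular) holomorphic distribution `D` is involutive over `A` if the Lie bracket of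
any two holomorphic vector fields which are defined on an open subset of `A` and take values in `D`
takes values in `D`. -/
def IsInvolutiveOn {E : Type*} [NormedAddCommGroup E] [NormedSpace ℂ E]
    {H : Type*} [TopologicalSpace H] (I : ModelWithCorners ℂ E H)
    {N : Type*} [TopologicalSpace N] [ChartedSpace H N] [IsManifold I ω N]
    (D : ∀ z : N, Submodule ℂ (TangentSpace I z)) (A : Set N) : Prop :=
  ∀ O : Set N, IsOpen O → O ⊆ A → ∀ ξ η : Π z : N, TangentSpace I z,
    CMDiff[O] ω (T% ξ) → CMDiff[O] ω (T% η) →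
    (∀ z ∈ O, ξ z ∈ D z) → (∀ z ∈ O, η z ∈ D z) →
    ∀ z ∈ O, VectorField.mlieBracket I ξ η z ∈ D z

section Setup

variable {E : Type*} [NormedAddCommGroup E] [NormedSpace ℂ E] [FiniteDimensional ℂ E]
  [CompleteSpace E]
  {M : Type*} [TopologicalSpace M] [ChartedSpace E M] [IsManifold 𝓘(ℂ, E) ω M]
  {F₁ : Type*} [NormedAddCommGroup F₁] [NormedSpace ℂ F₁] [FiniteDimensional ℂ F₁]
  {U : M → Type*} [TopologicalSpace (TotalSpace F₁ U)]
  [∀ x, AddCommGroup (U x)] [∀ x, Module ℂ (U x)] [∀ x, TopologicalSpace (U x)]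
  [∀ x, IsTopologicalAddGroup (U x)] [∀ x, ContinuousSMul ℂ (U x)]
  [FiberBundle F₁ U] [VectorBundle ℂ F₁ U] [ContMDiffVectorBundle ω F₁ U 𝓘(ℂ, E)]
  {F₂ : Type*} [NormedAddCommGroup F₂] [NormedSpace ℂ F₂] [FiniteDimensional ℂ F₂]
  {V : M → Type*} [TopologicalSpace (TotalSpace F₂ V)]
  [∀ x, AddCommGroup (V x)] [∀ x, Module ℂ (V x)] [∀ x, TopologicalSpace (V x)]
  [∀ x, IsTopologicalAddGroup (V x)] [∀ x, ContinuousSMul ℂ (V x)]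
  [FiberBundle F₂ V] [VectorBundle ℂ F₂ V] [ContMDiffVectorBundle ω F₂ V 𝓘(ℂ, E)]

/-- A section `ε` of the top exterior power `Λ^r U` of a rank `r` holomorphic bundle is holomorphic
at `x` if `ε = f u₁ ∧ … ∧ u_r` with `f` holomorphic, for every holomorphic frame `u` near `x`. -/
def IsHolomorphicTopAt (E : Type*) [NormedAddCommGroup E] [NormedSpace ℂ E]
    {M : Type*} [TopologicalSpace M] [ChartedSpace E M]
    (F : Type*) [NormedAddCommGroup F] [NormedSpace ℂ F]
    {U : M → Type*} [TopologicalSpace (TotalSpace F U)]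
    [∀ x, AddCommGroup (U x)] [∀ x, Module ℂ (U x)] [∀ x, TopologicalSpace (U x)]
    [FiberBundle F U] (r : ℕ) (ε : ∀ x, ⋀[ℂ]^r (U x)) (x : M) : Prop :=
  ∀ u : Fin r → Π y : M, U y,
    (∀ i, ContMDiffAt 𝓘(ℂ, E) (𝓘(ℂ, E).prod 𝓘(ℂ, F)) ω (T% (u i)) x) →
    LinearIndependent ℂ (fun i => u i x) →
    ∀ f : M → ℂ, (∀ᶠ y in 𝓝 x, ε y = f y • exteriorPower.ιMulti ℂ r (fun i => u i y)) →
      ContMDiffAt 𝓘(ℂ, E) 𝓘(ℂ, ℂ) ω f x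

variable (E F₁ U F₂ V) in
/-- A `(p, q)` paraconformal structure. -/
structure ParaconformalStructure (p q : ℕ) where
  rank_left : finrank ℂ F₁ = p
  rank_right : finrank ℂ F₂ = q
  /-- the isomorphism `α : TM → U ⊗ V` -/
  iso : ∀ x : M, TangentSpace 𝓘(ℂ, E) x ≃ₗ[ℂ] U x ⊗[ℂ] V x
  /-- `α` is an isomorphism of holomorphic bundles -/
  holo_iso : ∀ (x : M) (u : Π y : M, U y) (v : Π y : M, V y),
    CMDiffAt ω (T% u) x → CMDiffAt ω (T% v) x →
    CMDiffAt ω (T% (fun y => (iso y).symm (u y ⊗ₜ[ℂ] v y))) x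
  /-- the isomorphism `Λ^p U ≅ Λ^q V` -/
  volIso : ∀ x : M, ⋀[ℂ]^p (U x) ≃ₗ[ℂ] ⋀[ℂ]^q (V x)
  holo_volIso : ∀ (x : M) (ε : ∀ y, ⋀[ℂ]^p (U y)), IsHolomorphicTopAt E F₁ p ε x →
    IsHolomorphicTopAt E F₂ q (fun y => volIso y (ε y)) x

namespace ParaconformalStructure

variable {p q : ℕ} (S : ParaconformalStructure E F₁ U F₂ V p q)

/-- The vector field `α⁻¹(u ⊗ v)`. -/
def tmul (u : Π y : M, U y) (v : Π y : M, V y) (y : M) : TangentSpace 𝓘(ℂ, E) y :=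
  (S.iso y).symm (u y ⊗ₜ[ℂ] v y)


lemma tmul_add_left (u u' : Π y : M, U y) (v : Π y : M, V y) :
    S.tmul (u + u') v = S.tmul u v + S.tmul u' v := by
  funext y; simp [tmul, add_tmul]

lemma tmul_add_right (u : Π y : M, U y) (v v' : Π y : M, V y) :
    S.tmul u (v + v') = S.tmul u v + S.tmul u v' := by
  funext y; simp [tmul, tmul_add]

lemma tmul_smul_left (f : M → ℂ) (u : Π y : M, U y) (v : Π y : M, V y) :
    S.tmul (f • u) v = f • S.tmul u v := by
  funext y; simp [tmul, ← smul_tmul']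

lemma tmul_smul_right (f : M → ℂ) (u : Π y : M, U y) (v : Π y : M, V y) :
    S.tmul u (f • v) = f • S.tmul u v := by
  funext y; simp [tmul]

lemma mdifferentiableAt_tmul {x : M} {u : Π y : M, U y} {v : Π y : M, V y}
    (hu : MDiffAt (T% u) x) (hv : MDiffAt (T% v) x) : MDiffAt (T% (S.tmul u v)) x := by
  classical
  have : ContMDiffVectorBundle 1 F₁ U 𝓘(ℂ, E) := .of_le (n := ω) le_top
  have : ContMDiffVectorBundle 1 F₂ V 𝓘(ℂ, E) := .of_le (n := ω) le_top
  let e₁ := trivializationAt F₁ U x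
  let e₂ := trivializationAt F₂ V x
  have h₁ : x ∈ e₁.baseSet := FiberBundle.mem_baseSet_trivializationAt F₁ U x
  have h₂ : x ∈ e₂.baseSet := FiberBundle.mem_baseSet_trivializationAt F₂ V x
  let b₁ := finBasis ℂ F₁
  let b₂ := finBasis ℂ F₂
  have key : ∀ᶠ y in 𝓝 x, S.tmul u v y =
      ∑ i, ∑ j, (e₁.localFrameCoeff 𝓘(ℂ, E) b₁ i y (u y) *
        e₂.localFrameCoeff 𝓘(ℂ, E) b₂ j y (v y)) •
          S.tmul (e₁.localFrame b₁ i) (e₂.localFrame b₂ j) y := by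
    filter_upwards [e₁.eventually_eq_localFrame_sum_coeff_smul (I := 𝓘(ℂ, E)) b₁ h₁ (s := u),
      e₂.eventually_eq_localFrame_sum_coeff_smul (I := 𝓘(ℂ, E)) b₂ h₂ (s := v)] with y hy hy'
    conv_lhs => rw [tmul, hy, hy']
    simp only [tmul, sum_tmul, tmul_sum, map_sum]
    rw [Finset.sum_comm]
    refine Finset.sum_congr rfl fun i _ => Finset.sum_congr rfl fun j _ => ?_
    rw [tmul_smul, ← smul_tmul', map_smul, map_smul, smul_smul, mul_comm]
  have hs : MDiffAt (T% (fun y => ∑ i, ∑ j, (e₁.localFrameCoeff 𝓘(ℂ, E) b₁ i y (u y) *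
        e₂.localFrameCoeff 𝓘(ℂ, E) b₂ j y (v y)) •
          S.tmul (e₁.localFrame b₁ i) (e₂.localFrame b₂ j) y)) x := by
    refine MDifferentiableAt.sum_section fun i _ => MDifferentiableAt.sum_section fun j _ => ?_
    refine MDifferentiableAt.smul_section ?_ ?_
    · exact (mdifferentiableAt_localFrameCoeff b₁ h₁ hu i).mul
        (mdifferentiableAt_localFrameCoeff b₂ h₂ hv j)
    · exact (S.holo_iso x _ _ (contMDiffAt_localFrame_of_mem ω e₁ b₁ i h₁)
        (contMDiffAt_localFrame_of_mem ω e₂ b₂ j h₂)).mdifferentiableAt (by simp)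
  refine hs.congr_of_eventuallyEq ?_
  filter_upwards [key] with y hy
  simp [hy]

/-- The derivative at `x` of a vector field, read in the trivialization of `TM` centred at `x`. -/
def coordDeriv (X : Π y : M, TangentSpace 𝓘(ℂ, E) y) (x : M) :
    TangentSpace 𝓘(ℂ, E) x →L[ℂ] TangentSpace 𝓘(ℂ, E) x :=
  ((trivializationAt E (TangentSpace 𝓘(ℂ, E)) x).symmL ℂ x).comp
    (mvfderiv 𝓘(ℂ, E)
      (fun y => (trivializationAt E (TangentSpace 𝓘(ℂ, E)) x (⟨y, X y⟩ : TangentBundle 𝓘(ℂ, E) M)).2)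
      x)

lemma mvfderiv_congr {f g : M → E} {x : M} (h : f =ᶠ[𝓝 x] g) :
    mvfderiv 𝓘(ℂ, E) f x = mvfderiv 𝓘(ℂ, E) g x := by
  ext v
  simp only [mvfderiv, ContinuousLinearMap.comp_apply]
  exact congrArg (fun L : E →L[ℂ] E => L v) h.mfderiv_eq

lemma mdifferentiableAt_coord {X : Π y : M, TangentSpace 𝓘(ℂ, E) y} {x : M}
    (hX : MDiffAt (T% X) x) :
    MDifferentiableAt 𝓘(ℂ, E) 𝓘(ℂ, E) (fun y => (trivializationAt E (TangentSpace 𝓘(ℂ, E)) x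
      (⟨y, X y⟩ : TangentBundle 𝓘(ℂ, E) M)).2) x :=
  ((trivializationAt E (TangentSpace 𝓘(ℂ, E)) x).mdifferentiableAt_section_iff 𝓘(ℂ, E) X
    (FiberBundle.mem_baseSet_trivializationAt E (TangentSpace 𝓘(ℂ, E)) x)).1 hX

lemma coordDeriv_add {X Y : Π y : M, TangentSpace 𝓘(ℂ, E) y} {x : M}
    (hX : MDiffAt (T% X) x) (hY : MDiffAt (T% Y) x) :
    coordDeriv (X + Y) x = coordDeriv X x + coordDeriv Y x := by
  have hx := FiberBundle.mem_baseSet_trivializationAt E (TangentSpace 𝓘(ℂ, E)) x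
  simp only [coordDeriv]
  rw [← ContinuousLinearMap.comp_add,
    ← mvfderiv_add (mdifferentiableAt_coord hX) (mdifferentiableAt_coord hY)]
  congr 1
  refine mvfderiv_congr ?_
  filter_upwards [(trivializationAt E (TangentSpace 𝓘(ℂ, E)) x).open_baseSet.mem_nhds hx]
    with y hy
  exact ((trivializationAt E (TangentSpace 𝓘(ℂ, E)) x).linear ℂ hy).map_add (X y) (Y y)

lemma coordDeriv_smul {f : M → ℂ} {X : Π y : M, TangentSpace 𝓘(ℂ, E) y} {x : M}
    (hf : MDiffAt f x) (hX : MDiffAt (T% X) x) :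
    coordDeriv (f • X) x =
      f x • coordDeriv X x + (mvfderiv 𝓘(ℂ, E) f x).smulRight (X x) := by
  have hx := FiberBundle.mem_baseSet_trivializationAt E (TangentSpace 𝓘(ℂ, E)) x
  have h : coordDeriv (f • X) x =
      ((trivializationAt E (TangentSpace 𝓘(ℂ, E)) x).symmL ℂ x).comp
        (mvfderiv 𝓘(ℂ, E) (f • fun y => (trivializationAt E (TangentSpace 𝓘(ℂ, E)) x
          (⟨y, X y⟩ : TangentBundle 𝓘(ℂ, E) M)).2) x) := by
    rw [coordDeriv]
    congr 1
    refine mvfderiv_congr ?_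
    filter_upwards [(trivializationAt E (TangentSpace 𝓘(ℂ, E)) x).open_baseSet.mem_nhds hx]
      with y hy
    exact ((trivializationAt E (TangentSpace 𝓘(ℂ, E)) x).linear ℂ hy).map_smul (f y) (X y)
  rw [h, mvfderiv_smul hf (mdifferentiableAt_coord hX), ContinuousLinearMap.comp_add,
    ContinuousLinearMap.comp_smul]
  congr 1
  ext w
  have := (trivializationAt E (TangentSpace 𝓘(ℂ, E)) x).symmL_continuousLinearMapAt
    (R := ℂ) hx (X x)
  rw [(trivializationAt E (TangentSpace 𝓘(ℂ, E)) x).continuousLinearMapAt_apply_of_mem ℂ hx] at this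
  simp [this]

/-- The failure of the coordinate derivative to satisfy the product rule
`∇(α⁻¹(u ⊗ v)) = α⁻¹(∇u ⊗ v + u ⊗ ∇v)`. -/
def defect (nablaU : CovariantDerivative 𝓘(ℂ, E) F₁ U) (nablaV : CovariantDerivative 𝓘(ℂ, E) F₂ V)
    (x : M) (u : Π y : M, U y) (v : Π y : M, V y) :
    TangentSpace 𝓘(ℂ, E) x →L[ℂ] TangentSpace 𝓘(ℂ, E) x :=
  have : T2Space (TangentSpace 𝓘(ℂ, E) x) := inferInstanceAs (T2Space E)
  have : FiniteDimensional ℂ (TangentSpace 𝓘(ℂ, E) x) := inferInstanceAs (FiniteDimensional ℂ E)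
  coordDeriv (S.tmul u v) x - LinearMap.toContinuousLinearMap
    ((S.iso x).symm.toLinearMap ∘ₗ
      ((TensorProduct.mk ℂ (U x) (V x)).flip (v x) ∘ₗ (nablaU u x).toLinearMap +
        TensorProduct.mk ℂ (U x) (V x) (u x) ∘ₗ (nablaV v x).toLinearMap))

variable (nablaU : CovariantDerivative 𝓘(ℂ, E) F₁ U) (nablaV : CovariantDerivative 𝓘(ℂ, E) F₂ V)

lemma defect_apply (x : M) (u : Π y : M, U y) (v : Π y : M, V y) (X : TangentSpace 𝓘(ℂ, E) x) :
    S.defect nablaU nablaV x u v X = coordDeriv (S.tmul u v) x X -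
      (S.iso x).symm (nablaU u x X ⊗ₜ v x + u x ⊗ₜ nablaV v x X) := rfl

lemma defect_tensorial_left (x : M) (v : Π y : M, V y) (hv : MDiffAt (T% v) x) :
    TensorialAt 𝓘(ℂ, E) F₁ (S.defect nablaU nablaV x · v) x where
  smul {f u} hf hu := by
    ext X
    simp only [smul_apply, defect_apply]
    rw [tmul_smul_left, coordDeriv_smul hf (S.mdifferentiableAt_tmul hu hv),
      nablaU.isCovariantDerivativeOnUniv.leibniz hu hf]
    simp [add_tmul, ← smul_tmul', tmul]
    module
  add {u u'} hu hu' := by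
    ext X
    simp only [add_apply, defect_apply]
    rw [tmul_add_left, coordDeriv_add (S.mdifferentiableAt_tmul hu hv)
      (S.mdifferentiableAt_tmul hu' hv), nablaU.isCovariantDerivativeOnUniv.add hu hu']
    simp [add_tmul]
    abel

lemma defect_tensorial_right (x : M) (u : Π y : M, U y) (hu : MDiffAt (T% u) x) :
    TensorialAt 𝓘(ℂ, E) F₂ (S.defect nablaU nablaV x u) x where
  smul {f v} hf hv := by
    ext X
    simp only [smul_apply, defect_apply]
    rw [tmul_smul_right, coordDeriv_smul hf (S.mdifferentiableAt_tmul hu hv),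
      nablaV.isCovariantDerivativeOnUniv.leibniz hv hf]
    simp [tmul_add, tmul_smul, tmul]
    module
  add {v v'} hv hv' := by
    ext X
    simp only [add_apply, defect_apply]
    rw [tmul_add_right, coordDeriv_add (S.mdifferentiableAt_tmul hu hv)
      (S.mdifferentiableAt_tmul hu hv'), nablaV.isCovariantDerivativeOnUniv.add hv hv']
    simp [tmul_add]
    abel

/-- The defect depends only on `u ⊗ v` at the point. -/
def defectTensor (x : M) : U x ⊗[ℂ] V x →ₗ[ℂ]
    TangentSpace 𝓘(ℂ, E) x →L[ℂ] TangentSpace 𝓘(ℂ, E) x :=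
  have : ContMDiffVectorBundle 1 F₁ U 𝓘(ℂ, E) := .of_le (n := ω) le_top
  have : ContMDiffVectorBundle 1 F₂ V 𝓘(ℂ, E) := .of_le (n := ω) le_top
  TensorProduct.lift
    (ContinuousLinearMap.coeLM ℂ ∘ₗ (TensorialAt.mkHom₂ (S.defect nablaU nablaV x) x
      (S.defect_tensorial_left nablaU nablaV x) (S.defect_tensorial_right nablaU nablaV x)).toLinearMap)

lemma defectTensor_tmul {x : M} {u : Π y : M, U y} {v : Π y : M, V y}
    (hu : MDiffAt (T% u) x) (hv : MDiffAt (T% v) x) :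
    S.defectTensor nablaU nablaV x (u x ⊗ₜ v x) = S.defect nablaU nablaV x u v := by
  have : ContMDiffVectorBundle 1 F₁ U 𝓘(ℂ, E) := .of_le (n := ω) le_top
  have : ContMDiffVectorBundle 1 F₂ V 𝓘(ℂ, E) := .of_le (n := ω) le_top
  exact TensorialAt.mkHom₂_apply (S.defect_tensorial_left nablaU nablaV x)
    (S.defect_tensorial_right nablaU nablaV x) hu hv

/-- The connection induced on `TM`: the unique one for which covariant differentiation commutes
with `α` (see `induced_tmul`). -/
def induced : CovariantDerivative 𝓘(ℂ, E) E (TangentSpace 𝓘(ℂ, E) : M → Type _) where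
  toFun X x := coordDeriv X x - S.defectTensor nablaU nablaV x (S.iso x (X x))
  isCovariantDerivativeOnUniv :=
    { add := by
        intro X Y x hX hY _
        rw [coordDeriv_add hX hY]
        simp only [Pi.add_apply, map_add]
        abel
      leibniz := by
        intro X f x hX hf _
        rw [coordDeriv_smul hf hX]
        simp only [Pi.smul_apply', map_smul, smul_sub]
        abel }

lemma induced_tmul {x : M} {u : Π y : M, U y} {v : Π y : M, V y}
    (hu : MDiffAt (T% u) x) (hv : MDiffAt (T% v) x) (X : TangentSpace 𝓘(ℂ, E) x) :
    S.induced nablaU nablaV (S.tmul u v) x X =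
      (S.iso x).symm (nablaU u x X ⊗ₜ v x + u x ⊗ₜ nablaV v x X) := by
  have h : S.iso x (S.tmul u v x) = u x ⊗ₜ v x := by simp [tmul]
  change (coordDeriv (S.tmul u v) x - S.defectTensor nablaU nablaV x
    (S.iso x (S.tmul u v x))) X = _
  rw [h, S.defectTensor_tmul nablaU nablaV hu hv, sub_apply, defect_apply,
    sub_sub_cancel]

/-! ### Scales and the scale-preserving connections -/

/-- A connection is holomorphic if it maps local holomorphic sections to holomorphic ones. -/
def IsHolomorphicConnection {F : Type*} [NormedAddCommGroup F] [NormedSpace ℂ F]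
    {W : M → Type*} [TopologicalSpace (TotalSpace F W)]
    [∀ x, AddCommGroup (W x)] [∀ x, Module ℂ (W x)] [∀ x, TopologicalSpace (W x)]
    [∀ x, IsTopologicalAddGroup (W x)] [∀ x, ContinuousSMul ℂ (W x)]
    [FiberBundle F W] [VectorBundle ℂ F W] (nabla : CovariantDerivative 𝓘(ℂ, E) F W) : Prop :=
  ∀ O : Set M, IsOpen O → ContMDiffCovariantDerivativeOn F ω nabla.toFun O

/-- `∇ε = 0` for a non-vanishing section `ε` of the top exterior power `Λ^r W`: whenever
`w₁ ∧ … ∧ w_r = f ε` near `x`, one has `∑ᵢ w₁ ∧ … ∧ ∇_X wᵢ ∧ … ∧ w_r = df(X) ε` at `x`. -/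
def IsParallelTop {F : Type*} [NormedAddCommGroup F] [NormedSpace ℂ F]
    {W : M → Type*} [TopologicalSpace (TotalSpace F W)]
    [∀ x, AddCommGroup (W x)] [∀ x, Module ℂ (W x)] [∀ x, TopologicalSpace (W x)]
    [∀ x, IsTopologicalAddGroup (W x)] [∀ x, ContinuousSMul ℂ (W x)]
    [FiberBundle F W] {r : ℕ} (nabla : CovariantDerivative 𝓘(ℂ, E) F W)
    (ε : ∀ x, ⋀[ℂ]^r (W x)) : Prop :=
  ∀ (x : M) (w : Fin r → Π y : M, W y) (f : M → ℂ),
    (∀ i, CMDiffAt ω (T% (w i)) x) → CMDiffAt ω f x →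
    (∀ᶠ y in 𝓝 x, exteriorPower.ιMulti ℂ r (fun i => w i y) = f y • ε y) →
    ∀ X : TangentSpace 𝓘(ℂ, E) x,
      ∑ i, exteriorPower.ιMulti ℂ r (Function.update (fun j => w j x) i (nabla (w i) x X)) =
        mvfderiv 𝓘(ℂ, E) f x X • ε x

variable (E F₁ U) in
/-- A scale: a non-vanishing holomorphic section `ε` of `Λ^p U`. -/
structure _root_.Paraconformal.Scale (p : ℕ) where
  sec : ∀ x : M, ⋀[ℂ]^p (U x)
  ne_zero : ∀ x, sec x ≠ 0
  holo : ∀ x, IsHolomorphicTopAt E F₁ p sec x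

/-- The section `ε'` of `Λ^q V` corresponding to `ε`. -/
def primedScale (ε : Scale E F₁ U p) (x : M) : ⋀[ℂ]^q (V x) :=
  S.volIso x (ε.sec x)

/-- The torsion of the induced connection, as a tensor on `U ⊗ V ≅ TM`. -/
def torsion (x : M) : U x ⊗[ℂ] V x →ₗ[ℂ] U x ⊗[ℂ] V x →ₗ[ℂ] U x ⊗[ℂ] V x :=
  LinearMap.mk₂ ℂ
    (fun s t => S.iso x ((S.induced nablaU nablaV).torsion x ((S.iso x).symm s) ((S.iso x).symm t)))
    (by intros; simp) (by intros; simp) (by intros; simp) (by intros; simp)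

/-- All traces of the torsion vanish: the contractions `T_{CA' BB'}^{CC'}` and
`T_{AC' BB'}^{CC'}` (those in the second lower slot follow by skew-symmetry). -/
def TorsionTraceFree : Prop :=
  ∀ (x : M) (t : U x ⊗[ℂ] V x),
    (∀ (v : V x) (φ : Dual ℂ (V x)),
      LinearMap.trace ℂ (U x) ((TensorProduct.rid ℂ (U x)).toLinearMap ∘ₗ
        LinearMap.lTensor (U x) φ ∘ₗ (S.torsion nablaU nablaV x).flip t ∘ₗ
          (TensorProduct.mk ℂ (U x) (V x)).flip v) = 0) ∧
    (∀ (u : U x) (ψ : Dual ℂ (U x)),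
      LinearMap.trace ℂ (V x) ((TensorProduct.lid ℂ (V x)).toLinearMap ∘ₗ
        LinearMap.rTensor (V x) ψ ∘ₗ (S.torsion nablaU nablaV x).flip t ∘ₗ
          TensorProduct.mk ℂ (U x) (V x) u) = 0)

/-- The (unique) connections on `U` and `V` preserving the scale, with trace-free torsion. -/
structure IsScaleConnection (ε : Scale E F₁ U p) : Prop where
  holo_left : IsHolomorphicConnection nablaU
  holo_right : IsHolomorphicConnection nablaV
  parallel_left : IsParallelTop nablaU ε.sec
  parallel_right : IsParallelTop nablaV (S.primedScale ε)
  traceFree : S.TorsionTraceFree nablaU nablaV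

/-! ### Right-flatness -/

/-- The component `T⁺` of the torsion in `TM ⊗ Λ²U* ⊗ S²V*`. -/
def torsionPlus (x : M) (u₁ u₂ : U x) (v₁ v₂ : V x) : U x ⊗[ℂ] V x :=
  (1 / 2 : ℂ) • (S.torsion nablaU nablaV x (u₁ ⊗ₜ v₁) (u₂ ⊗ₜ v₂) +
    S.torsion nablaU nablaV x (u₁ ⊗ₜ v₂) (u₂ ⊗ₜ v₁))

/-- The curvature `R(X, Y) w = ([∇_X, ∇_Y] - ∇_{[X, Y]}) w`, computed with holomorphic extensions
of `X`, `Y` and `w` to a neighbourhood of `x`. -/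
def curvature {F : Type*} [NormedAddCommGroup F] [NormedSpace ℂ F]
    {W : M → Type*} [TopologicalSpace (TotalSpace F W)]
    [∀ x, AddCommGroup (W x)] [∀ x, Module ℂ (W x)] [∀ x, TopologicalSpace (W x)]
    [∀ x, IsTopologicalAddGroup (W x)] [∀ x, ContinuousSMul ℂ (W x)]
    [FiberBundle F W] (nabla : CovariantDerivative 𝓘(ℂ, E) F W)
    (x : M) (X Y : TangentSpace 𝓘(ℂ, E) x) (w : W x) : W x :=
  let X' : Π y : M, TangentSpace 𝓘(ℂ, E) y := FiberBundle.extend E X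
  let Y' : Π y : M, TangentSpace 𝓘(ℂ, E) y := FiberBundle.extend E Y
  let w' : Π y : M, W y := FiberBundle.extend F w
  nabla (fun y => nabla w' y (Y' y)) x X - nabla (fun y => nabla w' y (X' y)) x Y -
    nabla w' x (VectorField.mlieBracket 𝓘(ℂ, E) X' Y' x)

/-- The component of the curvature `R⁺` of `V` in `Λ²U* ⊗ V ⊗ V* ⊗ S²V*`, completely symmetrised
in its lower `V` indices. -/
def curvatureSym (x : M) (u₁ u₂ : U x) (v : Fin 3 → V x) : V x :=
  (1 / 6 : ℂ) • ∑ σ : Equiv.Perm (Fin 3),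
    curvature nablaV x ((S.iso x).symm (u₁ ⊗ₜ v (σ 0))) ((S.iso x).symm (u₂ ⊗ₜ v (σ 1))) (v (σ 2))

/-- The trace of `curvatureSym` over the upper and one lower `V` index. -/
def curvatureSymTrace (x : M) (u₁ u₂ : U x) (v₁ v₂ : V x) : ℂ :=
  let b := (trivializationAt F₂ V x).basisAt (finBasis ℂ F₂)
    (FiberBundle.mem_baseSet_trivializationAt F₂ V x)
  ∑ i, b.repr (S.curvatureSym nablaV x u₁ u₂ ![b i, v₁, v₂]) i

/-- The positive part `W⁺` of the Weyl tensor: the trace-free part of `curvatureSym`. -/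
def weylPlus (x : M) (u₁ u₂ : U x) (v₁ v₂ v₃ : V x) : V x :=
  S.curvatureSym nablaV x u₁ u₂ ![v₁, v₂, v₃] - (1 / (q + 2) : ℂ) •
    (S.curvatureSymTrace nablaV x u₁ u₂ v₂ v₃ • v₁ +
      S.curvatureSymTrace nablaV x u₁ u₂ v₁ v₃ • v₂ +
      S.curvatureSymTrace nablaV x u₁ u₂ v₁ v₂ • v₃)

/-- Right-flatness over a subset of `M`: `T⁺ = 0` if `p > 2`, and `W⁺ = 0` if `p = 2`. -/
def IsRightFlatOn (O : Set M) : Prop :=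
  ∀ x ∈ O,
    (2 < p → ∀ (u₁ u₂ : U x) (v₁ v₂ : V x), S.torsionPlus nablaU nablaV x u₁ u₂ v₁ v₂ = 0) ∧
    (p = 2 → ∀ (u₁ u₂ : U x) (v₁ v₂ v₃ : V x), S.weylPlus nablaV x u₁ u₂ v₁ v₂ v₃ = 0)

/-- The paraconformal structure is right-flat. -/
def IsRightFlat : Prop := S.IsRightFlatOn nablaU nablaV univ

/-! ### The distribution `T` on the total space of `V` -/

/-- The vertical tangent vector at `z` given by an element `w` of the fibre. -/
def vertical (z : TotalSpace F₂ V) (w : V z.proj) :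
    TangentSpace (𝓘(ℂ, E).prod 𝓘(ℂ, F₂)) z :=
  mfderiv 𝓘(ℂ, ℂ) (𝓘(ℂ, E).prod 𝓘(ℂ, F₂))
    (fun t : ℂ => (⟨z.proj, z.snd + t • w⟩ : TotalSpace F₂ V)) 0 (1 : ℂ)

/-- The horizontal lift of `X` to the point `z` of the total space of `V`: it equals
`ds(X) - vertical (∇_X s)` for a local section `s` through `z`. -/
def horizontalLift (z : TotalSpace F₂ V) (X : TangentSpace 𝓘(ℂ, E) z.proj) :
    TangentSpace (𝓘(ℂ, E).prod 𝓘(ℂ, F₂)) z :=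
  let s : Π y : M, V y := FiberBundle.extend F₂ z.snd
  let ds : TangentSpace (𝓘(ℂ, E).prod 𝓘(ℂ, F₂)) z :=
    mfderiv 𝓘(ℂ, E) (𝓘(ℂ, E).prod 𝓘(ℂ, F₂)) (T% s) z.proj X
  ds - vertical z (nablaV s z.proj X)

/-- The vector field `v_u = π^{A'} u^A D_{AA'}` on the total space of `V`. -/
def twistorField (u : Π y : M, U y) (z : TotalSpace F₂ V) :
    TangentSpace (𝓘(ℂ, E).prod 𝓘(ℂ, F₂)) z :=
  horizontalLift nablaV z ((S.iso z.proj).symm (u z.proj ⊗ₜ z.snd))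

/-- The distribution `T` on the total space of `V`, spanned by the `v_A = π^{A'} D_{AA'}`. -/
def distribution (z : TotalSpace F₂ V) :
    Submodule ℂ (TangentSpace (𝓘(ℂ, E).prod 𝓘(ℂ, F₂)) z) :=
  Submodule.span ℂ (range fun u : Π y : M, U y => S.twistorField nablaV u z)

/-! ### The distribution on `P(V)`

The projective bundle is described by its affine charts: a holomorphic frame `t` of `V` over an open
set `O` and an index `k` give coordinates `λⁱ = πⁱ / πᵏ`, `i ≠ k`, on the fibres over `O`, so that
the part `πᵏ ≠ 0` of `P(V)` over `O` is `O × ℂ^{q-1}`. -/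

/-- The homogeneous coordinates `πⁱ = λⁱ` for `i ≠ k`, `πᵏ = 1`. -/
def homogeneous (k : Fin q) (l : {i : Fin q // i ≠ k} → ℂ) (i : Fin q) : ℂ :=
  if h : i = k then 1 else l ⟨i, h⟩

section Frame

variable {O : Set M} {s : Fin p → Π y : M, U y} {t : Fin q → Π y : M, V y}

/-- The projection `(x, π) ↦ (x, πⁱ / πᵏ)` to the affine chart. -/
def affineProj (ht : IsLocalFrameOn 𝓘(ℂ, E) F₂ ω t O) (k : Fin q) (z : TotalSpace F₂ V) :
    M × ({i : Fin q // i ≠ k} → ℂ) :=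
  (z.proj, fun i => ht.coeff i z.proj z.snd / ht.coeff k z.proj z.snd)

variable (F₂) in
/-- The representative `t_k + ∑_{i ≠ k} λⁱ tᵢ` of a point of the affine chart. -/
def affineLift (t : Fin q → Π y : M, V y) (k : Fin q) (y : M × ({i : Fin q // i ≠ k} → ℂ)) :
    TotalSpace F₂ V :=
  ⟨y.1, ∑ i, homogeneous k y.2 i • t i y.1⟩

/-- The projection of the distribution `T` to `P(V)`, in an affine chart. -/
def projDistribution (ht : IsLocalFrameOn 𝓘(ℂ, E) F₂ ω t O) (k : Fin q)
    (y : M × ({i : Fin q // i ≠ k} → ℂ)) :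
    Submodule ℂ (TangentSpace (𝓘(ℂ, E).prod 𝓘(ℂ, {i : Fin q // i ≠ k} → ℂ)) y) :=
  (S.distribution nablaV (affineLift F₂ t k y)).map
    (mfderiv (𝓘(ℂ, E).prod 𝓘(ℂ, F₂)) (𝓘(ℂ, E).prod 𝓘(ℂ, {i : Fin q // i ≠ k} → ℂ))
      (affineProj ht k) (affineLift F₂ t k y)).toLinearMap

/-- The projection of `T` to `P(V)` is involutive, i.e. it is so in every affine chart. -/
def IsInvolutiveOnProj : Prop :=
  ∀ (O : Set M) (_ : IsOpen O) (t : Fin q → Π y : M, V y)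
    (ht : IsLocalFrameOn 𝓘(ℂ, E) F₂ ω t O) (k : Fin q),
    IsInvolutiveOn (𝓘(ℂ, E).prod 𝓘(ℂ, {i : Fin q // i ≠ k} → ℂ))
      (S.projDistribution nablaV ht k) (O ×ˢ univ)

/-- The components `γ_{AA'}{}^i{}_j` of the connection on `V`: `∇_{e_{AA'}} t_j = γ_{AA'}{}^i{}_j tᵢ`,
with `e_{AA'} = α⁻¹(s_A ⊗ t_{A'})`. -/
def connectionCoeff (s : Fin p → Π y : M, U y) (ht : IsLocalFrameOn 𝓘(ℂ, E) F₂ ω t O)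
    (A : Fin p) (A' i j : Fin q) (x : M) : ℂ :=
  ht.coeff i x (nablaV (t j) x (S.tmul (s A) (t A') x))

/-- The components `A_{AA'}{}^i`, quadratic in `λ`, of the projective connection. -/
def projConnection (s : Fin p → Π y : M, U y) (ht : IsLocalFrameOn 𝓘(ℂ, E) F₂ ω t O)
    (k : Fin q) (A : Fin p) (A' i : Fin q) (y : M × ({i : Fin q // i ≠ k} → ℂ)) : ℂ :=
  ∑ j, S.connectionCoeff nablaV s ht A A' i j y.1 * homogeneous k y.2 j -
    homogeneous k y.2 i *
      ∑ j, S.connectionCoeff nablaV s ht A A' k j y.1 * homogeneous k y.2 j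

/-- The operators `D_{AA'} = e_{AA'} - ∑ᵢ A_{AA'}{}^i ∂/∂λⁱ`. -/
def laxD (s : Fin p → Π y : M, U y) (ht : IsLocalFrameOn 𝓘(ℂ, E) F₂ ω t O)
    (k : Fin q) (A : Fin p) (A' : Fin q) (y : M × ({i : Fin q // i ≠ k} → ℂ)) :
    TangentSpace (𝓘(ℂ, E).prod 𝓘(ℂ, {i : Fin q // i ≠ k} → ℂ)) y :=
  ((S.tmul (s A) (t A') y.1 : E),
    (fun i => -S.projConnection nablaV s ht k A A' i y : {i : Fin q // i ≠ k} → ℂ))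

/-- The operators `v_A = D_{Ak} + ∑_{i ≠ k} λⁱ D_{Ai}` of the Lax `p`-tuple. -/
def laxField (s : Fin p → Π y : M, U y) (ht : IsLocalFrameOn 𝓘(ℂ, E) F₂ ω t O)
    (k : Fin q) (A : Fin p) (y : M × ({i : Fin q // i ≠ k} → ℂ)) :
    TangentSpace (𝓘(ℂ, E).prod 𝓘(ℂ, {i : Fin q // i ≠ k} → ℂ)) y :=
  ∑ A', homogeneous k y.2 A' • S.laxD nablaV s ht k A A' y

/-- The Lax `p`-tuple equations `[v_A, v_B] = ∑_C C_{AB}{}^C v_C` with given functions `C`. -/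
def IsLaxTuple (s : Fin p → Π y : M, U y) (ht : IsLocalFrameOn 𝓘(ℂ, E) F₂ ω t O)
    (k : Fin q) (C : Fin p → Fin p → Fin p → M × ({i : Fin q // i ≠ k} → ℂ) → ℂ) : Prop :=
  ∀ A B, ∀ y ∈ O ×ˢ (univ : Set ({i : Fin q // i ≠ k} → ℂ)),
    VectorField.mlieBracket (𝓘(ℂ, E).prod 𝓘(ℂ, {i : Fin q // i ≠ k} → ℂ))
      (S.laxField nablaV s ht k A) (S.laxField nablaV s ht k B) y =
    ∑ D, C A B D y • S.laxField nablaV s ht k D y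

end Frame

end ParaconformalStructure

end Setup

end Paraconformal

end

/-!
In frames of `U` and `V`, the twistor distribution is spanned by the fields `v_A = ∑ i, πⁱ D_{Ai}`,
and their brackets are
`[v_A, v_B] = ∑ E, C_{AB}^E v_E - ∑ d, T_{AB}^d D_d - ∑ i, r_{AB}^i ∂/∂πⁱ`,
where `T_{AB}` is the torsion on `s_A ⊗ π`, `s_B ⊗ π`, and `r_{AB}` the curvature on these vectors,
applied to `π` (`TwistorCalculus.lie_v`). The same formula holds in the affine coordinates of `P(V)`,
with the fields `∂/∂πⁱ` replaced by their projections. This identity is purely algebraic; it is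
proved for derivations of a ring of functions, and transferred to vector fields in
`FrameData.mlieBracket_fieldV`.

Hence the distribution is closed under brackets exactly if the torsion maps pairs in `U ⊗ π` to
`U ⊗ π` and `r_{AB}` vanishes; on `P(V)`, it is enough that `r_{AB}` is a multiple of `π`. These
conditions are compared with right-flatness.

* A trace-free torsion which maps pairs in `U ⊗ π` to `U ⊗ π` for all `π` vanishes on them, by
  polarisation (`TorsionTraceFree.torsionFlatAt`). For `p = 2` it vanishes there in any case
  (`TorsionTraceFree.torsionFlatAt_of_two`), and `T⁺` is the polarisation of this restriction of the
  torsion. The tensor `W⁺` vanishes exactly if `r_{AB}` is a multiple of `π` for all `π`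
  (`weylPlus_eq_zero_iff`). So closed brackets imply right-flatness, even when they are only known
  in an affine chart of `P(V)`, whose points are dense (`isRightFlatOn_of_lax`).
* Conversely, let the structure be right-flat over an open set. If `p > 2`, the torsion vanishes
  along `U ⊗ π`, and the Jacobi identity for three different `v_A` shows that `r_{AB} = ρ_{AB} π`
  (`TwistorCalculus.IsCone.r_parallel`). If `p = 2`, this is the assumption `W⁺ = 0`. It remains to
  show `ρ = 0`, so that torsion and curvature both vanish along the distribution
  (`IsScaleConnection.isRightFlatOn_iff`). Here the scale enters: in frames adapted to it the
  connection forms are trace-free, and the total space carries a volume form for which the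
  divergences of the `v_A` and of the Euler field are known. The bracket
  `[v_A, v_B] = ∑ E, C_{AB}^E v_E - ρ_{AB} Euler` gives one relation on taking divergences and another
  one on tracing the Jacobi identity of the frame `v_A`, `Euler`; the difference of both is
  `(p + q) ρ_{AB} = 0` (`TwistorCalculus.IsCone.r_eq_zero`).

A holomorphic vector field with values in the distribution is a holomorphic combination of the `v_A`
wherever some `πᵏ` is non-zero (`mlieBracket_mem_span`), so involutivity may be tested on the `v_A`.
On the zero section of `V` the distribution degenerates to zero, but there the bracket of two fields
with values in it vanishes as well. The coefficients `C_{AB}^E` on `P(V)` are unique, and are read off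
from the components of the brackets along the `e_{Ek}`, which are polynomials of degree two in the
`λⁱ` (`laxPoly`).
-/

set_option linter.unusedSectionVars false

noncomputable section

namespace Paraconformal

/-! ### Frames of derivations and divergence -/

section

section Frames

variable {S : Type*} [CommRing S] [Algebra ℂ S]

lemma lie_smul_derivation (X Y : Derivation ℂ S S) (f : S) :
    ⁅X, f • Y⁆ = f • ⁅X, Y⁆ + X f • Y := by
  ext h; simp [Derivation.commutator_apply]

lemma smul_lie_derivation (X Y : Derivation ℂ S S) (f : S) :
    ⁅f • X, Y⁆ = f • ⁅X, Y⁆ - Y f • X := by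
  ext h; simp [Derivation.commutator_apply]; ring

variable {ι : Type*} [Fintype ι]

/-- The derivation `∑ₐ yᵃ Xₐ` with components `y` in the family `X`. -/
def frameField (X : ι → Derivation ℂ S S) (y : ι → S) : Derivation ℂ S S := ∑ a, y a • X a

lemma frameField_apply (X : ι → Derivation ℂ S S) (y : ι → S) (f : S) :
    frameField X y f = ∑ a, y a * X a f := by
  rw [frameField, ← Derivation.coeFnAddMonoidHom_apply, map_sum, Finset.sum_apply]
  simp

/-- A finite family of derivations which is linearly independent over the functions and closed
under brackets, with structure functions `c`. -/
structure IsFrame (X : ι → Derivation ℂ S S) (c : ι → ι → ι → S) : Prop where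
  lie : ∀ a b, ⁅X a, X b⁆ = frameField X (c a b)
  indep : ∀ y, frameField X y = 0 → y = 0
  skew : ∀ a b d, c a b d = - c b a d

variable {X : ι → Derivation ℂ S S} {c : ι → ι → ι → S}

lemma frameField_add (X : ι → Derivation ℂ S S) (y z : ι → S) :
    frameField X (y + z) = frameField X y + frameField X z := by
  simp [frameField, add_smul, Finset.sum_add_distrib]

lemma frameField_smul (X : ι → Derivation ℂ S S) (f : S) (y : ι → S) :
    frameField X (f • y) = f • frameField X y := by
  simp [frameField, Finset.smul_sum, smul_smul]

lemma frameField_sub (X : ι → Derivation ℂ S S) (y z : ι → S) :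
    frameField X (y - z) = frameField X y - frameField X z := by
  simp [frameField, sub_smul, Finset.sum_sub_distrib]

lemma frameField_sum {κ : Type*} (s : Finset κ) (X : ι → Derivation ℂ S S) (y : κ → ι → S) :
    frameField X (∑ k ∈ s, y k) = ∑ k ∈ s, frameField X (y k) := by
  classical
  induction s using Finset.induction_on with
  | empty => simp [frameField]
  | insert k s hk ih => rw [Finset.sum_insert hk, Finset.sum_insert hk, frameField_add, ih]

lemma IsFrame.inj (h : IsFrame X c) {y z : ι → S} (hyz : frameField X y = frameField X z) :
    y = z := by
  rw [← sub_eq_zero]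
  exact h.indep _ (by rw [frameField_sub, hyz, sub_self])

/-- The components of a bracket with a member of the frame. -/
lemma IsFrame.lie_frameField (h : IsFrame X c) (a : ι) (z : ι → S) :
    ⁅X a, frameField X z⁆ = frameField X (fun d => X a (z d) + ∑ b, z b * c a b d) := by
  have : (fun d => X a (z d) + ∑ b, z b * c a b d) = (fun d => X a (z d)) + ∑ b, z b • c a b := by
    ext d; simp
  rw [this, frameField_add, frameField_sum]
  simp only [frameField_smul, ← h.lie]
  conv_lhs => rw [frameField]
  rw [lie_sum]
  simp only [lie_smul_derivation, Finset.sum_add_distrib]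
  rw [add_comm]; rfl

lemma IsFrame.jacobi (h : IsFrame X c) (a b d e : ι) :
    X a (c b d e) + X b (c d a e) + X d (c a b e) +
      ∑ f, (c b d f * c a f e + c d a f * c b f e + c a b f * c d f e) = 0 := by
  have key := lie_jacobi (X a) (X b) (X d)
  rw [h.lie b d, h.lie d a, h.lie a b, h.lie_frameField, h.lie_frameField, h.lie_frameField,
    ← frameField_add, ← frameField_add] at key
  have := congrFun (h.indep _ key) e
  simp only [Pi.add_apply, Pi.zero_apply] at this
  rw [← this]
  simp only [Finset.sum_add_distrib]
  ring

/-- The trace of the Jacobi identity, over its last two indices. -/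
lemma IsFrame.contracted_jacobi (h : IsFrame X c) (a b : ι) :
    ∑ d, (X d (c a b d) + X a (c b d d) - X b (c a d d)) + ∑ d, c a b d * ∑ e, c e d e = 0 := by
  have key : ∑ d, (X a (c b d d) + X b (c d a d) + X d (c a b d) +
      ∑ f, (c b d f * c a f d + c d a f * c b f d + c a b f * c d f d)) = 0 :=
    Finset.sum_eq_zero fun d _ => h.jacobi a b d d
  have h1 : ∑ d, ∑ f, c d a f * c b f d = - ∑ d, ∑ f, c b d f * c a f d := by
    rw [Finset.sum_comm, ← Finset.sum_neg_distrib]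
    refine Finset.sum_congr rfl fun f _ => ?_
    rw [← Finset.sum_neg_distrib]
    refine Finset.sum_congr rfl fun d _ => ?_
    rw [h.skew d a]; ring
  have h2 : ∑ d, X b (c d a d) = - ∑ d, X b (c a d d) := by
    rw [← Finset.sum_neg_distrib]
    exact Finset.sum_congr rfl fun d _ => by rw [h.skew d a]; simp
  have h3 : ∑ d, ∑ f, c a b f * c d f d = ∑ d, c a b d * ∑ e, c e d e := by
    rw [Finset.sum_comm]; simp [Finset.mul_sum]
  simp only [Finset.sum_add_distrib, Finset.sum_sub_distrib] at key ⊢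
  rw [h1, h2, h3] at key
  linear_combination key

/-- The divergence of the field with components `y`, with respect to the volume form which takes
the value `1` on the frame. -/
def frameDiv (X : ι → Derivation ℂ S S) (c : ι → ι → ι → S) (y : ι → S) : S :=
  ∑ a, X a (y a) + ∑ a, y a * ∑ d, c d a d

lemma IsFrame.lie_frameField_frameField (h : IsFrame X c) (y z : ι → S) :
    ⁅frameField X y, frameField X z⁆ = frameField X (fun d => frameField X y (z d) -
      frameField X z (y d) + ∑ a, ∑ b, y a * z b * c a b d) := by
  have e : (fun d => frameField X y (z d) -
      frameField X z (y d) + ∑ a, ∑ b, y a * z b * c a b d) =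
      ∑ a, (y a • (fun d => X a (z d) + ∑ b, z b * c a b d)) -
        (fun d => frameField X z (y d)) := by
    ext d
    simp only [frameField_apply, Pi.sub_apply, Finset.sum_apply, Pi.smul_apply, smul_eq_mul,
      mul_add, Finset.sum_add_distrib, Finset.mul_sum, mul_assoc]
    ring
  rw [e, frameField_sub, frameField_sum]
  simp only [frameField_smul, ← h.lie_frameField]
  conv_lhs => rw [show frameField X y = ∑ a, y a • X a from rfl]
  rw [sum_lie]
  simp only [smul_lie_derivation, Finset.sum_sub_distrib]
  rfl

/-- The divergence is a cocycle: `div [Y, Z] = Y (div Z) - Z (div Y)`. -/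
lemma IsFrame.frameDiv_lie (h : IsFrame X c) (y z w : ι → S)
    (hw : ⁅frameField X y, frameField X z⁆ = frameField X w) :
    frameDiv X c w = frameField X y (frameDiv X c z) - frameField X z (frameDiv X c y) := by
  rw [h.lie_frameField_frameField] at hw
  rw [← h.inj hw]
  -- the second order terms: `∑ₐ Xₐ` of the derivative of `v` along `u`
  have second : ∀ u v : ι → S, ∑ d, X d (frameField X u (v d)) =
      ∑ d, ∑ a, X d (u a) * X a (v d) + frameField X u (∑ d, X d (v d)) +
        ∑ d, ∑ a, u a * ∑ f, c d a f * X f (v d) := by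
    intro u v
    simp only [frameField_apply, map_sum, Derivation.leibniz, smul_eq_mul,
      Finset.sum_add_distrib, Finset.mul_sum]
    have : ∀ d a, X d (X a (v d)) = X a (X d (v d)) + ∑ f, c d a f * X f (v d) := by
      intro d a
      have := congrArg (fun D : Derivation ℂ S S => D (v d)) (h.lie d a)
      simp only [Derivation.commutator_apply, frameField_apply] at this
      linear_combination this
    simp only [this, mul_add, Finset.sum_add_distrib, Finset.mul_sum]
    rw [Finset.sum_comm (f := fun d a => u a * X a (X d (v d))),
      Finset.sum_congr rfl fun d _ => Finset.sum_congr rfl fun a _ => mul_comm (X a (v d)) _]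
    ring
  have cross : ∑ d, ∑ a, X d (y a) * X a (z d) = ∑ d, ∑ a, X d (z a) * X a (y d) := by
    rw [Finset.sum_comm]; simp [mul_comm]
  have struct : ∑ d, X d (∑ a, ∑ b, y a * z b * c a b d) =
      ∑ d, ∑ a, ∑ b, X d (y a) * z b * c a b d + ∑ d, ∑ a, ∑ b, y a * X d (z b) * c a b d +
        ∑ a, ∑ b, y a * z b * ∑ d, X d (c a b d) := by
    have : ∑ a, ∑ b, y a * z b * ∑ d, X d (c a b d) =
        ∑ d, ∑ a, ∑ b, y a * z b * X d (c a b d) := by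
      simp only [Finset.mul_sum]
      rw [Finset.sum_congr rfl fun a _ => Finset.sum_comm, Finset.sum_comm]
    rw [this]
    simp only [map_sum, Derivation.leibniz, smul_eq_mul, ← Finset.sum_add_distrib]
    refine Finset.sum_congr rfl fun d _ => Finset.sum_congr rfl fun a _ =>
      Finset.sum_congr rfl fun b _ => ?_
    ring
  have canc1 : ∑ d, ∑ a, y a * ∑ f, c d a f * X f (z d) =
      - ∑ d, ∑ a, ∑ b, y a * X d (z b) * c a b d := by
    simp only [Finset.mul_sum, ← Finset.sum_neg_distrib]
    rw [Finset.sum_congr rfl fun a _ => Finset.sum_comm, Finset.sum_comm]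
    refine Finset.sum_congr rfl fun d _ => ?_
    rw [Finset.sum_comm]
    refine Finset.sum_congr rfl fun a _ => Finset.sum_congr rfl fun b _ => ?_
    rw [h.skew a b d]; ring
  have canc2 : ∑ d, ∑ a, z a * ∑ f, c d a f * X f (y d) =
      ∑ d, ∑ a, ∑ b, X d (y a) * z b * c a b d := by
    simp only [Finset.mul_sum]
    rw [Finset.sum_congr rfl fun a _ => Finset.sum_comm, Finset.sum_comm]
    refine Finset.sum_congr rfl fun d _ => ?_
    refine Finset.sum_congr rfl fun a _ => Finset.sum_congr rfl fun b _ => ?_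
    ring
  have trace : ∀ u v : ι → S, frameField X u (∑ a, v a * ∑ d, c d a d) =
      ∑ a, frameField X u (v a) * ∑ d, c d a d + ∑ a, ∑ b, u a * v b * X a (∑ d, c d b d) := by
    intro u v
    simp only [map_sum, Derivation.leibniz, smul_eq_mul, Finset.sum_add_distrib]
    rw [add_comm]
    congr 1
    · exact Finset.sum_congr rfl fun a _ => by rw [mul_comm]
    · simp only [frameField_apply, Finset.mul_sum]
      rw [Finset.sum_congr rfl fun a _ => Finset.sum_comm, Finset.sum_comm]
      exact Finset.sum_congr rfl fun a _ => Finset.sum_congr rfl fun b _ =>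
        Finset.sum_congr rfl fun d _ => by ring
  -- the terms bilinear in `y` and `z` cancel by the trace of the Jacobi identity
  have cj : ∑ a, ∑ b, y a * z b * (∑ d, X d (c a b d) - X a (∑ d, c d b d) + X b (∑ d, c d a d) +
      ∑ d, c a b d * ∑ e, c e d e) = 0 := by
    refine Finset.sum_eq_zero fun a _ => Finset.sum_eq_zero fun b _ => ?_
    have := h.contracted_jacobi a b
    have s : ∀ x z', X x (∑ d, c d z' d) = - ∑ d, X x (c z' d d) := by
      intro x z'
      rw [map_sum, ← Finset.sum_neg_distrib]
      exact Finset.sum_congr rfl fun d _ => by rw [h.skew d z']; simp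
    rw [s a b, s b a]
    simp only [Finset.sum_add_distrib, Finset.sum_sub_distrib] at this
    linear_combination (y a * z b) * this
  have last : ∑ x, (∑ a, ∑ b, y a * z b * c a b x) * ∑ d, c d x d =
      ∑ a, ∑ b, y a * z b * ∑ d, c a b d * ∑ e, c e d e := by
    simp only [Finset.sum_mul]
    rw [Finset.sum_comm]
    refine Finset.sum_congr rfl fun a _ => ?_
    rw [Finset.sum_comm]
    refine Finset.sum_congr rfl fun b _ => ?_
    rw [Finset.mul_sum]
    exact Finset.sum_congr rfl fun d _ => by ring
  have swap : ∑ a, ∑ b, z a * y b * X a (∑ d, c d b d) =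
      ∑ a, ∑ b, y a * z b * X b (∑ d, c d a d) := by
    rw [Finset.sum_comm]
    exact Finset.sum_congr rfl fun a _ => Finset.sum_congr rfl fun b _ => by ring
  simp only [frameDiv, map_add, map_sub, add_mul, sub_mul, Finset.sum_add_distrib,
    Finset.sum_sub_distrib]
  rw [second, second, struct, trace, trace, cross, canc1, canc2, last, swap]
  simp only [mul_add, mul_sub, Finset.sum_add_distrib, Finset.sum_sub_distrib] at cj
  linear_combination cj

end Frames

end

/-! ### The brackets of a Lax tuple -/

section

/-- The algebraic data behind a Lax tuple, over a ring `S` of functions: derivations `e a`, which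
stand for a frame of the base, with structure functions `c`; vertical derivations `del i` in the
direction of the fibre coordinates `lam i`; functions `Γ a C B` and `γ a i j` which stand for
the coefficients of the connections on `U` and `V`, where the derivative index `a` comes first, and
the component index precedes the frame index.

The constants `sig` cover two cases at once: for `sig = 0` the `lam i` are the homogeneous
coordinates `πⁱ` and `del i = ∂/∂πⁱ`; for `sig` the indicator of `k` the `lam i` are the affine
coordinates `πⁱ / πᵏ`, and the `del i` are the projections of the fields `∂/∂πⁱ` to the affine
chart. -/
structure TwistorCalculus (p q : ℕ) (S : Type*) [CommRing S] [Algebra ℂ S] where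
  e : Fin p × Fin q → Derivation ℂ S S
  del : Fin q → Derivation ℂ S S
  lam : Fin q → S
  sig : Fin q → ℂ
  c : Fin p × Fin q → Fin p × Fin q → Fin p × Fin q → S
  Γ : Fin p × Fin q → Fin p → Fin p → S
  γ : Fin p × Fin q → Fin q → Fin q → S
  lie_e : ∀ a b, ⁅e a, e b⁆ = ∑ d, c a b d • e d
  lie_e_del : ∀ a i, ⁅e a, del i⁆ = 0
  lie_del : ∀ i j, ⁅del i, del j⁆ = sig i • del j - sig j • del i
  e_lam : ∀ a i, e a (lam i) = 0
  del_lam : ∀ i j, del i (lam j) = (if i = j then 1 else 0) - sig i • lam j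
  del_c : ∀ i a b d, del i (c a b d) = 0
  del_γ : ∀ i a j m, del i (γ a j m) = 0

namespace TwistorCalculus

variable {p q : ℕ} {S : Type*} [CommRing S] [Algebra ℂ S] (K : TwistorCalculus p q S)

/-- The components of `∇π` along `e a`, for `π` with constant components. -/
def gl (a : Fin p × Fin q) (i : Fin q) : S := ∑ j, K.γ a i j * K.lam j

/-- The vertical part of the horizontal lift of `e a`, up to sign. -/
def G (a : Fin p × Fin q) : Derivation ℂ S S := ∑ i, K.gl a i • K.del i

/-- The contraction of `∇π` with `sig`. It is zero in homogeneous coordinates, and the component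
`(∇π)ᵏ` in the affine coordinates `πⁱ / πᵏ`. -/
def kap (a : Fin p × Fin q) : S := ∑ i, K.sig i • K.gl a i

/-- The horizontal lift of `e a`. -/
def D (a : Fin p × Fin q) : Derivation ℂ S S := K.e a - K.G a

/-- The field `v_A = ∑ i, πⁱ D_{Ai}`. -/
def v (A : Fin p) : Derivation ℂ S S := ∑ i, K.lam i • K.D (A, i)

/-- The components of the torsion of the connection induced on `U ⊗ V`. -/
def T (a b d : Fin p × Fin q) : S :=
  (if d.2 = b.2 then K.Γ a d.1 b.1 else 0) + (if d.1 = b.1 then K.γ a d.2 b.2 else 0)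
    - (if d.2 = a.2 then K.Γ b d.1 a.1 else 0) - (if d.1 = a.1 then K.γ b d.2 a.2 else 0)
    - K.c a b d

/-- The components of the curvature of `V`. -/
def R (a b : Fin p × Fin q) (i j : Fin q) : S :=
  K.e a (K.γ b i j) - K.e b (K.γ a i j) + ∑ m, (K.γ a i m * K.γ b m j - K.γ b i m * K.γ a m j)
    - ∑ d, K.c a b d * K.γ d i j

/-- The components of the torsion on the vectors `s_A ⊗ π` and `s_B ⊗ π`. -/
def Tlam (A B : Fin p) (d : Fin p × Fin q) : S :=
  ∑ i, ∑ j, K.lam i * K.lam j * K.T (A, i) (B, j) d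

/-- The components of the curvature on `s_A ⊗ π` and `s_B ⊗ π`, applied to `π`. -/
def r (A B : Fin p) (m : Fin q) : S :=
  ∑ i, ∑ j, K.lam i * K.lam j * ∑ l, K.R (A, i) (B, j) m l * K.lam l

/-- The coefficient of `v_E` in the bracket `[v_A, v_B]`. -/
def C (A B E : Fin p) : S :=
  ∑ i, K.lam i * (K.Γ (A, i) E B - K.Γ (B, i) E A
    + (if E = B then K.kap (A, i) else 0) - (if E = A then K.kap (B, i) else 0))

lemma sum_derivation_apply {κ : Type*} (s : Finset κ) (f : κ → Derivation ℂ S S) (x : S) :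
    (∑ k ∈ s, f k) x = ∑ k ∈ s, f k x := by
  rw [← Derivation.coeFnAddMonoidHom_apply, map_sum, Finset.sum_apply]
  simp

lemma G_lam (a : Fin p × Fin q) (j : Fin q) : K.G a (K.lam j) = K.gl a j - K.kap a * K.lam j := by
  simp [G, sum_derivation_apply, K.del_lam, mul_sub, kap, Finset.sum_mul, Algebra.smul_def]
  exact Finset.sum_congr rfl fun _ _ => by ring

lemma D_lam (a : Fin p × Fin q) (j : Fin q) :
    K.D a (K.lam j) = - K.gl a j + K.kap a * K.lam j := by
  rw [D, Derivation.sub_apply, K.e_lam, G_lam]; ring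

lemma G_γ (a b : Fin p × Fin q) (i j : Fin q) : K.G a (K.γ b i j) = 0 := by
  simp [G, sum_derivation_apply, K.del_γ]

lemma lie_G (a b : Fin p × Fin q) :
    ⁅K.G a, K.G b⁆ = ∑ i, (∑ m, ∑ j, (K.γ b i m * K.γ a m j - K.γ a i m * K.γ b m j) * K.lam j) •
      K.del i := by
  have h1 : ∀ a b i, K.G a (K.gl b i) = ∑ m, ∑ j, K.γ b i m * K.γ a m j * K.lam j
      - K.kap a * K.gl b i := by
    intro a b i
    simp only [gl, map_sum, Derivation.leibniz, G_γ, G_lam, smul_eq_mul, mul_zero, add_zero,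
      Finset.mul_sum, mul_sub, Finset.sum_sub_distrib, mul_assoc]
    congr 1
    exact Finset.sum_congr rfl fun _ _ => by ring
  have h2 : ∑ i, ∑ j, (K.gl a i * K.gl b j) • ⁅K.del i, K.del j⁆ =
      K.kap a • K.G b - K.kap b • K.G a := by
    simp only [K.lie_del, smul_sub, Finset.sum_sub_distrib, G, kap, Finset.sum_smul,
      Finset.smul_sum]
    congr 1
    · rw [Finset.sum_comm]
      refine Finset.sum_congr rfl fun i _ => Finset.sum_congr rfl fun j _ => ?_
      ext x; simp [Algebra.smul_def]; ring
    · refine Finset.sum_congr rfl fun i _ => Finset.sum_congr rfl fun j _ => ?_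
      ext x; simp [Algebra.smul_def]; ring
  have h3 : ⁅K.G a, K.G b⁆ = ∑ i, K.G a (K.gl b i) • K.del i - ∑ i, K.G b (K.gl a i) • K.del i
      + ∑ i, ∑ j, (K.gl a i * K.gl b j) • ⁅K.del i, K.del j⁆ := by
    conv_lhs => rw [show K.G b = ∑ j, K.gl b j • K.del j from rfl, lie_sum]
    simp only [lie_smul_derivation, Finset.sum_add_distrib]
    have : ∀ j, ⁅K.G a, K.del j⁆ = ∑ i, K.gl a i • ⁅K.del i, K.del j⁆
        - ∑ i, K.del j (K.gl a i) • K.del i := by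
      intro j
      conv_lhs => rw [show K.G a = ∑ j, K.gl a j • K.del j from rfl, sum_lie]
      simp only [smul_lie_derivation, Finset.sum_sub_distrib]
    simp only [this, smul_sub, Finset.sum_sub_distrib, Finset.smul_sum, smul_smul]
    have e1 : ∑ i, K.G b (K.gl a i) • K.del i = ∑ j, ∑ i, (K.gl b j * K.del j (K.gl a i)) • K.del i := by
      rw [Finset.sum_comm]
      refine Finset.sum_congr rfl fun i _ => ?_
      rw [G, sum_derivation_apply, Finset.sum_smul]
      simp
    have e2 : ∑ j, ∑ i, (K.gl b j * K.gl a i) • ⁅K.del i, K.del j⁆ =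
        ∑ i, ∑ j, (K.gl a i * K.gl b j) • ⁅K.del i, K.del j⁆ := by
      rw [Finset.sum_comm]; simp [mul_comm]
    rw [e1, e2]
    abel
  rw [h3, h2]
  simp only [h1, sub_smul, Finset.sum_sub_distrib, sub_mul]
  simp only [G, Finset.smul_sum, smul_smul]
  abel

/-- The brackets of the horizontal lifts: their vertical part is the curvature. -/
lemma lie_D (a b : Fin p × Fin q) :
    ⁅K.D a, K.D b⁆ = ∑ d, K.c a b d • K.D d - ∑ i, (∑ j, K.R a b i j * K.lam j) • K.del i := by
  have h1 : ∀ a b, ⁅K.e a, K.G b⁆ = ∑ i, (∑ j, K.e a (K.γ b i j) * K.lam j) • K.del i := by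
    intro a b
    rw [G, lie_sum]
    refine Finset.sum_congr rfl fun i _ => ?_
    rw [lie_smul_derivation, K.lie_e_del, smul_zero, zero_add]
    simp [gl, K.e_lam, mul_comm]
  have h2 : ⁅K.D a, K.D b⁆ = ⁅K.e a, K.e b⁆ - ⁅K.e a, K.G b⁆ + ⁅K.e b, K.G a⁆ + ⁅K.G a, K.G b⁆ := by
    rw [D, D, sub_lie, lie_sub, lie_sub, ← lie_skew (K.G a) (K.e b)]
    abel
  rw [h2, h1, h1, lie_G, K.lie_e]
  simp only [D, smul_sub, Finset.sum_sub_distrib]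
  have h3 : ∑ d, K.c a b d • K.G d = ∑ i, (∑ j, (∑ d, K.c a b d * K.γ d i j) * K.lam j) • K.del i := by
    simp only [G, gl, Finset.smul_sum]
    rw [Finset.sum_comm]
    refine Finset.sum_congr rfl fun i _ => ?_
    simp only [smul_smul, ← Finset.sum_smul, Finset.mul_sum, Finset.sum_mul]
    rw [Finset.sum_comm]
    simp only [mul_assoc]
  rw [h3]
  have h4 : ∀ i, ∑ j, K.R a b i j * K.lam j = ∑ j, K.e a (K.γ b i j) * K.lam j
      - ∑ j, K.e b (K.γ a i j) * K.lam j
      - ∑ m, ∑ j, (K.γ b i m * K.γ a m j - K.γ a i m * K.γ b m j) * K.lam j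
      - ∑ j, (∑ d, K.c a b d * K.γ d i j) * K.lam j := by
    intro i
    rw [Finset.sum_comm (f := fun m j => (K.γ b i m * K.γ a m j - K.γ a i m * K.γ b m j) * K.lam j),
      ← Finset.sum_sub_distrib, ← Finset.sum_sub_distrib, ← Finset.sum_sub_distrib]
    refine Finset.sum_congr rfl fun j _ => ?_
    simp only [R, ← Finset.sum_mul, Finset.sum_sub_distrib]
    ring
  simp only [h4, sub_smul, Finset.sum_sub_distrib]
  abel

/-- The bracket of the fields of a Lax tuple: a combination of these fields, corrected by torsion and
curvature along `U ⊗ π`. -/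
lemma lie_v (A B : Fin p) :
    ⁅K.v A, K.v B⁆ = ∑ E, K.C A B E • K.v E - ∑ d, K.Tlam A B d • K.D d
      - ∑ m, K.r A B m • K.del m := by
  have h1 : ⁅K.v A, K.v B⁆ = ∑ i, ∑ j, (K.lam i * K.lam j) • ⁅K.D (A, i), K.D (B, j)⁆
      + ∑ i, ∑ j, (K.lam i * K.D (A, i) (K.lam j)) • K.D (B, j)
      - ∑ i, ∑ j, (K.lam i * K.D (B, i) (K.lam j)) • K.D (A, j) := by
    rw [v, v, sum_lie]
    simp only [lie_sum, smul_lie_derivation, lie_smul_derivation, Derivation.smul_apply,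
      smul_eq_mul, Finset.sum_add_distrib]
    simp only [smul_sub, smul_smul, Finset.sum_sub_distrib]
    rw [Finset.sum_comm (f := fun x y => (K.lam y * K.D (B, y) (K.lam x)) • K.D (A, x)),
      Finset.sum_congr rfl fun i _ => Finset.sum_congr rfl fun j _ =>
        congrArg (· • ⁅K.D (A, i), K.D (B, j)⁆) (mul_comm (K.lam j) (K.lam i))]
    abel
  rw [h1]
  have h2 : ∑ i, ∑ j, (K.lam i * K.lam j) • ⁅K.D (A, i), K.D (B, j)⁆ =
      ∑ d, (∑ i, ∑ j, K.lam i * K.lam j * K.c (A, i) (B, j) d) • K.D d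
        - ∑ m, K.r A B m • K.del m := by
    simp only [lie_D, smul_sub, Finset.sum_sub_distrib, Finset.smul_sum, smul_smul, r,
      Finset.sum_smul, Finset.mul_sum]
    congr 1
    · rw [Finset.sum_comm]
      rw [Finset.sum_congr rfl fun i _ => Finset.sum_comm]
      rw [Finset.sum_comm]
      rw [Finset.sum_congr rfl fun i _ => Finset.sum_comm]
    · rw [Finset.sum_congr rfl fun i _ => Finset.sum_comm]
      rw [Finset.sum_comm]
  have h3 : ∀ A B, ∑ i, ∑ j, (K.lam i * K.D (A, i) (K.lam j)) • K.D (B, j) =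
      ∑ d : Fin p × Fin q, (if d.1 = B then ∑ i, K.lam i * K.kap (A, i) * K.lam d.2
        - ∑ i, ∑ j, K.lam i * K.lam j * K.γ (A, i) d.2 j else 0) • K.D d := by
    intro A B
    rw [Fintype.sum_prod_type, Finset.sum_eq_single B]
    · rw [Finset.sum_comm]
      refine Finset.sum_congr rfl fun j _ => ?_
      rw [← Finset.sum_smul]
      congr 1
      simp only [D_lam, if_true, gl, ← Finset.sum_sub_distrib]
      refine Finset.sum_congr rfl fun i _ => ?_
      rw [mul_add, mul_neg, Finset.mul_sum, ← Finset.sum_neg_distrib, add_comm,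
        sub_eq_add_neg, ← Finset.sum_neg_distrib]
      congr 1
      · ring
      · exact Finset.sum_congr rfl fun _ _ => by ring
    · intro E _ hE
      simp [hE]
    · simp
  have h4 : ∑ E, K.C A B E • K.v E = ∑ d : Fin p × Fin q, (K.C A B d.1 * K.lam d.2) • K.D d := by
    rw [Fintype.sum_prod_type]
    simp [v, Finset.smul_sum, smul_smul]
  rw [h2, h3, h3, h4]
  have h5 : ∀ d : Fin p × Fin q, ∑ i, ∑ j, K.lam i * K.lam j * K.c (A, i) (B, j) d
      + (if d.1 = B then ∑ i, K.lam i * K.kap (A, i) * K.lam d.2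
        - ∑ i, ∑ j, K.lam i * K.lam j * K.γ (A, i) d.2 j else 0)
      - (if d.1 = A then ∑ i, K.lam i * K.kap (B, i) * K.lam d.2
        - ∑ i, ∑ j, K.lam i * K.lam j * K.γ (B, i) d.2 j else 0)
      = K.C A B d.1 * K.lam d.2 - K.Tlam A B d := by
    rintro ⟨E, m⟩
    have t1 : ∑ i, ∑ j, K.lam i * K.lam j * (if m = j then K.Γ (A, i) E B else 0) =
        ∑ i, K.lam i * K.Γ (A, i) E B * K.lam m := by
      refine Finset.sum_congr rfl fun i _ => ?_
      simp; ring
    have t2 : ∑ i, ∑ j, K.lam i * K.lam j * (if m = i then K.Γ (B, j) E A else 0) =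
        ∑ i, K.lam i * K.Γ (B, i) E A * K.lam m := by
      rw [Finset.sum_comm]
      refine Finset.sum_congr rfl fun i _ => ?_
      simp; ring
    have t3 : ∑ i, ∑ j, K.lam i * K.lam j * (if E = B then K.γ (A, i) m j else 0) =
        if E = B then ∑ i, ∑ j, K.lam i * K.lam j * K.γ (A, i) m j else 0 := by
      split_ifs <;> simp
    have t4 : ∑ i, ∑ j, K.lam i * K.lam j * (if E = A then K.γ (B, j) m i else 0) =
        if E = A then ∑ i, ∑ j, K.lam i * K.lam j * K.γ (B, i) m j else 0 := by
      split_ifs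
      · rw [Finset.sum_comm]
        exact Finset.sum_congr rfl fun _ _ => Finset.sum_congr rfl fun _ _ => by ring
      · simp
    have t5 : K.C A B E * K.lam m = ∑ i, K.lam i * K.Γ (A, i) E B * K.lam m
        - ∑ i, K.lam i * K.Γ (B, i) E A * K.lam m
        + (if E = B then ∑ i, K.lam i * K.kap (A, i) * K.lam m else 0)
        - (if E = A then ∑ i, K.lam i * K.kap (B, i) * K.lam m else 0) := by
      rw [C, Finset.sum_mul]
      have : ∀ (P : Prop) [Decidable P] (f : Fin q → S), (if P then ∑ i, f i else 0) =
        ∑ i, if P then f i else 0 := by intro P _ f; split_ifs <;> simp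
      rw [this, this, ← Finset.sum_sub_distrib, ← Finset.sum_add_distrib, ← Finset.sum_sub_distrib]
      refine Finset.sum_congr rfl fun i _ => ?_
      split_ifs <;> ring
    simp only [Tlam, T, mul_sub, mul_add, Finset.sum_sub_distrib, Finset.sum_add_distrib]
    rw [t1, t2, t3, t4, t5]
    split_ifs <;> ring
  have h6 : ∀ f g : Fin p × Fin q → S, ∑ d, f d • K.D d + ∑ d, g d • K.D d =
      ∑ d, (f d + g d) • K.D d := by
    intro f g; simp [add_smul, Finset.sum_add_distrib]
  have h7 : ∀ f g : Fin p × Fin q → S, ∑ d, f d • K.D d - ∑ d, g d • K.D d =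
      ∑ d, (f d - g d) • K.D d := by
    intro f g; simp [sub_smul, Finset.sum_sub_distrib]
  rw [h7, ← Finset.sum_congr rfl fun d _ => congrArg (· • K.D d) (h5 d), ← h7, ← h6]
  abel

end TwistorCalculus

end

/-! ### Homogeneity and the Euler field -/

section

namespace TwistorCalculus

variable {p q : ℕ} {S : Type*} [CommRing S] [Algebra ℂ S] (K : TwistorCalculus p q S)

/-- The frame made up of the `e a` and the vertical fields `∂/∂πⁱ`. -/
def frame : (Fin p × Fin q) ⊕ Fin q → Derivation ℂ S S := Sum.elim K.e K.del

/-- The structure functions of `frame`; only those of the `e a` are non-zero. -/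
def frameStr (a b d : (Fin p × Fin q) ⊕ Fin q) : S :=
  match a, b, d with
  | .inl a, .inl b, .inl d => K.c a b d
  | _, _, _ => 0

/-- The case of homogeneous coordinates on the total space of `V`, away from the zero section: the
derivations `e a` and `del i` are linearly independent, and the coordinates `πⁱ` have no common
annihilator. -/
structure IsCone : Prop where
  sig : ∀ i, K.sig i = 0
  skew : ∀ a b d, K.c a b d = - K.c b a d
  indep : ∀ y, frameField K.frame y = 0 → y = 0
  cancel : ∀ f : S, (∀ i, f * K.lam i = 0) → f = 0

variable {K}

lemma frameField_frame (y : (Fin p × Fin q) ⊕ Fin q → S) :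
    frameField K.frame y = ∑ d, y (.inl d) • K.e d + ∑ i, y (.inr i) • K.del i := by
  simp [frameField, frame]

lemma IsCone.isFrame (h : K.IsCone) : IsFrame K.frame K.frameStr where
  lie a b := by
    rcases a with a | i <;> rcases b with b | j
    · rw [frameField_frame]; simp [frame, frameStr, K.lie_e]
    · rw [frameField_frame]; simp [frame, frameStr, K.lie_e_del]
    · rw [← lie_skew, frameField_frame]; simp [frame, frameStr, K.lie_e_del]
    · rw [frameField_frame]; simp [frame, frameStr, K.lie_del, h.sig]
  indep := h.indep
  skew a b d := by
    rcases a with a | i <;> rcases b with b | j <;> rcases d with d | k <;>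
      first | exact h.skew _ _ _ | simp [frameStr]

variable (K) in
/-- The components of `v A` in `frame`. -/
def vComp (A : Fin p) : (Fin p × Fin q) ⊕ Fin q → S :=
  Sum.elim (fun d => if d.1 = A then K.lam d.2 else 0) fun m => - ∑ i, K.lam i * K.gl (A, i) m

variable (K) in
/-- The components of the Euler field in `frame`. -/
def eulerComp : (Fin p × Fin q) ⊕ Fin q → S := Sum.elim 0 K.lam

variable (K) in
/-- The Euler field `πⁱ ∂/∂πⁱ`. -/
def euler : Derivation ℂ S S := ∑ i, K.lam i • K.del i

lemma frameField_vComp (A : Fin p) : frameField K.frame (K.vComp A) = K.v A := by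
  rw [frameField_frame, Fintype.sum_prod_type, Finset.sum_eq_single A]
  · simp only [vComp, v, D, G, smul_sub, Finset.sum_sub_distrib, Sum.elim_inl, Sum.elim_inr,
      if_true, neg_smul, Finset.sum_neg_distrib, ← sub_eq_add_neg, Finset.smul_sum, smul_smul,
      Finset.sum_smul]
    rw [Finset.sum_comm (f := fun i j => (K.lam i * K.gl (A, i) j) • K.del j)]
  · intro E _ hE
    simp [vComp, hE]
  · simp

lemma frameField_eulerComp : frameField K.frame K.eulerComp = K.euler := by
  simp [frameField_frame, eulerComp, euler]

lemma IsCone.del_lam (h : K.IsCone) (i j : Fin q) :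
    K.del i (K.lam j) = if i = j then 1 else 0 := by
  simp [K.del_lam, h.sig]

lemma IsCone.euler_lam (h : K.IsCone) (j : Fin q) : K.euler (K.lam j) = K.lam j := by
  simp [euler, sum_derivation_apply, h.del_lam]

lemma euler_apply (f : S) : K.euler f = ∑ i, K.lam i * K.del i f := by
  simp [euler, sum_derivation_apply]

lemma del_e (i : Fin q) (a : Fin p × Fin q) (f : S) : K.del i (K.e a f) = K.e a (K.del i f) := by
  have := congrArg (fun X : Derivation ℂ S S => X f) (K.lie_e_del a i)
  simp only [Derivation.commutator_apply, Derivation.zero_apply] at this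
  exact (sub_eq_zero.1 this).symm

lemma del_R (i : Fin q) (a b : Fin p × Fin q) (j l : Fin q) : K.del i (K.R a b j l) = 0 := by
  simp [R, del_e, K.del_γ, K.del_c]

lemma euler_R (a b : Fin p × Fin q) (j l : Fin q) : K.euler (K.R a b j l) = 0 := by
  simp [euler_apply, del_R]

lemma IsCone.euler_r (h : K.IsCone) (A B : Fin p) (m : Fin q) :
    K.euler (K.r A B m) = 3 * K.r A B m := by
  simp only [r, map_sum, Derivation.leibniz, euler_R, h.euler_lam, smul_eq_mul, mul_zero, add_zero,
    Finset.mul_sum]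
  refine Finset.sum_congr rfl fun i _ => Finset.sum_congr rfl fun j _ =>
    Finset.sum_congr rfl fun l _ => ?_
  ring

lemma IsCone.euler_gl (h : K.IsCone) (a : Fin p × Fin q) (i : Fin q) :
    K.euler (K.gl a i) = K.gl a i := by
  simp only [gl, map_sum, Derivation.leibniz, h.euler_lam, smul_eq_mul]
  simp [euler_apply, K.del_γ]

lemma IsCone.lie_euler_del (h : K.IsCone) (i : Fin q) : ⁅K.euler, K.del i⁆ = - K.del i := by
  rw [euler, sum_lie]
  simp [smul_lie_derivation, K.lie_del, h.sig, h.del_lam]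

lemma lie_euler_e (a : Fin p × Fin q) : ⁅K.euler, K.e a⁆ = 0 := by
  rw [euler, sum_lie]
  refine Finset.sum_eq_zero fun i _ => ?_
  rw [smul_lie_derivation, ← lie_skew, K.lie_e_del, K.e_lam]
  simp

/-- The fields `v A` are homogeneous of degree one. -/
lemma IsCone.lie_euler_v (h : K.IsCone) (A : Fin p) : ⁅K.euler, K.v A⁆ = K.v A := by
  have hD : ∀ a, ⁅K.euler, K.D a⁆ = 0 := by
    intro a
    rw [D, lie_sub, lie_euler_e, G, lie_sum, zero_sub, neg_eq_zero]
    refine Finset.sum_eq_zero fun i _ => ?_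
    rw [lie_smul_derivation, h.lie_euler_del, h.euler_gl]
    simp
  rw [v, lie_sum]
  simp [hD, h.euler_lam]

lemma IsCone.R_skew (h : K.IsCone) (a b : Fin p × Fin q) (j l : Fin q) :
    K.R a b j l = - K.R b a j l := by
  simp only [R, h.skew a b, Finset.sum_sub_distrib, neg_mul, Finset.sum_neg_distrib]
  ring

lemma IsCone.r_skew (h : K.IsCone) (A B : Fin p) (m : Fin q) : K.r A B m = - K.r B A m := by
  rw [r, r, Finset.sum_comm, ← Finset.sum_neg_distrib]
  refine Finset.sum_congr rfl fun i _ => ?_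
  rw [← Finset.sum_neg_distrib]
  refine Finset.sum_congr rfl fun j _ => ?_
  simp only [h.R_skew (A, j), neg_mul, Finset.sum_neg_distrib]
  ring

variable (K) in
lemma C_skew (A B E : Fin p) : K.C A B E = - K.C B A E := by
  rw [C, C, ← Finset.sum_neg_distrib]
  exact Finset.sum_congr rfl fun i _ => by ring

variable (K) in
/-- The function `ρ` with `r A B i = ρ πⁱ`, when there is one: by Euler's relation it is the
divergence of `r A B` in the fibre direction, up to the factor `q + 2`. -/
def rho (A B : Fin p) : S := ((q + 2 : ℂ)⁻¹) • ∑ i, K.del i (K.r A B i)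

/-- Euler's relation: a vector with homogeneous cubic components which is proportional to `π`
is `π` times its divergence, up to the factor `q + 2`. -/
lemma IsCone.r_eq (h : K.IsCone) {A B : Fin p}
    (hr : ∀ i j, K.r A B i * K.lam j = K.r A B j * K.lam i) (j : Fin q) :
    K.r A B j = K.rho A B * K.lam j := by
  have key : ∑ i, K.del i (K.r A B i * K.lam j) = ∑ i, K.del i (K.r A B j * K.lam i) :=
    Finset.sum_congr rfl fun i _ => by rw [hr i j]
  simp only [Derivation.leibniz, h.del_lam, smul_eq_mul, Finset.sum_add_distrib,
    ← Finset.mul_sum, ← euler_apply, h.euler_r] at key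
  simp only [mul_ite, mul_one, mul_zero, Finset.sum_ite_eq', Finset.mem_univ, if_true,
    Finset.sum_const, Finset.card_univ, Fintype.card_fin, nsmul_eq_mul] at key
  have h2 : (q + 2 : ℂ) • K.r A B j = (∑ i, K.del i (K.r A B i)) * K.lam j := by
    have : (q + 2 : ℂ) • K.r A B j = (q + 2 : S) * K.r A B j := by
      rw [Algebra.smul_def]; simp [map_ofNat]
    rw [this]
    linear_combination -key
  have hq : (q + 2 : ℂ) ≠ 0 := by exact_mod_cast (by omega : q + 2 ≠ 0)
  rw [rho, smul_mul_assoc, ← h2, smul_smul, inv_mul_cancel₀ hq, one_smul]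

end TwistorCalculus

end

/-! ### Vanishing of the curvature along the twistor distribution -/

section

namespace TwistorCalculus

variable {p q : ℕ} {S : Type*} [CommRing S] [Algebra ℂ S] {K : TwistorCalculus p q S}

variable (K) in
/-- The vertical derivations. -/
def vert : Submodule S (Derivation ℂ S S) := Submodule.span S (range K.del)

variable (K) in
/-- The part `∑ i, πⁱ e_{Ai}` of `v A`, which it equals modulo vertical fields. -/
def w (A : Fin p) : Derivation ℂ S S := ∑ i, K.lam i • K.e (A, i)

lemma del_mem_vert (i : Fin q) : K.del i ∈ K.vert := Submodule.subset_span ⟨i, rfl⟩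

lemma sum_del_mem_vert (f : Fin q → S) : ∑ i, f i • K.del i ∈ K.vert :=
  Submodule.sum_mem _ fun i _ => Submodule.smul_mem _ _ (del_mem_vert i)

lemma D_sub_e_mem (a : Fin p × Fin q) : K.D a - K.e a ∈ K.vert := by
  rw [D, sub_sub_cancel_left]
  exact neg_mem (sum_del_mem_vert _)

lemma v_sub_w_mem (A : Fin p) : K.v A - K.w A ∈ K.vert := by
  rw [v, w, ← Finset.sum_sub_distrib]
  refine Submodule.sum_mem _ fun i _ => ?_
  rw [← smul_sub]
  exact Submodule.smul_mem _ _ (D_sub_e_mem _)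

lemma IsCone.eq_zero_of_mem_vert (h : K.IsCone) (f : Fin p × Fin q → S)
    (hf : ∑ d, f d • K.e d ∈ K.vert) : f = 0 := by
  obtain ⟨g, hg⟩ := (Submodule.mem_span_range_iff_exists_fun S).1 hf
  have := h.indep (Sum.elim f (-g)) (by
    rw [frameField_frame]
    simp [← hg])
  ext d
  simpa using congrFun this (.inl d)

lemma IsCone.lie_v_del (h : K.IsCone) (A : Fin p) (i : Fin q) :
    ⁅K.v A, K.del i⁆ + K.e (A, i) ∈ K.vert := by
  have hD : ∀ a : Fin p × Fin q, ⁅K.D a, K.del i⁆ ∈ K.vert := by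
    intro a
    rw [D, sub_lie, K.lie_e_del, zero_sub, G, sum_lie]
    refine neg_mem (Submodule.sum_mem _ fun j _ => ?_)
    rw [smul_lie_derivation, K.lie_del, h.sig, h.sig]
    simpa using neg_mem (Submodule.smul_mem K.vert (K.del i (K.gl a j)) (del_mem_vert j))
  have : ⁅K.v A, K.del i⁆ + K.e (A, i) = ∑ j, K.lam j • ⁅K.D (A, j), K.del i⁆ -
      (K.D (A, i) - K.e (A, i)) := by
    rw [v, sum_lie]
    simp [smul_lie_derivation, h.del_lam, Finset.sum_sub_distrib]
    abel
  rw [this]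
  exact sub_mem (Submodule.sum_mem _ fun j _ => Submodule.smul_mem _ _ (hD _)) (D_sub_e_mem _)

lemma lie_v_of_Tlam (hT : ∀ A B d, K.Tlam A B d = 0) (A B : Fin p) :
    ⁅K.v A, K.v B⁆ = ∑ E, K.C A B E • K.v E - ∑ m, K.r A B m • K.del m := by
  rw [lie_v]; simp [hT]

/-- The horizontal part of an iterated bracket. -/
lemma IsCone.lie_lie_v (h : K.IsCone) (hT : ∀ A B d, K.Tlam A B d = 0) (E A B : Fin p) :
    ⁅K.v E, ⁅K.v A, K.v B⁆⁆ - (∑ F, (K.v E (K.C A B F) + ∑ H, K.C A B H * K.C E H F) • K.w F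
      + ∑ i, K.r A B i • K.e (E, i)) ∈ K.vert := by
  have h1 : ⁅K.v E, ⁅K.v A, K.v B⁆⁆ =
      ∑ F, (K.v E (K.C A B F) + ∑ H, K.C A B H * K.C E H F) • K.v F
        - ∑ H, K.C A B H • ∑ m, K.r E H m • K.del m
        - ∑ i, (K.r A B i • ⁅K.v E, K.del i⁆ + K.v E (K.r A B i) • K.del i) := by
    rw [lie_v_of_Tlam hT A B, lie_sub, lie_sum, lie_sum]
    simp only [lie_smul_derivation, lie_v_of_Tlam hT E, smul_sub, Finset.sum_add_distrib,
      Finset.sum_sub_distrib, add_smul, Finset.sum_smul, Finset.smul_sum, smul_smul]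
    rw [Finset.sum_comm (f := fun F H => (K.C A B H * K.C E H F) • K.v F)]
    abel
  have h2 : ⁅K.v E, ⁅K.v A, K.v B⁆⁆ - (∑ F, (K.v E (K.C A B F) + ∑ H, K.C A B H * K.C E H F) • K.w F
      + ∑ i, K.r A B i • K.e (E, i)) =
      ∑ F, (K.v E (K.C A B F) + ∑ H, K.C A B H * K.C E H F) • (K.v F - K.w F)
        - ∑ H, K.C A B H • ∑ m, K.r E H m • K.del m
        - ∑ i, (K.r A B i • (⁅K.v E, K.del i⁆ + K.e (E, i)) + K.v E (K.r A B i) • K.del i) := by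
    rw [h1]
    simp only [smul_add, smul_sub, Finset.sum_add_distrib, Finset.sum_sub_distrib]
    abel
  rw [h2]
  refine sub_mem (sub_mem ?_ ?_) ?_
  · exact Submodule.sum_mem _ fun F _ => Submodule.smul_mem _ _ (v_sub_w_mem F)
  · exact Submodule.sum_mem _ fun F _ => Submodule.smul_mem _ _ (sum_del_mem_vert _)
  · exact Submodule.sum_mem _ fun i _ => add_mem (Submodule.smul_mem _ _ (h.lie_v_del E i))
      (Submodule.smul_mem _ _ (del_mem_vert i))

/-- If `p > 2` and the torsion vanishes along `U ⊗ π`, then the curvature `r` is proportional to `π`: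
in the Jacobi identity for `v E`, `v A`, `v B` with three distinct indices, the components along the
`e (E, i)` are `r A B i` plus a multiple of `πⁱ`. -/
lemma IsCone.r_parallel (h : K.IsCone) (hT : ∀ A B d, K.Tlam A B d = 0) (hp : 2 < p)
    (A B : Fin p) (i j : Fin q) : K.r A B i * K.lam j = K.r A B j * K.lam i := by
  obtain ⟨E, hEA, hEB⟩ : ∃ E : Fin p, E ≠ A ∧ E ≠ B := by
    have : (({A, B} : Finset (Fin p))ᶜ).Nonempty := by
      rw [← Finset.card_pos, Finset.card_compl, Fintype.card_fin]
      have := Finset.card_le_two (a := A) (b := B)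
      omega
    obtain ⟨E, hE⟩ := this
    exact ⟨E, by simpa using hE⟩
  rcases eq_or_ne A B with rfl | hAB
  · have h0 : ∀ m, K.r A A m = 0 := fun m => by
      have h1 := h.r_skew A A m
      have h2 : (2 : ℂ) • K.r A A m = 0 := by
        rw [two_smul]; linear_combination h1
      simpa using congrArg ((2 : ℂ)⁻¹ • ·) h2
    simp [h0]
  have h0 := lie_jacobi (K.v E) (K.v A) (K.v B)
  have h1 := add_mem (add_mem (h.lie_lie_v hT E A B) (h.lie_lie_v hT A B E)) (h.lie_lie_v hT B E A)
  let J : Fin p → S := fun F => (K.v E (K.C A B F) + ∑ H, K.C A B H * K.C E H F) +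
    (K.v A (K.C B E F) + ∑ H, K.C B E H * K.C A H F) +
    (K.v B (K.C E A F) + ∑ H, K.C E A H * K.C B H F)
  have h2 : ∑ d : Fin p × Fin q, (J d.1 * K.lam d.2 + (if d.1 = E then K.r A B d.2 else 0)
      + (if d.1 = A then K.r B E d.2 else 0) + (if d.1 = B then K.r E A d.2 else 0)) • K.e d =
      ∑ F, J F • K.w F + ∑ i, K.r A B i • K.e (E, i) + ∑ i, K.r B E i • K.e (A, i)
        + ∑ i, K.r E A i • K.e (B, i) := by
    simp only [add_smul, Finset.sum_add_distrib]
    have : ∀ (E : Fin p) (f : Fin q → S), ∑ d : Fin p × Fin q, (if d.1 = E then f d.2 else 0) • K.e d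
        = ∑ i, f i • K.e (E, i) := by
      intro E f
      rw [Fintype.sum_prod_type, Finset.sum_eq_single E]
      · simp
      · intro F _ hF; simp [hF]
      · simp
    rw [this, this, this]
    congr 3
    rw [Fintype.sum_prod_type]
    simp [w, Finset.smul_sum, smul_smul]
  have h3 : (∑ F, J F • K.w F + ∑ i, K.r A B i • K.e (E, i) + ∑ i, K.r B E i • K.e (A, i)
        + ∑ i, K.r E A i • K.e (B, i)) ∈ K.vert := by
    rw [← neg_mem_iff]
    convert h1 using 1
    rw [← zero_sub, ← h0]
    simp only [J, add_smul, Finset.sum_add_distrib]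
    abel
  rw [← h2] at h3
  have h4 := h.eq_zero_of_mem_vert _ h3
  have h5 : ∀ i, K.r A B i = - (J E * K.lam i) := by
    intro i
    have := congrFun h4 (E, i)
    simp [hEA, hEB] at this
    linear_combination this
  rw [h5, h5]; ring

/-- The trace-free conditions express the trace of the structure functions by the connection
coefficients. -/
lemma sum_str (h : ∀ a, ∑ E, K.Γ a E E = 0) (h' : ∀ a, ∑ i, K.γ a i i = 0)
    (hT : ∀ b, ∑ d, K.T d b d = 0) (B : Fin p) (j : Fin q) :
    ∑ d, K.c d (B, j) d = ∑ A, K.Γ (A, j) A B + ∑ i, K.γ (B, i) i j := by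
  have := hT (B, j)
  simp only [T, Finset.sum_sub_distrib, Finset.sum_add_distrib, if_true] at this
  rw [Fintype.sum_prod_type, Fintype.sum_prod_type, Fintype.sum_prod_type,
    Fintype.sum_prod_type] at this
  simp only [Finset.sum_ite_eq', Finset.mem_univ, if_true, Finset.sum_const, h', smul_zero,
    sub_zero] at this
  rw [Finset.sum_comm (f := fun (x : Fin p) (y : Fin q) => if x = B then K.γ (x, y) y j else 0)] at this
  simp only [← Finset.smul_sum, h, Finset.sum_ite_eq', Finset.mem_univ, if_true, smul_zero,
    sub_zero] at this
  exact (sub_eq_zero.1 this).symm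

/-- The function which is the divergence of `v A` and, up to sign, the trace of `C A`. -/
def divV (K : TwistorCalculus p q S) (A : Fin p) : S := ∑ i, K.lam i * ∑ B, K.Γ (B, i) B A

/-- The divergence of `v A`, with respect to the volume form which is `1` on `frame`. -/
lemma IsCone.frameDiv_vComp (h : K.IsCone) (hΓ : ∀ a, ∑ E, K.Γ a E E = 0)
    (hγ : ∀ a, ∑ i, K.γ a i i = 0) (hT : ∀ b, ∑ d, K.T d b d = 0) (A : Fin p) :
    frameDiv K.frame K.frameStr (K.vComp A) = K.divV A := by
  have h1 : ∑ x, K.del x (∑ i, K.lam i * K.gl (A, i) x) = ∑ i, K.gl (A, i) i := by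
    simp only [map_sum, Derivation.leibniz, h.del_lam, gl, K.del_γ, smul_eq_mul, mul_ite, mul_one,
      mul_zero, add_zero, Finset.sum_ite_eq, Finset.mem_univ, if_true, Finset.sum_add_distrib]
    rw [Finset.sum_comm (f := fun x i => K.lam i * K.γ (A, i) x x)]
    simp only [← Finset.mul_sum, hγ, mul_zero, Finset.sum_const_zero, zero_add]
  have h2 : ∑ x : Fin p × Fin q, K.e x (if x.1 = A then K.lam x.2 else 0) = 0 := by
    refine Finset.sum_eq_zero fun x _ => ?_
    split_ifs <;> simp [K.e_lam]
  rw [frameDiv, Fintype.sum_sum_type, Fintype.sum_sum_type]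
  simp only [Fintype.sum_sum_type]
  simp only [frame, frameStr, vComp, Sum.elim_inl, Sum.elim_inr, Finset.sum_const_zero, add_zero,
    map_neg, Finset.sum_neg_distrib, h1, h2, mul_zero]
  rw [Fintype.sum_prod_type, Finset.sum_eq_single A]
  · simp only [if_true, sum_str hΓ hγ hT, mul_add, Finset.sum_add_distrib, divV, gl]
    rw [Finset.sum_comm (f := fun i j => K.γ (A, i) i j * K.lam j)]
    simp only [Finset.mul_sum, mul_comm]
    ring
  · intro E _ hE; simp [hE]
  · simp

lemma IsCone.frameDiv_eulerComp (h : K.IsCone) :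
    frameDiv K.frame K.frameStr K.eulerComp = q := by
  rw [frameDiv, Fintype.sum_sum_type, Fintype.sum_sum_type]
  simp [frame, frameStr, eulerComp, h.del_lam]

variable (K) in
/-- The frame of the distribution spanned by the `v A` and the Euler field. -/
def twistorFrame : Option (Fin p) → Derivation ℂ S S
  | none => K.euler
  | some A => K.v A

variable (K) in
/-- The structure functions of `twistorFrame`, when `r = ρ π`. The Euler field acts on the `v A` by
the weight one. -/
def twistorStr : Option (Fin p) → Option (Fin p) → Option (Fin p) → S
  | some A, some B, some E => K.C A B E
  | some A, some B, none => - K.rho A B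
  | none, some A, some E => if E = A then 1 else 0
  | some A, none, some E => if E = A then -1 else 0
  | _, _, _ => 0

lemma IsCone.rho_skew (h : K.IsCone) (A B : Fin p) : K.rho A B = - K.rho B A := by
  simp [rho, h.r_skew A B]

lemma IsCone.lie_v_of_r (h : K.IsCone) (hT : ∀ A B d, K.Tlam A B d = 0)
    (hr : ∀ A B i j, K.r A B i * K.lam j = K.r A B j * K.lam i) (A B : Fin p) :
    ⁅K.v A, K.v B⁆ = ∑ E, K.C A B E • K.v E - K.rho A B • K.euler := by
  rw [lie_v_of_Tlam hT, euler, Finset.smul_sum]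
  simp only [smul_smul, ← h.r_eq (hr A B)]

lemma IsCone.twistorFrame_isFrame (h : K.IsCone) (hT : ∀ A B d, K.Tlam A B d = 0)
    (hr : ∀ A B i j, K.r A B i * K.lam j = K.r A B j * K.lam i) :
    IsFrame K.twistorFrame K.twistorStr where
  lie a b := by
    rcases a with _ | A <;> rcases b with _ | B
    · simp [frameField, twistorStr]
    · simp [frameField, twistorStr, twistorFrame, Fintype.sum_option, h.lie_euler_v]
    · rw [← lie_skew]
      simp [frameField, twistorStr, twistorFrame, Fintype.sum_option, h.lie_euler_v]
    · simp [frameField, twistorStr, twistorFrame, Fintype.sum_option, h.lie_v_of_r hT hr]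
      abel
  indep y hy := by
    have h1 : frameField K.frame (∑ A, y (some A) • K.vComp A + y none • K.eulerComp) = 0 := by
      rw [frameField_add, frameField_sum]
      simp only [frameField_smul, frameField_vComp, frameField_eulerComp]
      rw [← hy, frameField, Fintype.sum_option, add_comm]
      rfl
    have h2 := h.indep _ h1
    have h3 : ∀ A, y (some A) = 0 := by
      intro A
      refine h.cancel _ fun i => ?_
      have := congrFun h2 (.inl (A, i))
      simpa [vComp, eulerComp] using this
    have h4 : y none = 0 := by
      refine h.cancel _ fun i => ?_
      have := congrFun h2 (.inr i)
      simpa [h3, vComp, eulerComp] using this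
    ext o
    rcases o with _ | A
    · exact h4
    · exact h3 A
  skew a b d := by
    rcases a with _ | A <;> rcases b with _ | B <;> rcases d with _ | E
    case some.some.some => exact K.C_skew A B E
    case some.some.none => simp [twistorStr, h.rho_skew A B]
    all_goals simp only [twistorStr, neg_zero]
    all_goals split_ifs <;> simp

lemma IsCone.euler_rho (h : K.IsCone) (A B : Fin p) : K.euler (K.rho A B) = 2 * K.rho A B := by
  have h1 : ∀ i, K.euler (K.del i (K.r A B i)) = 2 * K.del i (K.r A B i) := by
    intro i
    have := congrArg (fun X : Derivation ℂ S S => X (K.r A B i)) (h.lie_euler_del i)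
    simp only [Derivation.commutator_apply, h.euler_r, Derivation.neg_apply] at this
    have h3 : K.del i (3 * K.r A B i) = 3 * K.del i (K.r A B i) := by
      have : (3 : S) * K.r A B i = (3 : ℂ) • K.r A B i := by
        rw [Algebra.smul_def]; simp [map_ofNat]
      rw [this, (K.del i).map_smul, Algebra.smul_def]; simp [map_ofNat]
    rw [h3] at this
    linear_combination this
  rw [rho, K.euler.map_smul, map_sum, Finset.sum_congr rfl fun i _ => h1 i, ← Finset.mul_sum,
    mul_smul_comm]

/-- If the torsion vanishes along `U ⊗ π` and the curvature satisfies `r = ρ π`, then `r = 0`,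
because both connections preserve volume forms. The bracket
`[v A, v B] = ∑ E, C A B E v E - ρ Euler` is traced in two ways: by the Jacobi identity for the frame
of the `v A` and the Euler field, and by taking divergences on the total space. The difference of
the two results is `(p + q) ρ = 0`. -/
lemma IsCone.r_eq_zero (h : K.IsCone) (hT : ∀ A B d, K.Tlam A B d = 0)
    (hr : ∀ A B i j, K.r A B i * K.lam j = K.r A B j * K.lam i)
    (hΓ : ∀ a, ∑ E, K.Γ a E E = 0) (hγ : ∀ a, ∑ i, K.γ a i i = 0)
    (hTr : ∀ b, ∑ d, K.T d b d = 0) (A B : Fin p) (i : Fin q) : K.r A B i = 0 := by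
  have hC : ∀ A, ∑ E, K.C A E E = - K.divV A := by
    intro A
    have hk : K.kap = 0 := by ext a; simp [kap, h.sig]
    simp only [C, hk, Pi.zero_apply, ite_self, add_zero, sub_zero]
    rw [Finset.sum_comm]
    simp only [← Finset.mul_sum, Finset.sum_sub_distrib, hΓ, zero_sub, mul_neg,
      Finset.sum_neg_distrib, divV]
  -- the trace of the Jacobi identity for the frame `v A`, `π ∂/∂π`
  have h1 := (h.twistorFrame_isFrame hT hr).contracted_jacobi (some A) (some B)
  simp only [Fintype.sum_option, twistorFrame, twistorStr, map_neg, map_zero, h.euler_rho] at h1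
  -- the divergence of the bracket
  have h2 := h.isFrame.frameDiv_lie (K.vComp A) (K.vComp B)
    (∑ E, K.C A B E • K.vComp E - K.rho A B • K.eulerComp) (by
      rw [frameField_sub, frameField_sum]
      simp only [frameField_smul, frameField_vComp, frameField_eulerComp, h.lie_v_of_r hT hr])
  have hlin : ∀ y z, frameDiv K.frame K.frameStr (y - z) =
      frameDiv K.frame K.frameStr y - frameDiv K.frame K.frameStr z := by
    intro y z
    simp [frameDiv, sub_mul, Finset.sum_sub_distrib]; ring
  have hsum : ∀ y : Fin p → _, frameDiv K.frame K.frameStr (∑ E, y E) =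
      ∑ E, frameDiv K.frame K.frameStr (y E) := by
    intro y
    simp only [frameDiv, Finset.sum_apply, map_sum, Finset.sum_mul, Finset.sum_add_distrib]
    congr 1 <;> rw [Finset.sum_comm]
  have hsmul : ∀ f y, frameDiv K.frame K.frameStr (f • y) =
      f * frameDiv K.frame K.frameStr y + frameField K.frame y f := by
    intro f y
    simp only [frameDiv, Pi.smul_apply, smul_eq_mul, Derivation.leibniz, frameField_apply,
      Finset.sum_add_distrib, mul_add, Finset.mul_sum, mul_assoc]
    ring
  rw [hlin, hsum] at h2
  simp only [hsmul, h.frameDiv_vComp hΓ hγ hTr, h.frameDiv_eulerComp, frameField_vComp,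
    frameField_eulerComp, h.euler_rho] at h2
  have h3 : ∀ A, ∑ E, K.C E A E = K.divV A := by
    intro A
    rw [← neg_neg (K.divV A), ← hC, ← Finset.sum_neg_distrib]
    exact Finset.sum_congr rfl fun E _ => K.C_skew E A E
  have h4 : ((p + q : ℕ) : S) * K.rho A B = 0 := by
    simp only [Finset.sum_add_distrib, Finset.sum_sub_distrib, ← map_sum, hC, h3, map_neg] at h1 h2
    simp at h1
    push_cast
    linear_combination h1 - h2
  have h5 : K.rho A B = 0 := by
    have hpq : ((p + q : ℕ) : ℂ) ≠ 0 := by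
      have := i.2
      exact_mod_cast (by omega : p + q ≠ 0)
    have h6 : ((p + q : ℕ) : ℂ) • K.rho A B = 0 := by
      rw [Algebra.smul_def, map_natCast, h4]
    rw [← one_smul ℂ (K.rho A B), ← inv_mul_cancel₀ hpq, mul_smul, h6, smul_zero]
  rw [h.r_eq (hr A B), h5, zero_mul]

end TwistorCalculus

end

/-! ### Vector fields as derivations -/

section

section Derivations

variable {E' : Type*} [NormedAddCommGroup E'] [NormedSpace ℂ E']
    {H' : Type*} [TopologicalSpace H'] {I : ModelWithCorners ℂ E' H'}
    {N : Type*} [TopologicalSpace N] [ChartedSpace H' N] [IsManifold I ω N]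
    {G : Type*} [NormedAddCommGroup G] [NormedSpace ℂ G]

/-- A holomorphic vector field maps holomorphic functions to holomorphic functions. -/
lemma contMDiffAt_mvfderiv_apply {f : N → G} {X : Π z : N, TangentSpace I z} {z : N}
    (hf : CMDiffAt ω f z) (hX : CMDiffAt ω (T% X) z) :
    CMDiffAt ω (fun y => mvfderiv I f y (X y)) z := by
  obtain ⟨u, hu, hfu⟩ := (contMDiffAt_iff_contMDiffOn_nhds (by simp)).1 hf
  obtain ⟨v, hvu, hvo, hzv⟩ := mem_nhds_iff.1 hu
  have hfv := hfu.mono hvu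
  have h1 := hfv.contMDiffOn_tangentMapWithin (m := ω) (by simp) hvo.uniqueMDiffOn
  have h2 : ContMDiffAt I 𝓘(ℂ, G).tangent ω (fun y => tangentMapWithin I 𝓘(ℂ, G) f v ⟨y, X y⟩) z := by
    have : (TotalSpace.proj ⁻¹' v : Set (TangentBundle I N)) ∈ 𝓝 (⟨z, X z⟩ : TangentBundle I N) :=
      (hvo.preimage (FiberBundle.continuous_proj E' (TangentSpace I))).mem_nhds hzv
    exact (h1.contMDiffAt this).comp z hX
  have h3 := (contMDiff_snd_tangentBundle_modelSpace G 𝓘(ℂ, G) (n := ω)).contMDiffAt.comp z h2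
  refine h3.congr_of_eventuallyEq ?_
  filter_upwards [hvo.mem_nhds hzv] with y hy
  simp only [Function.comp, tangentMapWithin, mvfderiv]
  rw [mfderivWithin_of_isOpen hvo hy]
  rfl

variable [I.Boundaryless] [CompleteSpace E']

variable (I) in
/-- A vector field read in the chart centred at `z`. -/
def chartField (z : N) (X : Π z : N, TangentSpace I z) (u : E') : E' :=
  VectorField.mpullbackWithin 𝓘(ℂ, E') I (extChartAt I z).symm X univ u

/-- The derivative of a function along a vector field, computed in a chart. -/
lemma mvfderiv_extChartAt_symm {g : N → G} (X : Π z : N, TangentSpace I z) (z : N) {u : E'}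
    (hu : u ∈ (extChartAt I z).target) (hg : MDiffAt g ((extChartAt I z).symm u)) :
    mvfderiv I g ((extChartAt I z).symm u) (X ((extChartAt I z).symm u)) =
      fderiv ℂ (g ∘ (extChartAt I z).symm) u (chartField I z X u) := by
  have hr : range I = univ := I.range_eq_univ
  have h1 : MDifferentiableAt 𝓘(ℂ, E') I (extChartAt I z).symm u := by
    have := mdifferentiableWithinAt_extChartAt_symm (I := I) hu
    rwa [hr, mdifferentiableWithinAt_univ] at this
  have hinv := isInvertible_mfderivWithin_extChartAt_symm (I := I) hu
  rw [hr] at hinv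
  have h2 := hinv.self_apply_inverse (X ((extChartAt I z).symm u))
  have h3 := congrArg (fun w => mvfderiv I g ((extChartAt I z).symm u) w) h2
  rw [← mfderiv_eq_fderiv, mfderiv_comp u hg h1, ← mfderivWithin_univ (f := (extChartAt I z).symm)]
  exact h3.symm

/-- The Lie bracket of vector fields is the commutator of derivations. -/
lemma mvfderiv_mlieBracket {f : N → G} {X Y : Π z : N, TangentSpace I z} {z : N}
    (hf : CMDiffAt ω f z) (hX : MDiffAt (T% X) z) (hY : MDiffAt (T% Y) z) :
    mvfderiv I f z (VectorField.mlieBracket I X Y z) =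
      mvfderiv I (fun y => mvfderiv I f y (Y y)) z (X z) -
        mvfderiv I (fun y => mvfderiv I f y (X y)) z (Y z) := by
  have : IsManifold I 2 N := .of_le (n := ω) le_top
  have hr : range I = univ := I.range_eq_univ
  set φ := extChartAt I z with hφ
  set f' : E' → G := f ∘ φ.symm with hf'
  have hz : φ.symm (φ z) = z := extChartAt_to_inv z
  have htar : ∀ᶠ u in 𝓝 (φ z), u ∈ φ.target := extChartAt_target_mem_nhds z
  have hsymm : ContMDiffAt 𝓘(ℂ, E') I ω φ.symm (φ z) :=
    (contMDiffOn_extChartAt_symm z).contMDiffAt htar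
  have hf'ω : ContDiffAt ℂ ω f' (φ z) := by
    rw [← contMDiffAt_iff_contDiffAt]
    exact ContMDiffAt.comp (φ z) (by rw [hz]; exact hf) hsymm
  have hfnear : ∀ᶠ u in 𝓝 (φ z), MDiffAt f (φ.symm u) := by
    have h1 : ∀ᶠ y in 𝓝 z, MDiffAt f y := by
      obtain ⟨u, hu, hfu⟩ := (contMDiffAt_iff_contMDiffOn_nhds (by simp)).1 hf
      filter_upwards [eventually_mem_nhds_iff.2 hu] with y hy
      exact (hfu.contMDiffAt hy).mdifferentiableAt (by simp)
    have h2 : Tendsto φ.symm (𝓝 (φ z)) (𝓝 z) := by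
      have := hsymm.continuousAt
      rwa [ContinuousAt, hz] at this
    exact h2.eventually h1
  have key : ∀ X : Π z : N, TangentSpace I z, MDiffAt (T% X) z →
      DifferentiableAt ℂ (chartField I z X) (φ z) ∧
      (fun y => mvfderiv I f y (X y)) ∘ φ.symm =ᶠ[𝓝 (φ z)]
        (fun u => fderiv ℂ f' u (chartField I z X u)) ∧
      MDiffAt (fun y => mvfderiv I f y (X y)) z := by
    intro X hX
    have hd : DifferentiableAt ℂ (chartField I z X) (φ z) := by
      rw [← mdifferentiableWithinAt_univ] at hX
      have := hX.differentiableWithinAt_mpullbackWithin_vectorField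
      rw [preimage_univ, univ_inter, hr] at this
      exact differentiableWithinAt_univ.1 this
    have he : (fun y => mvfderiv I f y (X y)) ∘ φ.symm =ᶠ[𝓝 (φ z)]
        (fun u => fderiv ℂ f' u (chartField I z X u)) := by
      filter_upwards [htar, hfnear] with u hu hfu
      exact mvfderiv_extChartAt_symm X z hu hfu
    refine ⟨hd, he, ?_⟩
    have h1 : DifferentiableAt ℂ (fun u => fderiv ℂ f' u (chartField I z X u)) (φ z) :=
      ((hf'ω.fderiv_right (m := 1) (by simp)).differentiableAt (by simp)).clm_apply hd
    have h2 : MDiffAt ((fun u => fderiv ℂ f' u (chartField I z X u)) ∘ φ) z :=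
      h1.mdifferentiableAt.comp z (mdifferentiableAt_extChartAt (mem_chart_source _ z))
    refine h2.congr_of_eventuallyEq ?_
    have h3 : Tendsto φ (𝓝 z) (𝓝 (φ z)) := continuousAt_extChartAt z
    filter_upwards [h3.eventually he, extChartAt_source_mem_nhds (I := I) z] with y hy hys
    have hl : φ.symm (φ y) = y := φ.left_inv hys
    rw [Function.comp_apply, hl] at hy
    exact hy
  obtain ⟨hX1, hX2, hX3⟩ := key X hX
  obtain ⟨hY1, hY2, hY3⟩ := key Y hY
  have hout : ∀ (g : N → G) (Z : Π z : N, TangentSpace I z), MDiffAt g z →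
      mvfderiv I g z (Z z) = fderiv ℂ (g ∘ φ.symm) (φ z) (chartField I z Z (φ z)) := by
    intro g Z hg
    have := mvfderiv_extChartAt_symm (g := g) Z z (mem_extChartAt_target z) (by rwa [hz])
    rwa [hz] at this
  have hbr : mvfderiv I f z (VectorField.mlieBracket I X Y z) =
      fderiv ℂ f' (φ z) (VectorField.lieBracket ℂ (chartField I z X) (chartField I z Y) (φ z)) := by
    have e1 : f =ᶠ[𝓝 z] f' ∘ φ := by
      filter_upwards [extChartAt_source_mem_nhds (I := I) z] with y hy
      have hl : φ.symm (φ y) = y := φ.left_inv hy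
      rw [Function.comp_apply, hf', Function.comp_apply, hl]
    have e2 : mfderiv I 𝓘(ℂ, G) f z = (fderiv ℂ f' (φ z)).comp (mfderiv I 𝓘(ℂ, E') φ z) := by
      rw [e1.mfderiv_eq, mfderiv_comp z
        (hf'ω.differentiableAt (by simp)).mdifferentiableAt
        (mdifferentiableAt_extChartAt (mem_chart_source _ z)), mfderiv_eq_fderiv]
      rfl
    let b : E' := VectorField.lieBracket ℂ (chartField I z X) (chartField I z Y) (φ z)
    have e3 := (isInvertible_mfderiv_extChartAt (I := I) (mem_extChartAt_source z)).self_apply_inverse b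
    have e4 : VectorField.mlieBracket I X Y z = (mfderiv I 𝓘(ℂ, E') φ z).inverse b := by
      rw [← VectorField.mlieBracketWithin_univ, VectorField.mlieBracketWithin_apply, preimage_univ,
        univ_inter, hr]
      simp only [b]
      rw [← VectorField.lieBracketWithin_univ]
      rfl
    have e5 : ∀ w, mvfderiv I f z w = fderiv ℂ f' (φ z) (mfderiv I 𝓘(ℂ, E') φ z w) := by
      intro w
      exact congrArg (fun L : E' →L[ℂ] G => L w) e2
    rw [e5, e4]
    exact congrArg (fderiv ℂ f' (φ z)) e3
  have hd := (hf'ω.fderiv_right (m := 1) (by simp)).differentiableAt (by simp)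
  have hs : IsSymmSndFDerivAt ℂ f' (φ z) := hf'ω.isSymmSndFDerivAt (by simp)
  rw [hbr, hout _ X hY3, hout _ Y hX3, hY2.fderiv_eq, hX2.fderiv_eq,
    fderiv_clm_apply hd hY1, fderiv_clm_apply hd hX1]
  simp only [add_apply, ContinuousLinearMap.comp_apply,
    ContinuousLinearMap.flip_apply, VectorField.lieBracket_eq, map_sub]
  rw [hs (chartField I z X (φ z)) (chartField I z Y (φ z))]
  abel

end Derivations

end

/-! ### Coefficients in a local frame -/

section

section FrameCoeff

variable {E : Type*} [NormedAddCommGroup E] [NormedSpace ℂ E]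
  {H : Type*} [TopologicalSpace H] {I : ModelWithCorners ℂ E H}
  {M : Type*} [TopologicalSpace M] [ChartedSpace H M]
  {E' : Type*} [NormedAddCommGroup E'] [NormedSpace ℂ E']
  {H' : Type*} [TopologicalSpace H'] {J : ModelWithCorners ℂ E' H'}
  {N : Type*} [TopologicalSpace N] [ChartedSpace H' N]
  {F : Type*} [NormedAddCommGroup F] [NormedSpace ℂ F]
  {V : M → Type*} [TopologicalSpace (TotalSpace F V)]
  [∀ x, AddCommGroup (V x)] [∀ x, Module ℂ (V x)] [∀ x, TopologicalSpace (V x)]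
  [FiberBundle F V] [VectorBundle ℂ F V]
  {ι : Type*} [Fintype ι] {n : ℕ∞ω} {s : ι → Π x : M, V x} {u : Set M}

/-- The coefficients, in a frame `s` over `u`, of a `C^n` family `t m ∈ V (b m)` of vectors are
`C^n` functions. -/
lemma contMDiffAt_frameCoeff [ContMDiffVectorBundle n F V I]
    (hs : IsLocalFrameOn I F n s u) (hu : IsOpen u) {b : N → M} {t : Π m : N, V (b m)} {z : N}
    (hz : b z ∈ u) (ht : ContMDiffAt J (I.prod 𝓘(ℂ, F)) n (fun m => TotalSpace.mk' F (b m) (t m)) z)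
    (i : ι) : ContMDiffAt J 𝓘(ℂ, ℂ) n (fun m => hs.coeff i (b m) (t m)) z := by
  classical
  let e := trivializationAt F V (b z)
  have hbz : b z ∈ e.baseSet := FiberBundle.mem_baseSet_trivializationAt F V (b z)
  let a : ι → M → F := fun j x => (e ⟨x, s j x⟩).2
  have ha : ∀ j, ContMDiffAt I 𝓘(ℂ, F) n (a j) (b z) := fun j =>
    (e.contMDiffAt_section_iff (n := n) (IB := I) hbz).1
      (hs.contMDiffAt hu hz j)
  have hb : ContMDiffAt J I n b z := (contMDiffAt_totalSpace.1 ht).1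
  have hτ : ContMDiffAt J 𝓘(ℂ, F) n (fun m => (e ⟨b m, t m⟩).2) z := (contMDiffAt_totalSpace.1 ht).2
  -- `L x` is the change of basis from the frame to the trivialization, whose inverse is holomorphic
  let L : M → (ι → ℂ) →L[ℂ] F := fun x => ∑ j, (ContinuousLinearMap.proj j).smulRight (a j x)
  have hL : ContMDiffAt I 𝓘(ℂ, (ι → ℂ) →L[ℂ] F) n L (b z) := by
    refine contMDiffAt_finsetSum fun j _ => ?_
    exact ((ContinuousLinearMap.smulRightL ℂ (ι → ℂ) F
      (ContinuousLinearMap.proj j)).contDiff.contMDiff.contMDiffAt).comp (b z) (ha j)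
  have hLa : ∀ x c, L x c = ∑ j, c j • a j x := by
    intro x c; simp [L]
  have key : ∀ x (_ : x ∈ u) (_ : x ∈ e.baseSet), ∃ Φ : (ι → ℂ) ≃L[ℂ] F,
      (Φ : (ι → ℂ) →L[ℂ] F) = L x ∧ ∀ w : V x, Φ (fun j => hs.coeff j x w) = (e ⟨x, w⟩).2 := by
    intro x hx hx'
    have hfd : FiniteDimensional ℂ (V x) := (hs.toBasisAt hx).finiteDimensional_of_finite
    have hfd' : FiniteDimensional ℂ F := (e.linearEquivAt ℂ x hx').finiteDimensional
    let Φ : (ι → ℂ) ≃L[ℂ] F :=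
      ((hs.toBasisAt hx).equivFun.symm.trans (e.linearEquivAt ℂ x hx')).toContinuousLinearEquiv
    refine ⟨Φ, ?_, ?_⟩
    · ext1 c
      rw [hLa]
      change e.linearEquivAt ℂ x hx' ((hs.toBasisAt hx).equivFun.symm c) = _
      rw [Basis.equivFun_symm_apply, map_sum]
      simp [a]
    · intro w
      change e.linearEquivAt ℂ x hx' ((hs.toBasisAt hx).equivFun.symm _) = _
      rw [Basis.equivFun_symm_apply, ← Trivialization.linearEquivAt_apply (R := ℂ) e x hx' w]
      congr 1
      conv_rhs => rw [← (hs.toBasisAt hx).sum_repr w]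
      simp [IsLocalFrameOn.coeff, hx]
  obtain ⟨Φ₀, hΦ₀, -⟩ := key (b z) hz hbz
  have hinv : ContMDiffAt J 𝓘(ℂ, F →L[ℂ] (ι → ℂ)) n (fun m => (L (b m)).inverse) z := by
    have h1 : ContDiffAt ℂ n ContinuousLinearMap.inverse (L (b z)) := by
      rw [← hΦ₀]; exact contDiffAt_map_inverse Φ₀
    exact h1.contMDiffAt.comp z (hL.comp z hb)
  have h2 : ContMDiffAt J 𝓘(ℂ, ι → ℂ) n (fun m => (L (b m)).inverse (e ⟨b m, t m⟩).2) z :=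
    hinv.clm_apply hτ
  have h3 := (contMDiffAt_pi_space.1 h2) i
  refine h3.congr_of_eventuallyEq ?_
  filter_upwards [hb.continuousAt.preimage_mem_nhds (hu.mem_nhds hz),
    hb.continuousAt.preimage_mem_nhds (e.open_baseSet.mem_nhds hbz)] with m hm hm'
  obtain ⟨Φ, hΦ, hΦt⟩ := key (b m) hm hm'
  rw [← hΦ, ContinuousLinearMap.inverse_equiv, ← hΦt (t m)]
  simp

lemma contMDiffOn_frameCoeff [ContMDiffVectorBundle n F V I]
    (hs : IsLocalFrameOn I F n s u) (hu : IsOpen u) {t : Π x : M, V x}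
    (ht : CMDiff[u] n (T% t)) (i : ι) : CMDiff[u] n (fun x => hs.coeff i x (t x)) := fun _ hx =>
  (contMDiffAt_frameCoeff (J := I) hs hu (b := fun x : M => x) hx
    (ht.contMDiffAt (hu.mem_nhds hx)) i).contMDiffWithinAt

lemma frame_sum_coeff (hs : IsLocalFrameOn I F n s u) {x : M} (hx : x ∈ u) (w : V x) :
    ∑ i, hs.coeff i x w • s i x = w := by
  conv_rhs => rw [← (hs.toBasisAt hx).sum_repr w]
  simp [IsLocalFrameOn.coeff, hx]

lemma frame_coeff_sum (hs : IsLocalFrameOn I F n s u) {x : M} (hx : x ∈ u) (c : ι → ℂ) (i : ι) :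
    hs.coeff i x (∑ j, c j • s j x) = c i := by
  classical
  have := (hs.toBasisAt hx).repr_sum_self c
  simp only [IsLocalFrameOn.toBasisAt_coe] at this
  simp [IsLocalFrameOn.coeff, hx, -map_sum, this]

lemma frame_coeff_self [DecidableEq ι] (hs : IsLocalFrameOn I F n s u) {x : M} (hx : x ∈ u)
    (i j : ι) : hs.coeff i x (s j x) = if i = j then 1 else 0 := by
  have := frame_coeff_sum hs hx (Pi.single j 1) i
  simpa [Finset.sum_pi_single', Pi.single_apply] using this

end FrameCoeff

section Smooth

variable {E : Type*} [NormedAddCommGroup E] [NormedSpace ℂ E]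
  {H : Type*} [TopologicalSpace H] {I : ModelWithCorners ℂ E H}
  {M : Type*} [TopologicalSpace M] [ChartedSpace H M] [IsManifold I ω M]

/-- The Lie bracket of holomorphic vector fields is holomorphic. -/
lemma contMDiffAt_mlieBracket [CompleteSpace E] {X Y : Π x : M, TangentSpace I x} {x : M}
    (hX : CMDiffAt ω (T% X) x) (hY : CMDiffAt ω (T% Y) x) :
    CMDiffAt ω (T% (VectorField.mlieBracket I X Y)) x := by
  have := ContMDiffWithinAt.mlieBracketWithin_vectorField (s := univ) (m := ω) (n := ω)
    (contMDiffWithinAt_univ.2 hX) (contMDiffWithinAt_univ.2 hY) uniqueMDiffOn_univ (mem_univ x)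
    (by simp)
  simpa [VectorField.mlieBracketWithin_univ, contMDiffWithinAt_univ] using this

end Smooth

end

/-! ### The ring of holomorphic functions on an open set -/

section

section HoloRing

variable {E' : Type*} [NormedAddCommGroup E'] [NormedSpace ℂ E']
    {H' : Type*} [TopologicalSpace H'] {I : ModelWithCorners ℂ E' H'}
    {N : Type*} [TopologicalSpace N] [ChartedSpace H' N]

variable (I) in
/-- The algebra of holomorphic functions on an open set `W`, realised as those functions on the
subtype `W` which are restrictions of functions on `N` that are holomorphic on `W`. Functions on the
subtype, rather than on `N`, are used so that equality of elements is equality on `W`. -/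
def holoSubalgebra (W : TopologicalSpace.Opens N) : Subalgebra ℂ (W → ℂ) where
  carrier := {f | ∃ F : N → ℂ, CMDiff[(W : Set N)] ω F ∧ ∀ z : W, f z = F z}
  mul_mem' := by
    rintro f g ⟨F, hF, hf⟩ ⟨G, hG, hg⟩
    exact ⟨F * G, hF.mul hG, fun z => by simp [hf, hg]⟩
  add_mem' := by
    rintro f g ⟨F, hF, hf⟩ ⟨G, hG, hg⟩
    exact ⟨F + G, hF.add hG, fun z => by simp [hf, hg]⟩
  algebraMap_mem' r := ⟨fun _ => r, contMDiffOn_const, fun z => by simp⟩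

variable (I) in
/-- The ring of holomorphic functions on the open set `W`. -/
abbrev HoloRing (W : TopologicalSpace.Opens N) : Type _ := ↥(holoSubalgebra I W)

namespace HoloRing

variable {W : TopologicalSpace.Opens N}

/-- The restriction to `W` of a function which is holomorphic on `W`. -/
def mk (F : N → ℂ) (hF : CMDiff[(W : Set N)] ω F) : HoloRing I W :=
  ⟨fun z => F z, F, hF, fun _ => rfl⟩

lemma mk_coe (F : N → ℂ) (hF : CMDiff[(W : Set N)] ω F) (z : W) :
    (mk F hF : HoloRing I W).1 z = F z := rfl

lemma exists_eq_mk (f : HoloRing I W) :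
    ∃ (F : N → ℂ) (hF : CMDiff[(W : Set N)] ω F), f = mk F hF := by
  obtain ⟨f, F, hF, h⟩ := f
  exact ⟨F, hF, Subtype.ext (funext h)⟩

lemma ext_apply {f g : HoloRing I W} (h : ∀ z : W, f.1 z = g.1 z) : f = g :=
  Subtype.ext (funext h)

variable (W) in
lemma sum_coe {κ : Type*} (s : Finset κ) (f : κ → HoloRing I W) (z : W) :
    (∑ k ∈ s, f k).1 z = ∑ k ∈ s, (f k).1 z := by
  classical
  induction s using Finset.induction with
  | empty => simp
  | insert a s ha ih =>
    rw [Finset.sum_insert ha, Finset.sum_insert ha, ← ih]; rfl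

/-- A function extending an element of `HoloRing I W`. -/
def rep (f : HoloRing I W) : N → ℂ := f.2.choose

lemma rep_contMDiffOn (f : HoloRing I W) : CMDiff[(W : Set N)] ω f.rep := f.2.choose_spec.1

lemma rep_apply (f : HoloRing I W) (z : W) : f.rep z = f.1 z := (f.2.choose_spec.2 z).symm

lemma rep_eq (f : HoloRing I W) {F : N → ℂ} (h : ∀ z : W, f.1 z = F z) (z : W) :
    f.rep =ᶠ[𝓝 (z : N)] F := by
  filter_upwards [W.isOpen.mem_nhds z.2] with y hy
  rw [rep_apply f ⟨y, hy⟩, h]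

lemma mdifferentiableAt_rep (f : HoloRing I W) (z : W) : MDiffAt f.rep (z : N) :=
  (f.rep_contMDiffOn.contMDiffAt (W.isOpen.mem_nhds z.2)).mdifferentiableAt (by simp)

end HoloRing

lemma mvfderiv_congr_nhds {G : Type*} [NormedAddCommGroup G] [NormedSpace ℂ G]
    {f g : N → G} {x : N} (h : f =ᶠ[𝓝 x] g) (X : TangentSpace I x) :
    mvfderiv I f x X = mvfderiv I g x X := by
  simp only [mvfderiv, ContinuousLinearMap.comp_apply]
  exact congrArg (fun L : E' →L[ℂ] G => L X) h.mfderiv_eq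

variable [IsManifold I ω N] {W : TopologicalSpace.Opens N}

/-- The derivation of `HoloRing I W` given by a vector field which is holomorphic on `W`. -/
def der (X : Π z : N, TangentSpace I z) (hX : CMDiff[(W : Set N)] ω (T% X)) :
    Derivation ℂ (HoloRing I W) (HoloRing I W) :=
  Derivation.mk'
    { toFun := fun f => HoloRing.mk (fun z => mvfderiv I f.rep z (X z)) fun z hz =>
        (contMDiffAt_mvfderiv_apply (f.rep_contMDiffOn.contMDiffAt (W.isOpen.mem_nhds hz))
          (hX.contMDiffAt (W.isOpen.mem_nhds hz))).contMDiffWithinAt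
      map_add' := fun f g => HoloRing.ext_apply fun z => by
        change mvfderiv I (f + g).rep z (X z) = mvfderiv I f.rep z (X z) + mvfderiv I g.rep z (X z)
        rw [mvfderiv_congr_nhds ((f + g).rep_eq (F := f.rep + g.rep) (fun z => by
          simp [HoloRing.rep_apply]) z), mvfderiv_add (f.mdifferentiableAt_rep z)
          (g.mdifferentiableAt_rep z)]
        rfl
      map_smul' := fun c f => HoloRing.ext_apply fun z => by
        change mvfderiv I (c • f).rep z (X z) = c • mvfderiv I f.rep z (X z)
        rw [mvfderiv_congr_nhds ((c • f).rep_eq (F := (fun _ : N => c) • f.rep) (fun z => by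
          simp [HoloRing.rep_apply]) z), mvfderiv_smul (mdifferentiableAt_const)
          (f.mdifferentiableAt_rep z), mvfderiv_const]
        simp }
    fun f g => HoloRing.ext_apply fun z => by
        change mvfderiv I (f * g).rep z (X z) = f.1 z * mvfderiv I g.rep z (X z) +
          g.1 z * mvfderiv I f.rep z (X z)
        rw [mvfderiv_congr_nhds ((f * g).rep_eq (F := f.rep * g.rep) (fun z => by
          simp [HoloRing.rep_apply]) z), mvfderiv_mul (f.mdifferentiableAt_rep z)
          (g.mdifferentiableAt_rep z), ← f.rep_apply, ← g.rep_apply]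
        simp

lemma der_apply {X : Π z : N, TangentSpace I z} (hX : CMDiff[(W : Set N)] ω (T% X))
    (f : HoloRing I W) {F : N → ℂ} (hF : ∀ z : W, f.1 z = F z) (z : W) :
    (der X hX f).1 z = mvfderiv I F z (X z) :=
  mvfderiv_congr_nhds (f.rep_eq hF z) _

lemma der_mk {X : Π z : N, TangentSpace I z} (hX : CMDiff[(W : Set N)] ω (T% X))
    {F : N → ℂ} (hF : CMDiff[(W : Set N)] ω F) (z : W) :
    (der X hX (HoloRing.mk F hF)).1 z = mvfderiv I F z (X z) :=
  der_apply hX _ (fun _ => rfl) z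

variable [I.Boundaryless] [CompleteSpace E']

lemma contMDiffOn_mlieBracket {X Y : Π z : N, TangentSpace I z}
    (hX : CMDiff[(W : Set N)] ω (T% X)) (hY : CMDiff[(W : Set N)] ω (T% Y)) :
    CMDiff[(W : Set N)] ω (T% (VectorField.mlieBracket I X Y)) := fun _ hz =>
  (contMDiffAt_mlieBracket (hX.contMDiffAt (W.isOpen.mem_nhds hz))
    (hY.contMDiffAt (W.isOpen.mem_nhds hz))).contMDiffWithinAt

/-- The assignment of derivations to vector fields preserves brackets. -/
lemma lie_der {X Y : Π z : N, TangentSpace I z}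
    (hX : CMDiff[(W : Set N)] ω (T% X)) (hY : CMDiff[(W : Set N)] ω (T% Y)) :
    ⁅der X hX, der Y hY⁆ = der (VectorField.mlieBracket I X Y) (contMDiffOn_mlieBracket hX hY) := by
  ext1 f
  refine HoloRing.ext_apply fun z => ?_
  have hX' := hX.contMDiffAt (W.isOpen.mem_nhds z.2)
  have hY' := hY.contMDiffAt (W.isOpen.mem_nhds z.2)
  rw [Derivation.commutator_apply]
  change (der X hX (der Y hY f)).1 z - (der Y hY (der X hX f)).1 z = _
  rw [der_apply hX (der Y hY f) (F := fun y => mvfderiv I f.rep y (Y y))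
      (fun y => der_apply hY f (fun w => (f.rep_apply w).symm) y),
    der_apply hY (der X hX f) (F := fun y => mvfderiv I f.rep y (X y))
      (fun y => der_apply hX f (fun w => (f.rep_apply w).symm) y),
    der_apply _ f (fun w => (f.rep_apply w).symm),
    mvfderiv_mlieBracket (f.rep_contMDiffOn.contMDiffAt (W.isOpen.mem_nhds z.2))
      (hX'.mdifferentiableAt (by simp)) (hY'.mdifferentiableAt (by simp))]

/-- Inside a chart domain a tangent vector is determined by the derivatives of holomorphic
functions along it. -/
lemma tangent_eq_of_mvfderiv_eq {z₀ : N} (hW : (W : Set N) ⊆ (chartAt H' z₀).source) {z : N}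
    (hz : z ∈ W) {X Y : TangentSpace I z}
    (h : ∀ F : N → ℂ, CMDiff[(W : Set N)] ω F → mvfderiv I F z X = mvfderiv I F z Y) : X = Y := by
  have hz' : z ∈ (extChartAt I z₀).source := by rw [extChartAt_source]; exact hW hz
  have hinj := (isInvertible_mfderiv_extChartAt (I := I) hz').injective
  apply hinj
  have hφ : ∀ y ∈ W, CMDiffAt ω (extChartAt I z₀) y := fun y hy =>
    contMDiffAt_extChartAt' (by exact hW hy)
  have key : ∀ ℓ : E' →L[ℂ] ℂ, ∀ v : TangentSpace I z, mvfderiv I (fun y => ℓ (extChartAt I z₀ y)) z v =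
      ℓ (mfderiv I 𝓘(ℂ, E') (extChartAt I z₀) z v : E') := by
    intro ℓ v
    have h1 : HasMFDerivAt 𝓘(ℂ, E') 𝓘(ℂ, ℂ) ℓ (extChartAt I z₀ z) ℓ :=
      ℓ.hasFDerivAt.hasMFDerivAt
    have h2 := h1.comp z ((hφ z hz).mdifferentiableAt (by simp)).hasMFDerivAt
    have h3 := h2.mfderiv
    simp only [mvfderiv, ContinuousLinearMap.comp_apply]
    exact congrArg (fun L : E' →L[ℂ] ℂ => L v) h3
  by_contra hne
  obtain ⟨ℓ, hℓ⟩ := SeparatingDual.exists_separating_of_ne (R := ℂ) (V := E') hne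
  apply hℓ
  have := h (fun y => ℓ (extChartAt I z₀ y)) fun y hy =>
    (ℓ.contMDiff.contMDiffAt.comp y (hφ y hy)).contMDiffWithinAt
  rw [key, key] at this
  exact this

end HoloRing

end

/-! ### Vector fields on products -/

section

section Product

variable {E : Type*} [NormedAddCommGroup E] [NormedSpace ℂ E] [CompleteSpace E]
  {M : Type*} [TopologicalSpace M] [ChartedSpace E M] [IsManifold 𝓘(ℂ, E) ω M]
  {P : Type*} [NormedAddCommGroup P] [NormedSpace ℂ P] [CompleteSpace P]

/-- The vector field on `M × P` with components `X` and `g`. -/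
def prodField (X : Π x : M, TangentSpace 𝓘(ℂ, E) x) (g : P → P) (y : M × P) :
    TangentSpace (𝓘(ℂ, E).prod 𝓘(ℂ, P)) y :=
  ((X y.1 : E), (g y.2 : P))

lemma contMDiffAt_prodField {X : Π x : M, TangentSpace 𝓘(ℂ, E) x} {g : P → P}
    {y : M × P} (hX : CMDiffAt ω (T% X) y.1) (hg : ContDiffAt ℂ ω g y.2) :
    CMDiffAt ω (T% (prodField X g)) y := by
  have h1 : ContMDiffAt (𝓘(ℂ, E).prod 𝓘(ℂ, P)) 𝓘(ℂ, E).tangent ω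
      (fun y : M × P => (⟨y.1, X y.1⟩ : TangentBundle 𝓘(ℂ, E) M)) y :=
    ContMDiffAt.comp (I' := 𝓘(ℂ, E)) y hX contMDiffAt_fst
  have h2 : ContMDiffAt (𝓘(ℂ, E).prod 𝓘(ℂ, P)) 𝓘(ℂ, P).tangent ω
      (fun y : M × P => (⟨y.2, g y.2⟩ : TangentBundle 𝓘(ℂ, P) P)) y := by
    have h3 : ContMDiffAt 𝓘(ℂ, P) 𝓘(ℂ, P).tangent ω
        (fun l : P => (⟨l, g l⟩ : TangentBundle 𝓘(ℂ, P) P)) y.2 :=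
      contMDiffAt_vectorSpace_iff_contDiffAt.2 hg
    exact ContMDiffAt.comp (I' := 𝓘(ℂ, P)) y h3 contMDiffAt_snd
  exact (contMDiff_equivTangentBundleProd_symm (n := ω)).contMDiffAt.comp y
    (ContMDiffAt.prodMk h1 h2)

variable {G : Type*} [NormedAddCommGroup G] [NormedSpace ℂ G]

lemma mvfderiv_comp_fst {f : M → G} {y : M × P} (hf : MDiffAt f y.1)
    (v : TangentSpace (𝓘(ℂ, E).prod 𝓘(ℂ, P)) y) :
    mvfderiv (𝓘(ℂ, E).prod 𝓘(ℂ, P)) (fun y : M × P => f y.1) y v =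
      mvfderiv 𝓘(ℂ, E) f y.1 (Prod.fst (α := E) (β := P) v) := by
  have h := (hf.hasMFDerivAt.comp y (hasMFDerivAt_fst (I := 𝓘(ℂ, E)) (I' := 𝓘(ℂ, P)) y)).mfderiv
  exact congrArg (fun L : (E × P) →L[ℂ] G => L v) h

lemma mvfderiv_comp_snd {f : P → G} {y : M × P} (hf : DifferentiableAt ℂ f y.2)
    (v : TangentSpace (𝓘(ℂ, E).prod 𝓘(ℂ, P)) y) :
    mvfderiv (𝓘(ℂ, E).prod 𝓘(ℂ, P)) (fun y : M × P => f y.2) y v =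
      fderiv ℂ f y.2 (Prod.snd (α := E) (β := P) v) := by
  have h := (hf.hasFDerivAt.hasMFDerivAt.comp y
    (hasMFDerivAt_snd (I := 𝓘(ℂ, E)) (I' := 𝓘(ℂ, P)) y)).mfderiv
  exact congrArg (fun L : (E × P) →L[ℂ] G => L v) h

/-- The Lie bracket of product vector fields is computed componentwise. -/
lemma mlieBracket_prodField {X Y : Π x : M, TangentSpace 𝓘(ℂ, E) x} {g h : P → P} {y : M × P}
    (hX : CMDiffAt ω (T% X) y.1) (hY : CMDiffAt ω (T% Y) y.1)
    (hg : ContDiffAt ℂ ω g y.2) (hh : ContDiffAt ℂ ω h y.2) :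
    VectorField.mlieBracket (𝓘(ℂ, E).prod 𝓘(ℂ, P)) (prodField X g) (prodField Y h) y =
      prodField (VectorField.mlieBracket 𝓘(ℂ, E) X Y)
        (fun l => fderiv ℂ h l (g l) - fderiv ℂ g l (h l)) y := by
  have hX' := contMDiffAt_prodField (y := y) hX hg
  have hY' := contMDiffAt_prodField (y := y) hY hh
  refine Prod.ext (α := E) (β := P) ?_ ?_
  · have hφ : ContMDiffAt 𝓘(ℂ, E) 𝓘(ℂ, E) ω (extChartAt 𝓘(ℂ, E) y.1) y.1 := contMDiffAt_extChartAt
    have hev : ∀ᶠ z in 𝓝 y, ContMDiffAt 𝓘(ℂ, E) 𝓘(ℂ, E) ω (extChartAt 𝓘(ℂ, E) y.1) z.1 := by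
      have : ∀ᶠ x in 𝓝 y.1, ContMDiffAt 𝓘(ℂ, E) 𝓘(ℂ, E) ω (extChartAt 𝓘(ℂ, E) y.1) x := by
        filter_upwards [(chartAt E y.1).open_source.mem_nhds (mem_chart_source E y.1)] with x hx
        exact contMDiffAt_extChartAt' hx
      exact continuous_fst.continuousAt.eventually this
    have hφ' : ContMDiffAt (𝓘(ℂ, E).prod 𝓘(ℂ, P)) 𝓘(ℂ, E) ω
        (fun z : M × P => extChartAt 𝓘(ℂ, E) y.1 z.1) y := hφ.comp y contMDiffAt_fst
    have hinj := (isInvertible_mfderiv_extChartAt (I := 𝓘(ℂ, E))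
      (mem_extChartAt_source (I := 𝓘(ℂ, E)) y.1)).injective
    have hev' : ∀ (Z : Π x : M, TangentSpace 𝓘(ℂ, E) x) (k : P → P),
        (fun z : M × P => mvfderiv (𝓘(ℂ, E).prod 𝓘(ℂ, P))
        (fun z : M × P => extChartAt 𝓘(ℂ, E) y.1 z.1) z (prodField Z k z)) =ᶠ[𝓝 y]
        fun z => mvfderiv 𝓘(ℂ, E) (extChartAt 𝓘(ℂ, E) y.1) z.1 (Z z.1) := by
      intro Z k
      filter_upwards [hev] with z hz
      exact mvfderiv_comp_fst (hz.mdifferentiableAt (by simp)) _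
    apply hinj
    have h1 := mvfderiv_mlieBracket hφ' (hX'.mdifferentiableAt (by simp))
      (hY'.mdifferentiableAt (by simp))
    have h2 := mvfderiv_mlieBracket hφ (hX.mdifferentiableAt (by simp))
      (hY.mdifferentiableAt (by simp))
    rw [mvfderiv_comp_fst (hφ.mdifferentiableAt (by simp)), mvfderiv_congr_nhds (hev' Y h),
      mvfderiv_congr_nhds (hev' X g), mvfderiv_comp_fst
        ((contMDiffAt_mvfderiv_apply hφ hY).mdifferentiableAt (by simp)),
      mvfderiv_comp_fst
        ((contMDiffAt_mvfderiv_apply hφ hX).mdifferentiableAt (by simp))] at h1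
    exact h1.trans h2.symm
  · have hev' : ∀ (Z : Π x : M, TangentSpace 𝓘(ℂ, E) x) (k : P → P),
        (fun z : M × P => mvfderiv (𝓘(ℂ, E).prod 𝓘(ℂ, P))
        (fun z : M × P => z.2) z (prodField Z k z)) = fun z => k z.2 := by
      intro Z k
      funext z
      rw [mvfderiv_comp_snd (f := fun l : P => l) differentiableAt_fun_id]
      simp [prodField]
    have h1 := mvfderiv_mlieBracket (I := 𝓘(ℂ, E).prod 𝓘(ℂ, P)) (f := fun z : M × P => z.2)
      (contMDiffAt_snd) (hX'.mdifferentiableAt (by simp)) (hY'.mdifferentiableAt (by simp))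
    rw [hev', hev', mvfderiv_comp_snd (hh.differentiableAt (by simp)),
      mvfderiv_comp_snd (hg.differentiableAt (by simp)),
      mvfderiv_comp_snd (f := fun l : P => l) differentiableAt_fun_id] at h1
    rw [fderiv_fun_id] at h1
    exact h1

end Product

end

/-! ### The calculus on the product with a fibre model -/

section

/-- A space of fibre coordinates for a `TwistorCalculus`: functions `lam i` and vector fields `dl i`
on a vector space `P`, and constants `sig i` as there. -/
structure FibreModel (q : ℕ) (P : Type*) [NormedAddCommGroup P] [NormedSpace ℂ P] where
  lam : Fin q → P → ℂ
  dl : Fin q → P → P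
  sig : Fin q → ℂ
  contDiff_lam : ∀ i, ContDiff ℂ ω (lam i)
  contDiff_dl : ∀ i, ContDiff ℂ ω (dl i)
  fderiv_lam : ∀ i j l, fderiv ℂ (lam j) l (dl i l) = (if i = j then 1 else 0) - sig i * lam j l
  bracket : ∀ i j l, fderiv ℂ (dl j) l (dl i l) - fderiv ℂ (dl i) l (dl j l) =
    sig i • dl j l - sig j • dl i l

/-- A frame `e` of the tangent bundle over `O`, and connection coefficients `Γ`, `γ`, with the index
conventions of `TwistorCalculus`. -/
structure FrameData (E : Type*) [NormedAddCommGroup E] [NormedSpace ℂ E]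
    {M : Type*} [TopologicalSpace M] [ChartedSpace E M] [IsManifold 𝓘(ℂ, E) ω M]
    (p q : ℕ) (O : Set M) where
  isOpen : IsOpen O
  e : Fin p × Fin q → Π x : M, TangentSpace 𝓘(ℂ, E) x
  frame : IsLocalFrameOn 𝓘(ℂ, E) E ω e O
  Γ : Fin p × Fin q → Fin p → Fin p → M → ℂ
  γ : Fin p × Fin q → Fin q → Fin q → M → ℂ
  contMDiffOn_Γ : ∀ a i j, CMDiff[O] ω (Γ a i j)
  contMDiffOn_γ : ∀ a i j, CMDiff[O] ω (γ a i j)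

variable {E : Type*} [NormedAddCommGroup E] [NormedSpace ℂ E] [CompleteSpace E]
  {M : Type*} [TopologicalSpace M] [ChartedSpace E M] [IsManifold 𝓘(ℂ, E) ω M]
  {P : Type*} [NormedAddCommGroup P] [NormedSpace ℂ P] [CompleteSpace P] {p q : ℕ}

namespace FrameData

variable {O : Set M} (Q : FrameData E p q O) (m : FibreModel q P)

/-- The structure functions of the frame: `[e a, e b] = ∑ d, c a b d • e d`. -/
def c (a b d : Fin p × Fin q) (x : M) : ℂ :=
  Q.frame.coeff d x (VectorField.mlieBracket 𝓘(ℂ, E) (Q.e a) (Q.e b) x)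

lemma contMDiffAt_e (a : Fin p × Fin q) {x : M} (hx : x ∈ O) : CMDiffAt ω (T% (Q.e a)) x :=
  (Q.frame.contMDiffOn a).contMDiffAt (Q.isOpen.mem_nhds hx)

lemma contMDiffOn_c (a b d : Fin p × Fin q) : CMDiff[O] ω (Q.c a b d) :=
  contMDiffOn_frameCoeff Q.frame Q.isOpen (fun _ hx =>
    (contMDiffAt_mlieBracket (Q.contMDiffAt_e a hx) (Q.contMDiffAt_e b hx)).contMDiffWithinAt) d

variable (W : TopologicalSpace.Opens (M × P)) (hW : ∀ y ∈ W, y.1 ∈ O)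

variable {W}

lemma contMDiffOn_prodField {X : Π x : M, TangentSpace 𝓘(ℂ, E) x} {g : P → P}
    (hW : ∀ y ∈ W, y.1 ∈ O) (hX : ∀ x ∈ O, CMDiffAt ω (T% X) x) (hg : ContDiff ℂ ω g) :
    CMDiff[(W : Set (M × P))] ω (T% (prodField X g)) := fun y hy =>
  (contMDiffAt_prodField (hX y.1 (hW y hy)) hg.contDiffAt).contMDiffWithinAt

lemma contMDiffOn_comp_fst {f : M → ℂ} (hO : IsOpen O) (hW : ∀ y ∈ W, y.1 ∈ O)
    (hf : CMDiff[O] ω f) :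
    ContMDiffOn (𝓘(ℂ, E).prod 𝓘(ℂ, P)) 𝓘(ℂ, ℂ) ω (fun y : M × P => f y.1) W := fun y hy =>
  ((hf.contMDiffAt (hO.mem_nhds (hW y hy))).comp y contMDiffAt_fst).contMDiffWithinAt

lemma contMDiffOn_comp_snd {f : P → ℂ} (hf : ContDiff ℂ ω f) :
    ContMDiffOn (𝓘(ℂ, E).prod 𝓘(ℂ, P)) 𝓘(ℂ, ℂ) ω (fun y : M × P => f y.2) W := fun y _ =>
  (hf.contMDiff.contMDiffAt.comp y contMDiffAt_snd).contMDiffWithinAt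

variable (W)

/-- The derivation given by the vector field `e a`, extended trivially to the product. -/
def derE (a : Fin p × Fin q) : Derivation ℂ (HoloRing (𝓘(ℂ, E).prod 𝓘(ℂ, P)) W)
    (HoloRing (𝓘(ℂ, E).prod 𝓘(ℂ, P)) W) :=
  der (prodField (Q.e a) 0) (contMDiffOn_prodField hW (fun _ hx => Q.contMDiffAt_e a hx)
    contDiff_const)

/-- The derivation given by the vertical vector field `dl i`. -/
def derV (i : Fin q) : Derivation ℂ (HoloRing (𝓘(ℂ, E).prod 𝓘(ℂ, P)) W)
    (HoloRing (𝓘(ℂ, E).prod 𝓘(ℂ, P)) W) :=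
  der (prodField 0 (m.dl i)) (contMDiffOn_prodField (O := univ) (fun _ _ => mem_univ _) (fun x _ =>
    contMDiff_zeroSection ℂ (TangentSpace 𝓘(ℂ, E)) x)
    (m.contDiff_dl i))

/-- Pull back a holomorphic function on `O` to `W`. -/
def base (f : M → ℂ) (hf : CMDiff[O] ω f) : HoloRing (𝓘(ℂ, E).prod 𝓘(ℂ, P)) W :=
  HoloRing.mk (fun y => f y.1) (contMDiffOn_comp_fst Q.isOpen hW hf)

lemma contMDiffAt_zero (x : M) : CMDiffAt ω (T% (0 : Π x : M, TangentSpace 𝓘(ℂ, E) x)) x :=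
  contMDiff_zeroSection ℂ (TangentSpace 𝓘(ℂ, E)) x

lemma contDiffAt_zero_map (l : P) : ContDiffAt ℂ ω (0 : P → P) l := contDiffAt_const

lemma derV_base (i : Fin q) (f : M → ℂ) (hf : CMDiff[O] ω f) :
    derV (E := E) (M := M) m W i (Q.base W hW f hf) = 0 := by
  refine HoloRing.ext_apply fun y => ?_
  rw [derV, base, der_mk, mvfderiv_comp_fst ((hf.contMDiffAt
    (Q.isOpen.mem_nhds (hW y y.2))).mdifferentiableAt (by simp))]
  exact map_zero _

lemma derE_base (a : Fin p × Fin q) (f : M → ℂ) (hf : CMDiff[O] ω f) (y : W) :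
    (Q.derE W hW a (Q.base W hW f hf)).1 y = mvfderiv 𝓘(ℂ, E) f y.1.1 (Q.e a y.1.1) := by
  rw [derE, base, der_mk, mvfderiv_comp_fst ((hf.contMDiffAt
    (Q.isOpen.mem_nhds (hW y y.2))).mdifferentiableAt (by simp))]
  rfl

/-- The twistor calculus on an open subset of `M × P` given by a frame and a fibre model. -/
def calculus : TwistorCalculus p q (HoloRing (𝓘(ℂ, E).prod 𝓘(ℂ, P)) W) where
  e := Q.derE W hW
  del := derV m W
  lam i := HoloRing.mk (fun y => m.lam i y.2) (contMDiffOn_comp_snd (m.contDiff_lam i))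
  sig := m.sig
  c a b d := Q.base W hW (Q.c a b d) (Q.contMDiffOn_c a b d)
  Γ a i j := Q.base W hW (Q.Γ a i j) (Q.contMDiffOn_Γ a i j)
  γ a i j := Q.base W hW (Q.γ a i j) (Q.contMDiffOn_γ a i j)
  lie_e a b := by
    rw [derE, derE, lie_der]
    ext1 f
    obtain ⟨F, hF, rfl⟩ := f.exists_eq_mk
    refine HoloRing.ext_apply fun y => ?_
    rw [der_mk, TwistorCalculus.sum_derivation_apply, HoloRing.sum_coe,
      mlieBracket_prodField (Q.contMDiffAt_e a (hW y y.2)) (Q.contMDiffAt_e b (hW y y.2))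
        (contDiffAt_zero_map _) (contDiffAt_zero_map _)]
    have h : prodField (VectorField.mlieBracket 𝓘(ℂ, E) (Q.e a) (Q.e b))
        (fun l => fderiv ℂ (0 : P → P) l ((0 : P → P) l) - fderiv ℂ (0 : P → P) l ((0 : P → P) l))
          y.1 = ∑ d, Q.c a b d y.1.1 • prodField (Q.e d) (0 : P → P) y.1 := by
      refine Prod.ext (α := E) (β := P) ?_ ?_
      · refine (frame_sum_coeff Q.frame (hW y y.2)
          (VectorField.mlieBracket 𝓘(ℂ, E) (Q.e a) (Q.e b) y.1.1)).symm.trans ?_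
        exact (map_sum (ContinuousLinearMap.fst ℂ E P)
          (fun d => Q.c a b d y.1.1 • prodField (Q.e d) (0 : P → P) y.1) _).symm
      · refine Eq.trans ?_ (map_sum (ContinuousLinearMap.snd ℂ E P)
          (fun d => Q.c a b d y.1.1 • prodField (Q.e d) (0 : P → P) y.1) _).symm
        rw [Finset.sum_eq_zero]
        · simp [prodField]
        · intro d _
          exact smul_zero (M := ℂ) (A := P) _
    rw [h, map_sum]
    refine Finset.sum_congr rfl fun d _ => ?_
    rw [map_smul]
    change _ = Q.c a b d y.1.1 * (Q.derE W hW d _).1 y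
    rw [derE, der_mk]; rfl
  lie_e_del a i := by
    rw [derE, derV, lie_der]
    ext1 f
    obtain ⟨F, hF, rfl⟩ := f.exists_eq_mk
    refine HoloRing.ext_apply fun y => ?_
    rw [der_mk, mlieBracket_prodField (Q.contMDiffAt_e a (hW y y.2)) (contMDiffAt_zero _)
      (contDiffAt_zero_map _) (m.contDiff_dl i).contDiffAt]
    have h : prodField (VectorField.mlieBracket 𝓘(ℂ, E) (Q.e a) 0)
        (fun l => fderiv ℂ (m.dl i) l ((0 : P → P) l) - fderiv ℂ (0 : P → P) l (m.dl i l)) y.1 =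
          0 := by
      refine Prod.ext (α := E) (β := P) ?_ ?_
      · change VectorField.mlieBracket 𝓘(ℂ, E) (Q.e a) 0 y.1.1 = 0
        simp
      · simp [prodField]; rfl
    rw [h, map_zero]; rfl
  lie_del i j := by
    rw [derV, derV, lie_der]
    ext1 f
    obtain ⟨F, hF, rfl⟩ := f.exists_eq_mk
    refine HoloRing.ext_apply fun y => ?_
    rw [der_mk, mlieBracket_prodField (contMDiffAt_zero _) (contMDiffAt_zero _)
      (m.contDiff_dl i).contDiffAt (m.contDiff_dl j).contDiffAt]
    have h : prodField (VectorField.mlieBracket 𝓘(ℂ, E) (0 : Π x : M, TangentSpace 𝓘(ℂ, E) x) 0)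
        (fun l => fderiv ℂ (m.dl j) l (m.dl i l) - fderiv ℂ (m.dl i) l (m.dl j l)) y.1 =
          m.sig i • prodField (E := E) 0 (m.dl j) y.1 - m.sig j • prodField 0 (m.dl i) y.1 := by
      refine Prod.ext (α := E) (β := P) ?_ ?_
      · refine Eq.trans (b := (0 : E)) ?_ ?_
        · change VectorField.mlieBracket 𝓘(ℂ, E) (0 : Π x : M, TangentSpace 𝓘(ℂ, E) x) 0 y.1.1 = 0
          simp
        · change (0 : E) = m.sig i • (0 : E) - m.sig j • (0 : E)
          simp
      · exact m.bracket i j y.1.2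
    rw [h, map_sub, map_smul, map_smul]
    change _ = m.sig i • (derV m W j _).1 y - m.sig j • (derV m W i _).1 y
    rw [derV, derV, der_mk, der_mk]
  e_lam a i := by
    refine HoloRing.ext_apply fun y => ?_
    rw [derE, der_mk, mvfderiv_comp_snd ((m.contDiff_lam i).differentiable (by simp) _)]
    exact map_zero _
  del_lam i j := by
    refine HoloRing.ext_apply fun y => ?_
    rw [derV, der_mk, mvfderiv_comp_snd ((m.contDiff_lam j).differentiable (by simp) _)]
    refine (m.fderiv_lam i j y.1.2).trans ?_
    split_ifs <;> simp [HoloRing.mk_coe]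
  del_c i a b d := derV_base Q m W hW i _ _
  del_γ i a b d := derV_base Q m W hW i _ _

/-- The components of the torsion in the frame `e`. -/
def T (a b d : Fin p × Fin q) (x : M) : ℂ :=
  (if d.2 = b.2 then Q.Γ a d.1 b.1 x else 0) + (if d.1 = b.1 then Q.γ a d.2 b.2 x else 0)
    - (if d.2 = a.2 then Q.Γ b d.1 a.1 x else 0) - (if d.1 = a.1 then Q.γ b d.2 a.2 x else 0)
    - Q.c a b d x

/-- The components of the curvature of the connection with coefficients `γ` in the frame `e`. -/
def R (a b : Fin p × Fin q) (i j : Fin q) (x : M) : ℂ :=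
  mvfderiv 𝓘(ℂ, E) (Q.γ b i j) x (Q.e a x) - mvfderiv 𝓘(ℂ, E) (Q.γ a i j) x (Q.e b x) +
    ∑ k, (Q.γ a i k x * Q.γ b k j x - Q.γ b i k x * Q.γ a k j x) - ∑ d, Q.c a b d x * Q.γ d i j x

/-- The components of `∇π` along `e a`, for `π` with constant components. -/
def gl (a : Fin p × Fin q) (i : Fin q) (y : M × P) : ℂ := ∑ j, Q.γ a i j y.1 * m.lam j y.2

/-- The coefficients `C` of the brackets of the fields `fieldV` in the torsion- and curvature-free
case. -/
def C (A B D : Fin p) (y : M × P) : ℂ :=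
  ∑ i, m.lam i y.2 * (Q.Γ (A, i) D B y.1 - Q.Γ (B, i) D A y.1
    + (if D = B then ∑ j, m.sig j * Q.gl m (A, i) j y else 0)
    - (if D = A then ∑ j, m.sig j * Q.gl m (B, i) j y else 0))

/-- The components of the torsion evaluated on `s_A ⊗ π` and `s_B ⊗ π`. -/
def Tlam (A B : Fin p) (d : Fin p × Fin q) (y : M × P) : ℂ :=
  ∑ i, ∑ j, m.lam i y.2 * m.lam j y.2 * Q.T (A, i) (B, j) d y.1

/-- The components of the curvature evaluated on `s_A ⊗ π`, `s_B ⊗ π` and `π`. -/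
def r (A B : Fin p) (k : Fin q) (y : M × P) : ℂ :=
  ∑ i, ∑ j, m.lam i y.2 * m.lam j y.2 * ∑ l, Q.R (A, i) (B, j) k l y.1 * m.lam l y.2

/-- The horizontal lift of `e a`. -/
def fieldD (a : Fin p × Fin q) (y : M × P) : TangentSpace (𝓘(ℂ, E).prod 𝓘(ℂ, P)) y :=
  prodField (Q.e a) 0 y - ∑ i, Q.gl m a i y • prodField 0 (m.dl i) y

/-- The vector field `v_A = ∑ i, λ_i D_{Ai}`. -/
def fieldV (A : Fin p) (y : M × P) : TangentSpace (𝓘(ℂ, E).prod 𝓘(ℂ, P)) y :=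
  ∑ i, m.lam i y.2 • Q.fieldD m (A, i) y

lemma calculus_T (a b d : Fin p × Fin q) (y : W) :
    ((Q.calculus m W hW).T a b d).1 y = Q.T a b d y.1.1 := by
  simp only [TwistorCalculus.T, T, calculus]
  split_ifs <;> rfl

lemma calculus_R (a b : Fin p × Fin q) (i j : Fin q) (y : W) :
    ((Q.calculus m W hW).R a b i j).1 y = Q.R a b i j y.1.1 := by
  have h1 := Q.derE_base W hW a _ (Q.contMDiffOn_γ b i j) y
  have h2 := Q.derE_base W hW b _ (Q.contMDiffOn_γ a i j) y
  rw [R, ← h1, ← h2]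
  change _ - _ + (∑ k, _ : HoloRing (𝓘(ℂ, E).prod 𝓘(ℂ, P)) W).1 y -
    (∑ d, _ : HoloRing (𝓘(ℂ, E).prod 𝓘(ℂ, P)) W).1 y = _
  rw [HoloRing.sum_coe, HoloRing.sum_coe]
  rfl

lemma calculus_gl (a : Fin p × Fin q) (i : Fin q) (y : W) :
    ((Q.calculus m W hW).gl a i).1 y = Q.gl m a i y.1 := by
  rw [TwistorCalculus.gl, HoloRing.sum_coe]; rfl

lemma calculus_Tlam (A B : Fin p) (d : Fin p × Fin q) (y : W) :
    ((Q.calculus m W hW).Tlam A B d).1 y = Q.Tlam m A B d y.1 := by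
  rw [TwistorCalculus.Tlam, HoloRing.sum_coe, Tlam]
  refine Finset.sum_congr rfl fun i _ => ?_
  rw [HoloRing.sum_coe]
  refine Finset.sum_congr rfl fun j _ => ?_
  rw [← Q.calculus_T m W hW]
  rfl

lemma calculus_r (A B : Fin p) (k : Fin q) (y : W) :
    ((Q.calculus m W hW).r A B k).1 y = Q.r m A B k y.1 := by
  rw [TwistorCalculus.r, HoloRing.sum_coe, r]
  refine Finset.sum_congr rfl fun i _ => ?_
  rw [HoloRing.sum_coe]
  refine Finset.sum_congr rfl fun j _ => ?_
  have : (∑ l, (Q.calculus m W hW).R (A, i) (B, j) k l * (Q.calculus m W hW).lam l).1 y =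
      ∑ l, Q.R (A, i) (B, j) k l y.1.1 * m.lam l y.1.2 := by
    rw [HoloRing.sum_coe]
    refine Finset.sum_congr rfl fun l _ => ?_
    rw [← Q.calculus_R m W hW]
    rfl
  rw [← this]
  rfl

lemma calculus_C (A B D : Fin p) (y : W) :
    ((Q.calculus m W hW).C A B D).1 y = Q.C m A B D y.1 := by
  have hk : ∀ a, ((Q.calculus m W hW).kap a).1 y = ∑ j, m.sig j * Q.gl m a j y.1 := by
    intro a
    rw [TwistorCalculus.kap, HoloRing.sum_coe]
    refine Finset.sum_congr rfl fun j _ => ?_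
    rw [← Q.calculus_gl m W hW]
    rfl
  rw [TwistorCalculus.C, HoloRing.sum_coe, C]
  refine Finset.sum_congr rfl fun i _ => ?_
  rw [← hk, ← hk]
  split_ifs <;> rfl

lemma calculus_D (a : Fin p × Fin q) {F : M × P → ℂ}
    (hF : ContMDiffOn (𝓘(ℂ, E).prod 𝓘(ℂ, P)) 𝓘(ℂ, ℂ) ω F W) (y : W) :
    ((Q.calculus m W hW).D a (HoloRing.mk F hF)).1 y =
      mvfderiv (𝓘(ℂ, E).prod 𝓘(ℂ, P)) F y.1 (Q.fieldD m a y) := by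
  have h1 : ((Q.calculus m W hW).e a (HoloRing.mk F hF)).1 y =
    mvfderiv (𝓘(ℂ, E).prod 𝓘(ℂ, P)) F y.1 (prodField (Q.e a) 0 y.1) := by
    change (Q.derE W hW a _).1 y = _
    rw [derE, der_mk]
  rw [TwistorCalculus.D, Derivation.sub_apply, TwistorCalculus.G, fieldD, map_sub, map_sum, ← h1,
    TwistorCalculus.sum_derivation_apply]
  change _ - (∑ i, _ : HoloRing (𝓘(ℂ, E).prod 𝓘(ℂ, P)) W).1 y = _
  rw [HoloRing.sum_coe]
  congr 1
  refine Finset.sum_congr rfl fun i _ => ?_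
  have h2 : ((Q.calculus m W hW).del i (HoloRing.mk F hF)).1 y =
    mvfderiv (𝓘(ℂ, E).prod 𝓘(ℂ, P)) F y.1 (prodField 0 (m.dl i) y.1) := by
    change (derV m W i _).1 y = _
    rw [derV, der_mk]
  rw [map_smul, ← h2, ← Q.calculus_gl m W hW]
  rfl

lemma calculus_v (A : Fin p) {F : M × P → ℂ}
    (hF : ContMDiffOn (𝓘(ℂ, E).prod 𝓘(ℂ, P)) 𝓘(ℂ, ℂ) ω F W) (y : W) :
    ((Q.calculus m W hW).v A (HoloRing.mk F hF)).1 y =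
      mvfderiv (𝓘(ℂ, E).prod 𝓘(ℂ, P)) F y.1 (Q.fieldV m A y) := by
  rw [TwistorCalculus.v, fieldV, map_sum, TwistorCalculus.sum_derivation_apply, HoloRing.sum_coe]
  refine Finset.sum_congr rfl fun i _ => ?_
  rw [map_smul, ← Q.calculus_D m W hW]
  rfl

lemma contMDiffAt_gl (a : Fin p × Fin q) (i : Fin q) {y : M × P} (hy : y.1 ∈ O) :
    ContMDiffAt (𝓘(ℂ, E).prod 𝓘(ℂ, P)) 𝓘(ℂ, ℂ) ω (Q.gl m a i) y := by
  refine contMDiffAt_finsetSum fun j _ => ?_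
  exact (((Q.contMDiffOn_γ a i j).contMDiffAt (Q.isOpen.mem_nhds hy)).comp y contMDiffAt_fst).mul
    ((m.contDiff_lam j).contMDiff.contMDiffAt.comp y contMDiffAt_snd)

lemma contMDiffAt_fieldD (a : Fin p × Fin q) {y : M × P} (hy : y.1 ∈ O) :
    CMDiffAt ω (T% (Q.fieldD m a)) y := by
  refine (contMDiffAt_prodField (Q.contMDiffAt_e a hy) (contDiffAt_zero_map _)).sub_section ?_
  refine ContMDiffAt.sum_section fun i _ => ?_
  exact (Q.contMDiffAt_gl m a i hy).smul_section
    (contMDiffAt_prodField (contMDiffAt_zero _) (m.contDiff_dl i).contDiffAt)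

lemma contMDiffAt_fieldV (A : Fin p) {y : M × P} (hy : y.1 ∈ O) :
    CMDiffAt ω (T% (Q.fieldV m A)) y := by
  refine ContMDiffAt.sum_section fun i _ => ?_
  exact ((m.contDiff_lam i).contMDiff.contMDiffAt.comp y contMDiffAt_snd).smul_section
    (Q.contMDiffAt_fieldD m (A, i) hy)

/-- The brackets of the fields `v_A`, in terms of torsion and curvature. This is
`TwistorCalculus.lie_v` in the ring of holomorphic functions on a neighbourhood of `y` inside a chart
domain, where vector fields are determined by their derivations. -/
theorem mlieBracket_fieldV (A B : Fin p) {y : M × P} (hy : y.1 ∈ O) :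
    VectorField.mlieBracket (𝓘(ℂ, E).prod 𝓘(ℂ, P)) (Q.fieldV m A) (Q.fieldV m B) y =
      ∑ D, Q.C m A B D y • Q.fieldV m D y - ∑ d, Q.Tlam m A B d y • Q.fieldD m d y -
        ∑ i, Q.r m A B i y • prodField 0 (m.dl i) y := by
  let W : TopologicalSpace.Opens (M × P) := ⟨(O ∩ (chartAt E y.1).source) ×ˢ univ,
    (Q.isOpen.inter (chartAt E y.1).open_source).prod isOpen_univ⟩
  have hW : ∀ y ∈ W, y.1 ∈ O := fun y hy => hy.1.1
  have hyW : y ∈ W := ⟨⟨hy, mem_chart_source E y.1⟩, mem_univ _⟩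
  have hWc : (W : Set (M × P)) ⊆ (chartAt (ModelProd E P) y).source := by
    intro z hz
    rw [prodChartedSpace_chartAt]
    exact ⟨hz.1.2, mem_univ _⟩
  refine tangent_eq_of_mvfderiv_eq (I := 𝓘(ℂ, E).prod 𝓘(ℂ, P)) hWc hyW fun F hF => ?_
  have hV : ∀ A, CMDiff[(W : Set (M × P))] ω (T% (Q.fieldV m A)) := fun A z hz =>
    (Q.contMDiffAt_fieldV m A (hW z hz)).contMDiffWithinAt
  have hv : ∀ A, (Q.calculus m W hW).v A = der (Q.fieldV m A) (hV A) := by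
    intro A
    ext1 f
    obtain ⟨F, hF, rfl⟩ := f.exists_eq_mk
    refine HoloRing.ext_apply fun z => ?_
    rw [der_mk, calculus_v]
  have h := (Q.calculus m W hW).lie_v A B
  rw [hv A, hv B, lie_der] at h
  have h1 := congrArg (fun δ => (δ (HoloRing.mk F hF)).1 ⟨y, hyW⟩) h
  simp only [der_mk] at h1
  rw [h1, map_sub, map_sub, map_sum, map_sum, map_sum, Derivation.sub_apply, Derivation.sub_apply,
    TwistorCalculus.sum_derivation_apply, TwistorCalculus.sum_derivation_apply,
    TwistorCalculus.sum_derivation_apply]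
  change (∑ i, _ : HoloRing (𝓘(ℂ, E).prod 𝓘(ℂ, P)) W).1 _ -
    (∑ i, _ : HoloRing (𝓘(ℂ, E).prod 𝓘(ℂ, P)) W).1 _ -
    (∑ i, _ : HoloRing (𝓘(ℂ, E).prod 𝓘(ℂ, P)) W).1 _ = _
  rw [HoloRing.sum_coe, HoloRing.sum_coe, HoloRing.sum_coe]
  congr 1
  · congr 1
    · refine Finset.sum_congr rfl fun D _ => ?_
      rw [map_smul, ← Q.calculus_v m W hW D hF ⟨y, hyW⟩, ← Q.calculus_C m W hW A B D ⟨y, hyW⟩]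
      rfl
    · refine Finset.sum_congr rfl fun D _ => ?_
      rw [map_smul, ← Q.calculus_D m W hW D hF ⟨y, hyW⟩, ← Q.calculus_Tlam m W hW A B D ⟨y, hyW⟩]
      rfl
  · refine Finset.sum_congr rfl fun i _ => ?_
    have h2 : ((Q.calculus m W hW).del i (HoloRing.mk F hF)).1 ⟨y, hyW⟩ =
      mvfderiv (𝓘(ℂ, E).prod 𝓘(ℂ, P)) F y (prodField 0 (m.dl i) y) := by
      change (derV m W i _).1 _ = _
      rw [derV, der_mk]
    rw [map_smul, ← h2, ← Q.calculus_r m W hW A B i ⟨y, hyW⟩]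
    rfl

end FrameData

end

/-! ### Homogeneous coordinates -/

section

/-- The homogeneous coordinates `π` on the fibres of `V`, with the vector fields `∂/∂πⁱ`. -/
def coneModel (q : ℕ) : FibreModel q (Fin q → ℂ) where
  lam i l := l i
  dl i _ := Pi.single i 1
  sig _ := 0
  contDiff_lam i := contDiff_apply ℂ ℂ i
  contDiff_dl i := contDiff_const
  fderiv_lam i j l := by
    rw [(hasFDerivAt_apply (𝕜 := ℂ) j l).fderiv]
    simp [Pi.single_apply, eq_comm]
  bracket i j l := by simp

variable {E : Type*} [NormedAddCommGroup E] [NormedSpace ℂ E] [CompleteSpace E]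
  {M : Type*} [TopologicalSpace M] [ChartedSpace E M] [IsManifold 𝓘(ℂ, E) ω M]
  {p q : ℕ}

namespace FrameData

variable {O : Set M} (Q : FrameData E p q O)

lemma c_skew (a b d : Fin p × Fin q) (x : M) : Q.c a b d x = - Q.c b a d x := by
  rw [c, c, VectorField.mlieBracket_swap_apply, map_neg]

/-- In homogeneous coordinates, over a chart domain and away from the zero section, the calculus is
that of a cone. -/
lemma isCone_calculus (W : TopologicalSpace.Opens (M × (Fin q → ℂ))) (hW : ∀ y ∈ W, y.1 ∈ O)
    {y₀ : M × (Fin q → ℂ)} (hWc : (W : Set (M × (Fin q → ℂ))) ⊆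
      (chartAt (ModelProd E (Fin q → ℂ)) y₀).source) (h0 : ∀ y ∈ W, y.2 ≠ 0) :
    (Q.calculus (coneModel q) W hW).IsCone where
  sig _ := rfl
  skew a b d := HoloRing.ext_apply fun y => Q.c_skew a b d y.1.1
  indep f hf := by
    have key : ∀ y : W, ∑ d, (f (.inl d)).1 y • prodField (Q.e d) (0 : (Fin q → ℂ) → _) y.1 +
        ∑ i, (f (.inr i)).1 y • prodField (E := E) 0 ((coneModel q).dl i) y.1 = 0 := by
      intro y
      refine tangent_eq_of_mvfderiv_eq (I := 𝓘(ℂ, E).prod 𝓘(ℂ, Fin q → ℂ)) hWc y.2 fun F hF => ?_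
      have h1 := congrArg (fun δ => (δ (HoloRing.mk F hF)).1 y) hf
      rw [TwistorCalculus.frameField_frame] at h1
      simp only [Derivation.add_apply, TwistorCalculus.sum_derivation_apply] at h1
      change (∑ d, _ : HoloRing (𝓘(ℂ, E).prod 𝓘(ℂ, Fin q → ℂ)) W).1 y +
        (∑ i, _ : HoloRing (𝓘(ℂ, E).prod 𝓘(ℂ, Fin q → ℂ)) W).1 y = 0 at h1
      rw [HoloRing.sum_coe, HoloRing.sum_coe] at h1
      rw [map_zero, map_add, map_sum, map_sum, ← h1]
      congr 1
      · refine Finset.sum_congr rfl fun d _ => ?_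
        rw [map_smul]
        change _ = (f (.inl d)).1 y * (Q.derE W hW d _).1 y
        rw [derE, der_mk]; rfl
      · refine Finset.sum_congr rfl fun i _ => ?_
        rw [map_smul]
        change _ = (f (.inr i)).1 y * (derV (coneModel q) W i _).1 y
        rw [derV, der_mk]; rfl
    funext d
    refine HoloRing.ext_apply fun y => ?_
    rcases d with d | i
    · have h1 := congrArg (ContinuousLinearMap.fst ℂ E (Fin q → ℂ)) (key y)
      have h2 : ∑ d, (f (.inl d)).1 y • Q.e d y.1.1 = 0 := by
        refine Eq.trans ?_ h1
        refine Eq.trans ?_ (map_add (ContinuousLinearMap.fst ℂ E (Fin q → ℂ)) _ _).symm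
        refine Eq.trans ?_ (congrArg₂ (· + ·) (map_sum (ContinuousLinearMap.fst ℂ E (Fin q → ℂ)) _ _).symm
          (map_sum (ContinuousLinearMap.fst ℂ E (Fin q → ℂ)) _ _).symm)
        have : ∑ i, (ContinuousLinearMap.fst ℂ E (Fin q → ℂ))
          ((f (.inr i)).1 y • prodField (E := E) 0 ((coneModel q).dl i) y.1) = 0 :=
          Finset.sum_eq_zero fun i _ => smul_zero (M := ℂ) (A := E) _
        exact ((congrArg₂ (· + ·) rfl this).trans (add_zero _)).symm
      have h3 := frame_coeff_sum Q.frame (hW y y.2) (fun d => (f (.inl d)).1 y) d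
      rw [h2, map_zero] at h3
      exact h3.symm
    · have h1 := congrArg (ContinuousLinearMap.snd ℂ E (Fin q → ℂ)) (key y)
      have h2 : ∑ i, (f (.inr i)).1 y • (Pi.single i (1 : ℂ) : Fin q → ℂ) = 0 := by
        refine Eq.trans ?_ h1
        refine Eq.trans ?_ (map_add (ContinuousLinearMap.snd ℂ E (Fin q → ℂ)) _ _).symm
        refine Eq.trans ?_ (congrArg₂ (· + ·) (map_sum (ContinuousLinearMap.snd ℂ E (Fin q → ℂ)) _ _).symm
          (map_sum (ContinuousLinearMap.snd ℂ E (Fin q → ℂ)) _ _).symm)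
        have : ∑ d, (ContinuousLinearMap.snd ℂ E (Fin q → ℂ))
          ((f (.inl d)).1 y • prodField (Q.e d) (0 : (Fin q → ℂ) → _) y.1) = 0 :=
          Finset.sum_eq_zero fun i _ => smul_zero (M := ℂ) (A := Fin q → ℂ) _
        exact ((congrArg₂ (· + ·) this rfl).trans (zero_add _)).symm
      have h3 := congrFun h2 i
      simpa [Finset.sum_apply, Pi.single_apply] using h3
  cancel f hf := by
    refine HoloRing.ext_apply fun y => ?_
    obtain ⟨i, hi⟩ := Function.ne_iff.1 (h0 y y.2)
    have h1 : f.1 y * y.1.2 i = 0 := congrArg (fun g => g.1 y) (hf i)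
    exact (mul_eq_zero.1 h1).resolve_right hi

/-- A punctured cone neighbourhood of `(x, π)` on which the calculus applies. -/
def coneNhd (y : M × (Fin q → ℂ)) : TopologicalSpace.Opens (M × (Fin q → ℂ)) :=
  ⟨(O ∩ (chartAt E y.1).source) ×ˢ {0}ᶜ,
    (Q.isOpen.inter (chartAt E y.1).open_source).prod isOpen_compl_singleton⟩

lemma fst_mem_of_mem_coneNhd (y : M × (Fin q → ℂ)) : ∀ z ∈ Q.coneNhd y, z.1 ∈ O :=
  fun _ hz => hz.1.1

lemma mem_coneNhd {y : M × (Fin q → ℂ)} (hy : y.1 ∈ O) (h0 : y.2 ≠ 0) : y ∈ Q.coneNhd y :=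
  ⟨⟨hy, mem_chart_source E y.1⟩, h0⟩

lemma isCone_coneNhd (y : M × (Fin q → ℂ)) :
    (Q.calculus (coneModel q) (Q.coneNhd y) (Q.fst_mem_of_mem_coneNhd y)).IsCone :=
  Q.isCone_calculus _ _ (y₀ := y) (by
    intro z hz
    rw [prodChartedSpace_chartAt]
    exact ⟨hz.1.2, mem_univ _⟩) fun z hz => hz.2

lemma r_zero (A B : Fin p) (i : Fin q) (x : M) : Q.r (coneModel q) A B i (x, 0) = 0 := by
  simp [r, coneModel]

/-- For `p > 2`, vanishing of the torsion along the twistor distribution forces the curvature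
along it to be a multiple of `π`. -/
theorem r_parallel (hp : 2 < p)
    (hT : ∀ x ∈ O, ∀ A B d l, Q.Tlam (coneModel q) A B d (x, l) = 0) {x : M} (hx : x ∈ O)
    (A B : Fin p) (i j : Fin q) (l : Fin q → ℂ) :
    Q.r (coneModel q) A B i (x, l) * l j = Q.r (coneModel q) A B j (x, l) * l i := by
  rcases eq_or_ne l 0 with rfl | hl
  · simp
  have h := (Q.isCone_coneNhd (x, l)).r_parallel (fun A B d => HoloRing.ext_apply fun y => by
    rw [Q.calculus_Tlam]
    exact hT y.1.1 (Q.fst_mem_of_mem_coneNhd _ _ y.2) A B d y.1.2) hp A B i j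
  have h1 := congrArg (fun g => g.1 ⟨(x, l), Q.mem_coneNhd hx hl⟩) h
  rw [← Q.calculus_r (coneModel q) (Q.coneNhd (x, l)) (Q.fst_mem_of_mem_coneNhd _) A B i
    ⟨(x, l), Q.mem_coneNhd hx hl⟩, ← Q.calculus_r (coneModel q) (Q.coneNhd (x, l))
    (Q.fst_mem_of_mem_coneNhd _) A B j ⟨(x, l), Q.mem_coneNhd hx hl⟩]
  exact h1

/-- In frames with trace-free connection coefficients, a curvature which is a multiple of `π` along the twistor
distribution vanishes along it. -/
theorem r_eq_zero
    (hT : ∀ x ∈ O, ∀ A B d l, Q.Tlam (coneModel q) A B d (x, l) = 0)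
    (hr : ∀ x ∈ O, ∀ A B i j l,
      Q.r (coneModel q) A B i (x, l) * l j = Q.r (coneModel q) A B j (x, l) * l i)
    (hΓ : ∀ x ∈ O, ∀ a, ∑ D, Q.Γ a D D x = 0) (hγ : ∀ x ∈ O, ∀ a, ∑ i, Q.γ a i i x = 0)
    (hTr : ∀ x ∈ O, ∀ b, ∑ d, Q.T d b d x = 0) {x : M} (hx : x ∈ O)
    (A B : Fin p) (i : Fin q) (l : Fin q → ℂ) :
    Q.r (coneModel q) A B i (x, l) = 0 := by
  rcases eq_or_ne l 0 with rfl | hl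
  · exact Q.r_zero A B i x
  have hW := Q.fst_mem_of_mem_coneNhd (x, l)
  have h := (Q.isCone_coneNhd (x, l)).r_eq_zero
    (fun A B d => HoloRing.ext_apply fun y => by
      rw [Q.calculus_Tlam]
      exact hT y.1.1 (hW _ y.2) A B d y.1.2)
    (fun A B i j => HoloRing.ext_apply fun y => by
      have := hr y.1.1 (hW _ y.2) A B i j y.1.2
      rw [← Q.calculus_r (coneModel q) _ hW A B i y, ← Q.calculus_r (coneModel q) _ hW A B j y]
        at this
      exact this)
    (fun a => HoloRing.ext_apply fun y => by
      rw [HoloRing.sum_coe]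
      exact hΓ y.1.1 (hW _ y.2) a)
    (fun a => HoloRing.ext_apply fun y => by
      rw [HoloRing.sum_coe]
      exact hγ y.1.1 (hW _ y.2) a)
    (fun b => HoloRing.ext_apply fun y => by
      rw [HoloRing.sum_coe]
      simp only [Q.calculus_T]
      exact hTr y.1.1 (hW _ y.2) b) A B i
  have h1 := congrArg (fun g => g.1 ⟨(x, l), Q.mem_coneNhd hx hl⟩) h
  rw [← Q.calculus_r (coneModel q) (Q.coneNhd (x, l)) (Q.fst_mem_of_mem_coneNhd _) A B i
    ⟨(x, l), Q.mem_coneNhd hx hl⟩]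
  exact h1

end FrameData

end

/-! ### Affine coordinates -/

section

variable {E : Type*} [NormedAddCommGroup E] [NormedSpace ℂ E] [CompleteSpace E]
  {M : Type*} [TopologicalSpace M] [ChartedSpace E M] [IsManifold 𝓘(ℂ, E) ω M]
  {p q : ℕ}

namespace FrameData

variable {P : Type*} [NormedAddCommGroup P] [NormedSpace ℂ P] [CompleteSpace P]
variable {O : Set M} (Q : FrameData E p q O) (m : FibreModel q P)

lemma fst_fieldD (a : Fin p × Fin q) (y : M × P) :
    ContinuousLinearMap.fst ℂ E P (Q.fieldD m a y) = Q.e a y.1 := by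
  refine (map_sub (ContinuousLinearMap.fst ℂ E P) _ _).trans ?_
  refine (congrArg₂ (· - ·) rfl ((map_sum (ContinuousLinearMap.fst ℂ E P) _ _).trans
    (Finset.sum_eq_zero fun i _ => smul_zero (M := ℂ) (A := E) _))).trans (sub_zero (G := E) _)

lemma snd_fieldD (a : Fin p × Fin q) (y : M × P) :
    ContinuousLinearMap.snd ℂ E P (Q.fieldD m a y) = - ∑ i, Q.gl m a i y • m.dl i y.2 := by
  refine (map_sub (ContinuousLinearMap.snd ℂ E P) _ _).trans ?_
  exact (congrArg₂ (· - ·) rfl (map_sum (ContinuousLinearMap.snd ℂ E P) _ _)).trans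
    (zero_sub (G := P) _)

lemma fst_fieldV (A : Fin p) (y : M × P) :
    ContinuousLinearMap.fst ℂ E P (Q.fieldV m A y) =
      ∑ i, m.lam i y.2 • (Q.e (A, i) y.1 : E) := by
  refine (map_sum (ContinuousLinearMap.fst ℂ E P) _ _).trans ?_
  exact Finset.sum_congr rfl fun i _ => congrArg (m.lam i y.2 • ·) (Q.fst_fieldD m (A, i) y)

lemma snd_fieldV (A : Fin p) (y : M × P) :
    ContinuousLinearMap.snd ℂ E P (Q.fieldV m A y) =
      - ∑ i, m.lam i y.2 • ∑ j, Q.gl m (A, i) j y • m.dl j y.2 := by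
  refine (map_sum (ContinuousLinearMap.snd ℂ E P) _ _).trans ?_
  rw [← Finset.sum_neg_distrib]
  exact Finset.sum_congr rfl fun i _ => (congrArg (m.lam i y.2 • ·)
    (Q.snd_fieldD m (A, i) y)).trans (smul_neg (M := ℂ) (A := P) _ _)

/-- The fields `D a` are linearly independent modulo vertical vectors. -/
lemma sum_fieldD_eq {y : M × P} (hy : y.1 ∈ O) {a : Fin p × Fin q → ℂ} {b : Fin q → ℂ}
    (h : ∑ d, a d • Q.fieldD m d y = ∑ i, b i • prodField (E := E) 0 (m.dl i) y) :
    a = 0 ∧ ∑ i, b i • m.dl i y.2 = 0 := by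
  have ha : a = 0 := by
    have h1 : ∑ d, a d • Q.e d y.1 = 0 := by
      have h2 := congrArg (ContinuousLinearMap.fst ℂ E P) h
      have h3 := map_sum (ContinuousLinearMap.fst ℂ E P) (fun d => a d • Q.fieldD m d y) Finset.univ
      have h4 := map_sum (ContinuousLinearMap.fst ℂ E P)
        (fun i => b i • prodField (E := E) 0 (m.dl i) y) Finset.univ
      have h5 : ∑ i, ContinuousLinearMap.fst ℂ E P (b i • prodField (E := E) 0 (m.dl i) y) = 0 :=
        Finset.sum_eq_zero fun i _ => smul_zero (M := ℂ) (A := E) _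
      refine Eq.trans ?_ ((h3.symm.trans h2).trans (h4.trans h5))
      exact Finset.sum_congr rfl fun d _ => (congrArg (a d • ·) (Q.fst_fieldD m d y)).symm
    funext d
    have h3 := frame_coeff_sum Q.frame hy a d
    rw [h1, map_zero] at h3
    exact h3.symm
  refine ⟨ha, ?_⟩
  subst ha
  have h1 : ∑ d, (0 : Fin p × Fin q → ℂ) d • Q.fieldD m d y = 0 :=
    Finset.sum_eq_zero fun d _ => zero_smul ℂ (Q.fieldD m d y)
  have h2 := congrArg (ContinuousLinearMap.snd ℂ E P) (h1.symm.trans h)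
  have h4 := map_sum (ContinuousLinearMap.snd ℂ E P)
    (fun i => b i • prodField (E := E) 0 (m.dl i) y) Finset.univ
  exact (h2.trans h4).symm

/-- The bracket `[v_A, v_B]` is the combination of the `v_D` with coefficients `c D` exactly if the
torsion is in `U ⊗ π` with components determined by `c`, and the curvature term vanishes. -/
theorem mlieBracket_fieldV_eq_iff (A B : Fin p) {y : M × P} (hy : y.1 ∈ O) (c : Fin p → ℂ) :
    VectorField.mlieBracket (𝓘(ℂ, E).prod 𝓘(ℂ, P)) (Q.fieldV m A) (Q.fieldV m B) y =
      ∑ D, c D • Q.fieldV m D y ↔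
    (∀ d : Fin p × Fin q, Q.Tlam m A B d y = (Q.C m A B d.1 y - c d.1) * m.lam d.2 y.2) ∧
      ∑ i, Q.r m A B i y • m.dl i y.2 = 0 := by
  have hV : ∀ f : Fin p → ℂ, ∑ D, f D • Q.fieldV m D y =
      ∑ d : Fin p × Fin q, (f d.1 * m.lam d.2 y.2) • Q.fieldD m d y := by
    intro f
    rw [Fintype.sum_prod_type]
    refine Finset.sum_congr rfl fun D _ => ?_
    rw [fieldV, Finset.smul_sum]
    exact Finset.sum_congr rfl fun i _ => smul_smul _ _ _
  rw [Q.mlieBracket_fieldV m A B hy, sub_eq_iff_eq_add, hV, hV, ← sub_eq_iff_eq_add',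
    ← Finset.sum_sub_distrib, ← Finset.sum_sub_distrib]
  have hS : ∑ d : Fin p × Fin q, ((Q.C m A B d.1 y * m.lam d.2 y.2) • Q.fieldD m d y -
      Q.Tlam m A B d y • Q.fieldD m d y - (c d.1 * m.lam d.2 y.2) • Q.fieldD m d y) =
      ∑ d : Fin p × Fin q, ((Q.C m A B d.1 y - c d.1) * m.lam d.2 y.2 - Q.Tlam m A B d y) •
        Q.fieldD m d y :=
    Finset.sum_congr rfl fun d _ => by module
  rw [hS]
  constructor
  · intro h
    obtain ⟨h1, h2⟩ := Q.sum_fieldD_eq m hy h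
    exact ⟨fun d => (sub_eq_zero.1 (congrFun h1 d)).symm, h2⟩
  · rintro ⟨h1, h2⟩
    have h3 : ∑ i, Q.r m A B i y • prodField (E := E) 0 (m.dl i) y = 0 := by
      refine Prod.ext (α := E) (β := P) ?_ ?_
      · exact (map_sum (ContinuousLinearMap.fst ℂ E P) _ _).trans
          (Finset.sum_eq_zero fun i _ => smul_zero (M := ℂ) (A := E) _)
      · exact (map_sum (ContinuousLinearMap.snd ℂ E P)
          (fun i => Q.r m A B i y • prodField (E := E) 0 (m.dl i) y) _).trans h2
    refine Eq.trans (Finset.sum_eq_zero fun d _ => ?_) h3.symm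
    rw [h1, sub_self, zero_smul]

end FrameData

section Affine

open ParaconformalStructure

variable (k : Fin q)

/-- The affine coordinates `λⁱ` on the fibres of `P(V)`, with the projections to the affine chart
of the vector fields `∂/∂πⁱ`. -/
def affineModel : FibreModel q ({i : Fin q // i ≠ k} → ℂ) where
  lam i l := homogeneous k l i
  dl i l := fun j => (if i = j then 1 else 0) - (if i = k then 1 else 0) * l j
  sig i := if i = k then 1 else 0
  contDiff_lam i := by
    unfold homogeneous
    split_ifs with h
    · exact contDiff_const
    · exact contDiff_apply ℂ ℂ (⟨i, h⟩ : {i : Fin q // i ≠ k})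
  contDiff_dl i := contDiff_pi.2 fun j =>
    contDiff_const.sub (contDiff_const.mul (contDiff_apply ℂ ℂ j))
  fderiv_lam i j l := by
    unfold homogeneous
    by_cases h : j = k
    · subst h; simp
    · simp only [h, dite_false]
      rw [(hasFDerivAt_apply (𝕜 := ℂ) (⟨j, h⟩ : {i : Fin q // i ≠ k}) l).fderiv]
      simp
  bracket i j l := by
    -- `dl i` is affine, so that its derivative is its linear part
    have h : ∀ (i : Fin q) (w : {i : Fin q // i ≠ k} → ℂ),
        fderiv ℂ (fun l : {i : Fin q // i ≠ k} → ℂ => fun j : {i : Fin q // i ≠ k} =>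
          (if i = j then (1 : ℂ) else 0) - (if i = k then 1 else 0) * l j) l w =
        (-(if i = k then (1 : ℂ) else 0)) • w := by
      intro i w
      have h2 := ((hasFDerivAt_id (𝕜 := ℂ) l).const_smul (if i = k then (1 : ℂ) else 0)).const_sub
        (fun j : {i : Fin q // i ≠ k} => (if i = j then (1 : ℂ) else 0))
      exact (congrArg (fun L : ({i : Fin q // i ≠ k} → ℂ) →L[ℂ] ({i : Fin q // i ≠ k} → ℂ) => L w)
        h2.fderiv).trans (neg_smul (if i = k then (1 : ℂ) else 0) w).symm
    rw [h, h]
    funext n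
    simp only [Pi.sub_apply, Pi.smul_apply, smul_eq_mul]
    split_ifs
    all_goals simp
    all_goals ring

variable {k} {O : Set M} (Q : FrameData E p q O)

/-- The kernel of the projection of vertical vectors to the affine chart consists of the multiples of
the Euler field. -/
lemma sum_smul_affine_dl (r : Fin q → ℂ) (l : {i : Fin q // i ≠ k} → ℂ) :
    ∑ i, r i • (affineModel k).dl i l = 0 ↔ ∀ i, r i = r k * homogeneous k l i := by
  have h : ∀ j : {i : Fin q // i ≠ k}, (∑ i, r i • (affineModel k).dl i l) j = r j - r k * l j := by
    intro j
    simp [affineModel, Finset.sum_apply, mul_sub, Finset.sum_sub_distrib]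
  rw [funext_iff]
  simp only [h, Pi.zero_apply, sub_eq_zero]
  constructor
  · intro h i
    by_cases hi : i = k
    · simp [homogeneous, hi]
    · simpa [homogeneous, hi] using h ⟨i, hi⟩
  · intro h j
    simpa [homogeneous, j.2] using h j

/-- The coefficients of the brackets are unique. They are read off from the components along the
frame vectors `e_{Dk}`, as `λᵏ = 1`. -/
theorem coeff_eq_of_mlieBracket {A B : Fin p} {y : M × ({i : Fin q // i ≠ k} → ℂ)} (hy : y.1 ∈ O)
    {c : Fin p → ℂ} (h : VectorField.mlieBracket (𝓘(ℂ, E).prod 𝓘(ℂ, {i : Fin q // i ≠ k} → ℂ))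
      (Q.fieldV (affineModel k) A) (Q.fieldV (affineModel k) B) y =
      ∑ D, c D • Q.fieldV (affineModel k) D y) (D : Fin p) :
    c D = Q.C (affineModel k) A B D y - Q.Tlam (affineModel k) A B (D, k) y := by
  have h1 := ((Q.mlieBracket_fieldV_eq_iff (affineModel k) A B hy c).1 h).1 (D, k)
  have h2 : (affineModel k).lam k y.2 = 1 := by simp [affineModel, homogeneous]
  rw [h1, h2]; ring

/-- The homogeneous coordinates, normalised by `πᵏ = 1`, as polynomials in the affine coordinates. -/
def homogeneousPoly (k i : Fin q) : MvPolynomial {i : Fin q // i ≠ k} ℂ :=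
  if h : i = k then 1 else MvPolynomial.X ⟨i, h⟩

lemma eval_homogeneousPoly (i : Fin q) (l : {i : Fin q // i ≠ k} → ℂ) :
    MvPolynomial.eval l (homogeneousPoly k i) = homogeneous k l i := by
  unfold homogeneousPoly homogeneous
  split_ifs <;> simp

lemma totalDegree_homogeneousPoly (i : Fin q) : (homogeneousPoly k i).totalDegree ≤ 1 := by
  unfold homogeneousPoly
  split_ifs <;> simp

/-- The coefficients of the brackets of the Lax tuple as polynomials in the affine coordinates. -/
def laxPoly (k : Fin q) (A B D : Fin p) (x : M) : MvPolynomial {i : Fin q // i ≠ k} ℂ :=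
  ∑ i, MvPolynomial.C (Q.Γ (A, i) D B x - Q.Γ (B, i) D A x) * homogeneousPoly k i +
    ∑ i, ∑ j, MvPolynomial.C ((if D = B then Q.γ (A, i) k j x else 0) -
      (if D = A then Q.γ (B, i) k j x else 0) - Q.T (A, i) (B, j) (D, k) x) *
        (homogeneousPoly k i * homogeneousPoly k j)

/-- Both `C` and `Tlam` are of degree two in the `λⁱ`; in `C`, the `λⁱ` are multiplied by the linear
functions `(∇λ)ᵏ`. -/
lemma eval_laxPoly (A B D : Fin p) (x : M) (l : {i : Fin q // i ≠ k} → ℂ) :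
    MvPolynomial.eval l (laxPoly Q k A B D x) =
      Q.C (affineModel k) A B D (x, l) - Q.Tlam (affineModel k) A B (D, k) (x, l) := by
  have h : ∀ a : Fin p × Fin q, ∑ j, (affineModel k).sig j * Q.gl (affineModel k) a j (x, l) =
      ∑ j, Q.γ a k j x * homogeneous k l j := by
    intro a; simp [affineModel, FrameData.gl]
  have h2 : (affineModel k).lam = fun i l => homogeneous k l i := rfl
  simp only [laxPoly, FrameData.C, FrameData.Tlam, h, map_add, map_sum, map_mul,
    MvPolynomial.eval_C, eval_homogeneousPoly, h2]
  rw [← Finset.sum_add_distrib, ← Finset.sum_sub_distrib]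
  refine Finset.sum_congr rfl fun i _ => ?_
  have h3 : ∀ (c : Prop) [Decidable c] (a : Fin p × Fin q),
      (if c then ∑ j, Q.γ a k j x * homogeneous k l j else 0) =
        ∑ j, (if c then Q.γ a k j x else 0) * homogeneous k l j := by
    intro c _ a; split_ifs <;> simp
  rw [h3, h3, mul_sub, mul_add, add_sub_assoc, add_sub_assoc, Finset.mul_sum, Finset.mul_sum,
    ← Finset.sum_sub_distrib, ← Finset.sum_sub_distrib, mul_comm]
  congr 1
  refine Finset.sum_congr rfl fun j _ => ?_
  ring

lemma totalDegree_laxPoly (A B D : Fin p) (x : M) : (laxPoly Q k A B D x).totalDegree ≤ 2 := by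
  have hC : ∀ (c : ℂ) (P : MvPolynomial {i : Fin q // i ≠ k} ℂ), P.totalDegree ≤ 2 →
      (MvPolynomial.C c * P).totalDegree ≤ 2 := by
    intro c P hP
    refine (MvPolynomial.totalDegree_mul _ _).trans ?_
    simpa using hP
  refine (MvPolynomial.totalDegree_add _ _).trans (max_le ?_ ?_)
  · refine MvPolynomial.totalDegree_finsetSum_le fun i _ => hC _ _ ?_
    exact (totalDegree_homogeneousPoly i).trans (by norm_num)
  · refine MvPolynomial.totalDegree_finsetSum_le fun i _ =>
      MvPolynomial.totalDegree_finsetSum_le fun j _ => hC _ _ ?_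
    refine (MvPolynomial.totalDegree_mul _ _).trans ?_
    have h1 := totalDegree_homogeneousPoly (k := k) i
    have h2 := totalDegree_homogeneousPoly (k := k) j
    omega

lemma contMDiffOn_ite_zero (c : Prop) [Decidable c] {f : M → ℂ} (hf : CMDiff[O] ω f) :
    CMDiff[O] ω (fun x => if c then f x else 0) := by
  split_ifs
  · exact hf
  · exact contMDiffOn_const

lemma contMDiffOn_T (a b d : Fin p × Fin q) : CMDiff[O] ω (Q.T a b d) := by
  exact ((((contMDiffOn_ite_zero _ (Q.contMDiffOn_Γ a d.1 b.1)).add (contMDiffOn_ite_zero _ (Q.contMDiffOn_γ a d.2 b.2))).sub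
    (contMDiffOn_ite_zero _ (Q.contMDiffOn_Γ b d.1 a.1))).sub (contMDiffOn_ite_zero _ (Q.contMDiffOn_γ b d.2 a.2))).sub
    (Q.contMDiffOn_c a b d)

lemma contMDiffOn_coeff_laxPoly (A B D : Fin p) (n : {i : Fin q // i ≠ k} →₀ ℕ) :
    CMDiff[O] ω (fun x => (laxPoly Q k A B D x).coeff n) := by
  simp only [laxPoly, MvPolynomial.coeff_add, MvPolynomial.coeff_sum, MvPolynomial.coeff_C_mul]
  refine ContMDiffOn.add (contMDiffOn_finsetSum fun i _ => ?_)
    (contMDiffOn_finsetSum fun i _ => contMDiffOn_finsetSum fun j _ => ?_)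
  · exact ((Q.contMDiffOn_Γ _ _ _).sub (Q.contMDiffOn_Γ _ _ _)).mul contMDiffOn_const
  · exact (((contMDiffOn_ite_zero _ (Q.contMDiffOn_γ _ _ _)).sub (contMDiffOn_ite_zero _ (Q.contMDiffOn_γ _ _ _))).sub
      (contMDiffOn_T Q _ _ _)).mul contMDiffOn_const

end Affine

end

/-! ### The curvature of a holomorphic connection -/

section

lemma eventually_contMDiffAt_of {E' : Type*} [NormedAddCommGroup E'] [NormedSpace ℂ E']
    {H' : Type*} [TopologicalSpace H'] {I : ModelWithCorners ℂ E' H'}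
    {N : Type*} [TopologicalSpace N] [ChartedSpace H' N] [IsManifold I ω N]
    {E'' : Type*} [NormedAddCommGroup E''] [NormedSpace ℂ E'']
    {H'' : Type*} [TopologicalSpace H''] {J : ModelWithCorners ℂ E'' H''}
    {N' : Type*} [TopologicalSpace N'] [ChartedSpace H'' N'] [IsManifold J ω N']
    {f : N → N'} {x : N} (h : ContMDiffAt I J ω f x) : ∀ᶠ y in 𝓝 x, ContMDiffAt I J ω f y := by
  obtain ⟨u, hu, hwu⟩ := (contMDiffAt_iff_contMDiffOn_nhds (by simp)).1 h
  filter_upwards [eventually_mem_nhds_iff.2 hu] with y hy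
  exact hwu.contMDiffAt hy

section Curvature

variable {E : Type*} [NormedAddCommGroup E] [NormedSpace ℂ E] [CompleteSpace E]
  {M : Type*} [TopologicalSpace M] [ChartedSpace E M] [IsManifold 𝓘(ℂ, E) ω M]
  {F : Type*} [NormedAddCommGroup F] [NormedSpace ℂ F]
  {V : M → Type*} [TopologicalSpace (TotalSpace F V)]
  [∀ x, AddCommGroup (V x)] [∀ x, Module ℂ (V x)] [∀ x, TopologicalSpace (V x)]
  [∀ x, IsTopologicalAddGroup (V x)] [∀ x, ContinuousSMul ℂ (V x)]
  [FiberBundle F V] [VectorBundle ℂ F V] [ContMDiffVectorBundle ω F V 𝓘(ℂ, E)]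
  (nabla : CovariantDerivative 𝓘(ℂ, E) F V)

open ParaconformalStructure

/-- Holomorphic covariant derivatives of holomorphic sections are holomorphic. -/
lemma contMDiffAt_covDeriv (h : IsHolomorphicConnection nabla) {w : Π x : M, V x}
    {X : Π x : M, TangentSpace 𝓘(ℂ, E) x} {x : M} (hw : CMDiffAt ω (T% w) x)
    (hX : CMDiffAt ω (T% X) x) : CMDiffAt ω (T% (fun y => nabla w y (X y))) x := by
  obtain ⟨u, hu, hwu⟩ := (contMDiffAt_iff_contMDiffOn_nhds (by simp)).1 hw
  obtain ⟨v, hvu, hvo, hxv⟩ := mem_nhds_iff.1 hu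
  have h1 := (h v hvo).contMDiff ((hwu.mono hvu).of_le (n := ω) le_top)
  exact (h1.contMDiffAt (hvo.mem_nhds hxv)).clm_bundle_apply hX

lemma eventually_contMDiffAt {w : Π x : M, V x} {x : M} (hw : CMDiffAt ω (T% w) x) :
    ∀ᶠ y in 𝓝 x, CMDiffAt ω (T% w) y :=
  eventually_contMDiffAt_of hw

lemma covDeriv_add {w w' : Π x : M, V x} {x : M} (hw : MDiffAt (T% w) x)
    (hw' : MDiffAt (T% w') x) (X : TangentSpace 𝓘(ℂ, E) x) :
    nabla (w + w') x X = nabla w x X + nabla w' x X := by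
  rw [nabla.isCovariantDerivativeOnUniv.add hw hw']; simp

lemma covDeriv_smul {f : M → ℂ} {w : Π x : M, V x} {x : M} (hf : MDiffAt f x)
    (hw : MDiffAt (T% w) x) (X : TangentSpace 𝓘(ℂ, E) x) :
    nabla (f • w) x X = f x • nabla w x X + mvfderiv 𝓘(ℂ, E) f x X • w x := by
  rw [nabla.isCovariantDerivativeOnUniv.leibniz hw hf]; simp

lemma covDeriv_congr {w w' : Π x : M, V x} {x : M} (hw : MDiffAt (T% w) x)
    (hw' : MDiffAt (T% w') x) (h : ∀ᶠ y in 𝓝 x, w y = w' y) (X : TangentSpace 𝓘(ℂ, E) x) :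
    nabla w x X = nabla w' x X := by
  rw [nabla.isCovariantDerivativeOnUniv.congr_of_eventuallyEq hw hw' univ_mem h]

lemma covDeriv_sum_smul {ι : Type*} [Fintype ι] {f : ι → M → ℂ} {w : ι → Π x : M, V x} {x : M}
    (hf : ∀ i, MDiffAt (f i) x) (hw : ∀ i, MDiffAt (T% (w i)) x) (X : TangentSpace 𝓘(ℂ, E) x) :
    nabla (fun y => ∑ i, f i y • w i y) x X =
      ∑ i, (f i x • nabla (w i) x X + mvfderiv 𝓘(ℂ, E) (f i) x X • w i x) := by
  classical
  have key : ∀ s : Finset ι, nabla (fun y => ∑ i ∈ s, f i y • w i y) x X =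
      ∑ i ∈ s, (f i x • nabla (w i) x X + mvfderiv 𝓘(ℂ, E) (f i) x X • w i x) := by
    intro s
    induction s using Finset.induction with
    | empty =>
      have : (fun y => ∑ i ∈ (∅ : Finset ι), f i y • w i y) = (0 : Π x : M, V x) := by
        funext y; simp
      rw [this, nabla.zero]; simp
    | insert a s ha ih =>
      have h1 : (fun y => ∑ i ∈ insert a s, f i y • w i y) =
          f a • w a + fun y => ∑ i ∈ s, f i y • w i y := by
        funext y; simp [Finset.sum_insert ha]
      have h2 : MDiffAt (T% (fun y => ∑ i ∈ s, f i y • w i y)) x :=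
        MDifferentiableAt.sum_section fun i _ => (hf i).smul_section (hw i)
      rw [h1, covDeriv_add nabla ((hf a).smul_section (hw a)) h2,
        covDeriv_smul nabla (hf a) (hw a), ih, Finset.sum_insert ha]
  exact key Finset.univ

/-- The operator `[∇_X, ∇_Y] - ∇_{[X, Y]}` on sections. -/
def curvOp (X Y : Π x : M, TangentSpace 𝓘(ℂ, E) x) (w : Π x : M, V x) (x : M) : V x :=
  nabla (fun y => nabla w y (Y y)) x (X x) - nabla (fun y => nabla w y (X y)) x (Y x) -
    nabla w x (VectorField.mlieBracket 𝓘(ℂ, E) X Y x)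

lemma curvature_eq (x : M) (X Y : TangentSpace 𝓘(ℂ, E) x) (w : V x) :
    curvature nabla x X Y w = curvOp nabla (FiberBundle.extend E X) (FiberBundle.extend E Y)
      (FiberBundle.extend F w) x := by
  simp only [curvature, curvOp, FiberBundle.extend_apply_self]

/-- A local operator on holomorphic sections which is linear over holomorphic functions depends
only on the value of the section at the point. -/
lemma tensorial_eq_sum {G : Type*} [AddCommGroup G] [Module ℂ G] {ι : Type*} [Fintype ι]
    {t : ι → Π x : M, V x} {O : Set M} (hO : IsOpen O) (ht : IsLocalFrameOn 𝓘(ℂ, E) F ω t O)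
    {x : M} (hx : x ∈ O) (T : (Π x : M, V x) → G)
    (hcongr : ∀ w w', CMDiffAt ω (T% w) x → CMDiffAt ω (T% w') x → (∀ᶠ y in 𝓝 x, w y = w' y) →
      T w = T w')
    (hadd : ∀ w w', CMDiffAt ω (T% w) x → CMDiffAt ω (T% w') x → T (w + w') = T w + T w')
    (hsmul : ∀ (f : M → ℂ) w, CMDiffAt ω f x → CMDiffAt ω (T% w) x → T (f • w) = f x • T w)
    {w : Π x : M, V x} (hw : CMDiffAt ω (T% w) x) :
    T w = ∑ i, ht.coeff i x (w x) • T (t i) := by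
  classical
  have hc : ∀ i, CMDiffAt ω (fun y => ht.coeff i y (w y)) x := fun i =>
    contMDiffAt_frameCoeff (J := 𝓘(ℂ, E)) ht hO (b := fun x : M => x) hx hw i
  have hti : ∀ i, CMDiffAt ω (T% (t i)) x := fun i => ht.contMDiffAt hO hx i
  have key : ∀ s : Finset ι, T (fun y => ∑ i ∈ s, ht.coeff i y (w y) • t i y) =
      ∑ i ∈ s, ht.coeff i x (w x) • T (t i) := by
    intro s
    induction s using Finset.induction with
    | empty =>
      have h0 : (fun y => ∑ i ∈ (∅ : Finset ι), ht.coeff i y (w y) • t i y) =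
          (fun _ : M => (0 : ℂ)) • w := by
        funext y; simp
      rw [h0, hsmul _ _ contMDiffAt_const hw]; simp
    | insert a s ha ih =>
      have h1 : (fun y => ∑ i ∈ insert a s, ht.coeff i y (w y) • t i y) =
          (fun y => ht.coeff a y (w y)) • t a + fun y => ∑ i ∈ s, ht.coeff i y (w y) • t i y := by
        funext y; simp [Finset.sum_insert ha]
      have h2 : CMDiffAt ω (T% (fun y => ∑ i ∈ s, ht.coeff i y (w y) • t i y)) x :=
        ContMDiffAt.sum_section fun i _ => (hc i).smul_section (hti i)
      rw [h1, hadd _ _ ((hc a).smul_section (hti a)) h2, hsmul _ _ (hc a) (hti a),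
        ih, Finset.sum_insert ha]
  rw [← key Finset.univ]
  refine hcongr _ _ hw (ContMDiffAt.sum_section fun i _ => (hc i).smul_section (hti i)) ?_
  exact ht.eventually_eq_sum_coeff_smul w (hO.mem_nhds hx)

variable {nabla} (h : IsHolomorphicConnection nabla) {X X' Y : Π x : M, TangentSpace 𝓘(ℂ, E) x}
  {w w' : Π x : M, V x} {x : M} {f : M → ℂ}
include h

lemma curvOp_swap : curvOp nabla X Y w x = - curvOp nabla Y X w x := by
  rw [curvOp, curvOp, VectorField.mlieBracket_swap_apply, map_neg]; abel

lemma curvOp_congr_section (hX : CMDiffAt ω (T% X) x) (hY : CMDiffAt ω (T% Y) x)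
    (hw : CMDiffAt ω (T% w) x) (hw' : CMDiffAt ω (T% w') x) (hww : ∀ᶠ y in 𝓝 x, w y = w' y) :
    curvOp nabla X Y w x = curvOp nabla X Y w' x := by
  have key : ∀ Z : Π x : M, TangentSpace 𝓘(ℂ, E) x,
      ∀ᶠ y in 𝓝 x, nabla w y (Z y) = nabla w' y (Z y) := by
    intro Z
    filter_upwards [eventually_contMDiffAt hw, eventually_contMDiffAt hw',
      eventually_eventually_nhds.2 hww] with y h1 h2 h3
    exact covDeriv_congr nabla (h1.mdifferentiableAt (by simp)) (h2.mdifferentiableAt (by simp)) h3 _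
  rw [curvOp, curvOp,
    covDeriv_congr nabla ((contMDiffAt_covDeriv nabla h hw hY).mdifferentiableAt (by simp))
      ((contMDiffAt_covDeriv nabla h hw' hY).mdifferentiableAt (by simp)) (key Y),
    covDeriv_congr nabla ((contMDiffAt_covDeriv nabla h hw hX).mdifferentiableAt (by simp))
      ((contMDiffAt_covDeriv nabla h hw' hX).mdifferentiableAt (by simp)) (key X),
    covDeriv_congr nabla (hw.mdifferentiableAt (by simp)) (hw'.mdifferentiableAt (by simp)) hww]

lemma curvOp_add_section (hX : CMDiffAt ω (T% X) x) (hY : CMDiffAt ω (T% Y) x)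
    (hw : CMDiffAt ω (T% w) x) (hw' : CMDiffAt ω (T% w') x) :
    curvOp nabla X Y (w + w') x = curvOp nabla X Y w x + curvOp nabla X Y w' x := by
  have key : ∀ Z : Π x : M, TangentSpace 𝓘(ℂ, E) x, CMDiffAt ω (T% Z) x →
      ∀ v, nabla (fun y => nabla (w + w') y (Z y)) x v =
        nabla (fun y => nabla w y (Z y)) x v + nabla (fun y => nabla w' y (Z y)) x v := by
    intro Z hZ v
    have h1 := (contMDiffAt_covDeriv nabla h hw hZ).mdifferentiableAt (n := ω) (by simp)
    have h2 := (contMDiffAt_covDeriv nabla h hw' hZ).mdifferentiableAt (n := ω) (by simp)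
    rw [← covDeriv_add nabla h1 h2]
    refine covDeriv_congr nabla ((contMDiffAt_covDeriv nabla h (hw.add_section hw') hZ).mdifferentiableAt
      (by simp)) (mdifferentiableAt_add_section h1 h2) ?_ v
    filter_upwards [eventually_contMDiffAt hw, eventually_contMDiffAt hw'] with y h1 h2
    exact covDeriv_add nabla (h1.mdifferentiableAt (by simp)) (h2.mdifferentiableAt (by simp)) _
  rw [curvOp, key Y hY, key X hX, covDeriv_add nabla (hw.mdifferentiableAt (by simp))
    (hw'.mdifferentiableAt (by simp)), curvOp, curvOp]
  abel

lemma curvOp_smul_section (hX : CMDiffAt ω (T% X) x) (hY : CMDiffAt ω (T% Y) x)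
    (hf : CMDiffAt ω f x) (hw : CMDiffAt ω (T% w) x) :
    curvOp nabla X Y (f • w) x = f x • curvOp nabla X Y w x := by
  have hf' := hf.mdifferentiableAt (n := ω) (by simp)
  have hw₁ := hw.mdifferentiableAt (n := ω) (by simp)
  have key : ∀ Z : Π x : M, TangentSpace 𝓘(ℂ, E) x, CMDiffAt ω (T% Z) x →
      ∀ v, nabla (fun y => nabla (f • w) y (Z y)) x v =
        f x • nabla (fun y => nabla w y (Z y)) x v + mvfderiv 𝓘(ℂ, E) f x v • nabla w x (Z x) +
        (mvfderiv 𝓘(ℂ, E) f x (Z x) • nabla w x v +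
          mvfderiv 𝓘(ℂ, E) (fun y => mvfderiv 𝓘(ℂ, E) f y (Z y)) x v • w x) := by
    intro Z hZ v
    have h1 := (contMDiffAt_covDeriv nabla h hw hZ).mdifferentiableAt (n := ω) (by simp)
    have h2 := (contMDiffAt_mvfderiv_apply hf hZ).mdifferentiableAt (n := ω) (by simp)
    rw [← covDeriv_smul nabla hf' h1, ← covDeriv_smul nabla h2 hw₁,
      ← covDeriv_add nabla (hf'.smul_section h1) (h2.smul_section hw₁)]
    refine covDeriv_congr nabla ((contMDiffAt_covDeriv nabla h (hf.smul_section hw) hZ).mdifferentiableAt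
      (by simp)) (mdifferentiableAt_add_section (hf'.smul_section h1) (h2.smul_section hw₁)) ?_ v
    filter_upwards [eventually_contMDiffAt hw, eventually_contMDiffAt_of hf] with y h1 h2
    exact covDeriv_smul nabla (h2.mdifferentiableAt (by simp)) (h1.mdifferentiableAt (by simp)) _
  rw [curvOp, key Y hY, key X hX, covDeriv_smul nabla hf' hw₁,
    mvfderiv_mlieBracket hf (hX.mdifferentiableAt (by simp)) (hY.mdifferentiableAt (by simp)), curvOp]
  module

lemma curvOp_congr_left (hX : CMDiffAt ω (T% X) x) (hX' : CMDiffAt ω (T% X') x)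
    (hXX : ∀ᶠ y in 𝓝 x, X y = X' y) (hw : CMDiffAt ω (T% w) x) :
    curvOp nabla X Y w x = curvOp nabla X' Y w x := by
  have h1 : VectorField.mlieBracket 𝓘(ℂ, E) X Y x = VectorField.mlieBracket 𝓘(ℂ, E) X' Y x :=
    Filter.EventuallyEq.mlieBracket_vectorField_eq hXX (EventuallyEq.refl _ _)
  rw [curvOp, curvOp, h1, hXX.self_of_nhds,
    covDeriv_congr nabla ((contMDiffAt_covDeriv nabla h hw hX).mdifferentiableAt (by simp))
      ((contMDiffAt_covDeriv nabla h hw hX').mdifferentiableAt (by simp))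
      (hXX.mono fun y hy => by simp only [hy])]

lemma curvOp_add_left (hX : CMDiffAt ω (T% X) x) (hX' : CMDiffAt ω (T% X') x)
    (hw : CMDiffAt ω (T% w) x) :
    curvOp nabla (X + X') Y w x = curvOp nabla X Y w x + curvOp nabla X' Y w x := by
  have h1 := (contMDiffAt_covDeriv nabla h hw hX).mdifferentiableAt (n := ω) (by simp)
  have h2 := (contMDiffAt_covDeriv nabla h hw hX').mdifferentiableAt (n := ω) (by simp)
  have h3 : (fun y => nabla w y ((X + X') y)) = (fun y => nabla w y (X y)) +
      fun y => nabla w y (X' y) := by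
    funext y; simp
  rw [curvOp, h3, covDeriv_add nabla h1 h2, VectorField.mlieBracket_add_left
    (hX.mdifferentiableAt (by simp)) (hX'.mdifferentiableAt (by simp)), curvOp, curvOp,
    Pi.add_apply, map_add, map_add]
  abel

lemma curvOp_smul_left (hX : CMDiffAt ω (T% X) x) (hf : CMDiffAt ω f x)
    (hw : CMDiffAt ω (T% w) x) :
    curvOp nabla (f • X) Y w x = f x • curvOp nabla X Y w x := by
  have h1 := (contMDiffAt_covDeriv nabla h hw hX).mdifferentiableAt (n := ω) (by simp)
  have hf' := hf.mdifferentiableAt (n := ω) (by simp)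
  have h3 : (fun y => nabla w y ((f • X) y)) = f • (fun y => nabla w y (X y)) := by
    funext y; simp
  rw [curvOp, h3, covDeriv_smul nabla hf' h1, VectorField.mlieBracket_smul_left hf'
    (hX.mdifferentiableAt (by simp)), curvOp]
  simp only [Pi.smul_apply', map_add, map_smul, map_neg, neg_smul]
  module

/-- The curvature in frames of `TM` and `V`. -/
lemma curvature_eq_sum {ι κ : Type*} [Fintype ι] [Fintype κ]
    {e : ι → Π x : M, TangentSpace 𝓘(ℂ, E) x} {t : κ → Π x : M, V x} {O : Set M} (hO : IsOpen O)
    (he : IsLocalFrameOn 𝓘(ℂ, E) E ω e O) (ht : IsLocalFrameOn 𝓘(ℂ, E) F ω t O) (hx : x ∈ O)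
    (X Y : TangentSpace 𝓘(ℂ, E) x) (w : V x) :
    curvature nabla x X Y w = ∑ a, he.coeff a x X • ∑ b, he.coeff b x Y •
      ∑ j, ht.coeff j x w • curvOp nabla (e a) (e b) (t j) x := by
  have hXe : CMDiffAt ω (T% (FiberBundle.extend E X : Π x : M, TangentSpace 𝓘(ℂ, E) x)) x :=
    FiberBundle.contMDiffAt_extend 𝓘(ℂ, E) E X
  have hYe : CMDiffAt ω (T% (FiberBundle.extend E Y : Π x : M, TangentSpace 𝓘(ℂ, E) x)) x :=
    FiberBundle.contMDiffAt_extend 𝓘(ℂ, E) E Y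
  have hwe : CMDiffAt ω (T% (FiberBundle.extend F w : Π x : M, V x)) x :=
    FiberBundle.contMDiffAt_extend 𝓘(ℂ, E) F w
  have hea : ∀ a, CMDiffAt ω (T% (e a)) x := fun a => he.contMDiffAt hO hx a
  rw [curvature_eq, tensorial_eq_sum hO he hx (fun X => curvOp nabla X _ _ x)
    (fun X X' hX hX' hXX => curvOp_congr_left h hX hX' hXX hwe)
    (fun X X' hX hX' => curvOp_add_left h hX hX' hwe)
    (fun f X hf hX => curvOp_smul_left h hX hf hwe) hXe, FiberBundle.extend_apply_self]
  refine Finset.sum_congr rfl fun a _ => congrArg _ ?_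
  rw [tensorial_eq_sum hO he hx (fun Y => curvOp nabla (e a) Y _ x)
    (fun Y Y' hY hY' hYY => by
      rw [curvOp_swap h, curvOp_congr_left h hY hY' hYY hwe, ← curvOp_swap h])
    (fun Y Y' hY hY' => by
      rw [curvOp_swap h, curvOp_add_left h hY hY' hwe, neg_add, ← curvOp_swap h, ← curvOp_swap h])
    (fun f Y hf hY => by
      rw [curvOp_swap h, curvOp_smul_left h hY hf hwe, ← smul_neg, ← curvOp_swap h]) hYe,
    FiberBundle.extend_apply_self]
  refine Finset.sum_congr rfl fun b _ => congrArg _ ?_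
  rw [tensorial_eq_sum hO ht hx (fun w => curvOp nabla (e a) (e b) w x)
    (fun w w' hw hw' hww => curvOp_congr_section h (hea a) (hea b) hw hw' hww)
    (fun w w' hw hw' => curvOp_add_section h (hea a) (hea b) hw hw')
    (fun f w hf hw => curvOp_smul_section h (hea a) (hea b) hf hw) hwe,
    FiberBundle.extend_apply_self]

end Curvature

end

/-! ### Torsion and curvature in frames -/

section

open ParaconformalStructure

variable {E : Type*} [NormedAddCommGroup E] [NormedSpace ℂ E] [FiniteDimensional ℂ E]
  [CompleteSpace E]
  {M : Type*} [TopologicalSpace M] [ChartedSpace E M] [IsManifold 𝓘(ℂ, E) ω M]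
  {F₁ : Type*} [NormedAddCommGroup F₁] [NormedSpace ℂ F₁] [FiniteDimensional ℂ F₁]
  {U : M → Type*} [TopologicalSpace (TotalSpace F₁ U)]
  [∀ x, AddCommGroup (U x)] [∀ x, Module ℂ (U x)] [∀ x, TopologicalSpace (U x)]
  [∀ x, IsTopologicalAddGroup (U x)] [∀ x, ContinuousSMul ℂ (U x)]
  [FiberBundle F₁ U] [VectorBundle ℂ F₁ U] [ContMDiffVectorBundle ω F₁ U 𝓘(ℂ, E)]
  {F₂ : Type*} [NormedAddCommGroup F₂] [NormedSpace ℂ F₂] [FiniteDimensional ℂ F₂]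
  {V : M → Type*} [TopologicalSpace (TotalSpace F₂ V)]
  [∀ x, AddCommGroup (V x)] [∀ x, Module ℂ (V x)] [∀ x, TopologicalSpace (V x)]
  [∀ x, IsTopologicalAddGroup (V x)] [∀ x, ContinuousSMul ℂ (V x)]
  [FiberBundle F₂ V] [VectorBundle ℂ F₂ V] [ContMDiffVectorBundle ω F₂ V 𝓘(ℂ, E)]
  {p q : ℕ} (S : ParaconformalStructure E F₁ U F₂ V p q)

namespace ParaconformalStructure

variable {O : Set M} {s : Fin p → Π y : M, U y} {t : Fin q → Π y : M, V y}

lemma iso_tmul (u : Π y : M, U y) (v : Π y : M, V y) (x : M) :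
    S.iso x (S.tmul u v x) = u x ⊗ₜ v x := by simp [tmul]

/-- Frames of `U` and `V` give a frame of the tangent bundle. -/
lemma isLocalFrameOn_tmul (hO : IsOpen O) (hs : IsLocalFrameOn 𝓘(ℂ, E) F₁ ω s O)
    (ht : IsLocalFrameOn 𝓘(ℂ, E) F₂ ω t O) :
    IsLocalFrameOn 𝓘(ℂ, E) E ω (fun a : Fin p × Fin q => S.tmul (s a.1) (t a.2)) O := by
  have hb : ∀ x (hx : x ∈ O), ∃ b : Basis (Fin p × Fin q) ℂ (TangentSpace 𝓘(ℂ, E) x),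
      ∀ a, b a = S.tmul (s a.1) (t a.2) x := by
    intro x hx
    refine ⟨((hs.toBasisAt hx).tensorProduct (ht.toBasisAt hx)).map (S.iso x).symm, ?_⟩
    rintro ⟨A, i⟩
    simp [tmul]
  refine ⟨fun {x} hx => ?_, fun {x} hx => ?_, fun a x hx => ?_⟩
  · obtain ⟨b, hb⟩ := hb x hx
    rw [← funext hb]
    exact b.linearIndependent
  · obtain ⟨b, hb⟩ := hb x hx
    rw [← funext hb, b.span_eq]
  · exact (S.holo_iso x _ _ (hs.contMDiffAt hO hx a.1) (ht.contMDiffAt hO hx a.2)).contMDiffWithinAt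

variable {nablaU : CovariantDerivative 𝓘(ℂ, E) F₁ U} {nablaV : CovariantDerivative 𝓘(ℂ, E) F₂ V}
  (hU : IsHolomorphicConnection nablaU) (hV : IsHolomorphicConnection nablaV)
  (hO : IsOpen O) (hs : IsLocalFrameOn 𝓘(ℂ, E) F₁ ω s O) (ht : IsLocalFrameOn 𝓘(ℂ, E) F₂ ω t O)

/-- The frame `e_{Ai} = α⁻¹(s_A ⊗ t_i)` and the coefficients of the connections on `U` and `V`. -/
def frameData : FrameData E p q O where
  isOpen := hO
  e a := S.tmul (s a.1) (t a.2)
  frame := S.isLocalFrameOn_tmul hO hs ht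
  Γ a C B x := hs.coeff C x (nablaU (s B) x (S.tmul (s a.1) (t a.2) x))
  γ a i j x := ht.coeff i x (nablaV (t j) x (S.tmul (s a.1) (t a.2) x))
  contMDiffOn_Γ a C B := contMDiffOn_frameCoeff hs hO (fun x hx =>
    (contMDiffAt_covDeriv nablaU hU (hs.contMDiffAt hO hx B)
      (S.holo_iso x _ _ (hs.contMDiffAt hO hx a.1)
        (ht.contMDiffAt hO hx a.2))).contMDiffWithinAt) C
  contMDiffOn_γ a i j := contMDiffOn_frameCoeff ht hO (fun x hx =>
    (contMDiffAt_covDeriv nablaV hV (ht.contMDiffAt hO hx j)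
      (S.holo_iso x _ _ (hs.contMDiffAt hO hx a.1)
        (ht.contMDiffAt hO hx a.2))).contMDiffWithinAt) i

local notation "𝒬" => frameData S hU hV hO hs ht

include hU hV hO hs ht

lemma nablaU_frame {x : M} (hx : x ∈ O) (a : Fin p × Fin q) (B : Fin p) :
    nablaU (s B) x (S.tmul (s a.1) (t a.2) x) = ∑ C, (𝒬).Γ a C B x • s C x :=
  (frame_sum_coeff hs hx _).symm

lemma nablaV_frame {x : M} (hx : x ∈ O) (a : Fin p × Fin q) (j : Fin q) :
    nablaV (t j) x (S.tmul (s a.1) (t a.2) x) = ∑ i, (𝒬).γ a i j x • t i x :=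
  (frame_sum_coeff ht hx _).symm

/-- The components of the torsion. -/
lemma torsion_frame {x : M} (hx : x ∈ O) (a b : Fin p × Fin q) :
    S.torsion nablaU nablaV x (s a.1 x ⊗ₜ t a.2 x) (s b.1 x ⊗ₜ t b.2 x) =
      ∑ d, (𝒬).T a b d x • (s d.1 x ⊗ₜ[ℂ] t d.2 x) := by
  have hsm : ∀ A, MDiffAt (T% (s A)) x := fun A =>
    (hs.contMDiffAt hO hx A).mdifferentiableAt (by simp)
  have htm : ∀ A, MDiffAt (T% (t A)) x := fun A =>
    (ht.contMDiffAt hO hx A).mdifferentiableAt (by simp)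
  have he : ∀ a : Fin p × Fin q, MDiffAt (T% (S.tmul (s a.1) (t a.2))) x := fun a =>
    S.mdifferentiableAt_tmul (hsm _) (htm _)
  have h1 : S.torsion nablaU nablaV x (s a.1 x ⊗ₜ t a.2 x) (s b.1 x ⊗ₜ t b.2 x) =
      S.iso x ((S.induced nablaU nablaV).torsion x (S.tmul (s a.1) (t a.2) x)
        (S.tmul (s b.1) (t b.2) x)) := rfl
  have h2 : VectorField.mlieBracket 𝓘(ℂ, E) (S.tmul (s a.1) (t a.2)) (S.tmul (s b.1) (t b.2)) x =
      ∑ d, (𝒬).c a b d x • S.tmul (s d.1) (t d.2) x :=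
    (frame_sum_coeff (S.isLocalFrameOn_tmul hO hs ht) hx _).symm
  rw [h1, CovariantDerivative.torsion_apply _ (he a) (he b), S.induced_tmul nablaU nablaV (hsm _) (htm _),
    S.induced_tmul nablaU nablaV (hsm _) (htm _), h2, S.nablaU_frame hU hV hO hs ht hx,
    S.nablaU_frame hU hV hO hs ht hx, S.nablaV_frame hU hV hO hs ht hx,
    S.nablaV_frame hU hV hO hs ht hx, map_sub, map_sub, LinearEquiv.apply_symm_apply,
    LinearEquiv.apply_symm_apply, map_sum]
  simp only [map_smul, S.iso_tmul, FrameData.T, sub_smul, add_smul, Finset.sum_sub_distrib,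
    Finset.sum_add_distrib, ite_smul, zero_smul, sum_tmul, tmul_sum, ← smul_tmul', tmul_smul]
  have key1 : ∀ (f : Fin p × Fin q → ℂ) (j : Fin q),
      ∑ d : Fin p × Fin q, (if d.2 = j then f d • (s d.1 x ⊗ₜ[ℂ] t d.2 x) else 0) =
        ∑ C, f (C, j) • (s C x ⊗ₜ[ℂ] t j x) := by
    intro f j
    rw [Fintype.sum_prod_type]
    simp
  have key2 : ∀ (f : Fin p × Fin q → ℂ) (B : Fin p),
      ∑ d : Fin p × Fin q, (if d.1 = B then f d • (s d.1 x ⊗ₜ[ℂ] t d.2 x) else 0) =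
        ∑ i, f (B, i) • (s B x ⊗ₜ[ℂ] t i x) := by
    intro f B
    rw [Fintype.sum_prod_type, Finset.sum_comm]
    simp
  rw [key1 (fun d => (𝒬).Γ a d.1 b.1 x), key2 (fun d => (𝒬).γ a d.2 b.2 x),
    key1 (fun d => (𝒬).Γ b d.1 a.1 x), key2 (fun d => (𝒬).γ b d.2 a.2 x)]
  abel

/-- The components of the curvature of `V`. -/
lemma curvOp_frame {x : M} (hx : x ∈ O) (a b : Fin p × Fin q) (j : Fin q) :
    curvOp nablaV (S.tmul (s a.1) (t a.2)) (S.tmul (s b.1) (t b.2)) (t j) x =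
      ∑ i, (𝒬).R a b i j x • t i x := by
  have htm : ∀ A, MDiffAt (T% (t A)) x := fun A =>
    (ht.contMDiffAt hO hx A).mdifferentiableAt (by simp)
  have hγ : ∀ a i j, MDiffAt ((𝒬).γ a i j) x := fun a i j =>
    (((𝒬).contMDiffOn_γ a i j).contMDiffAt (hO.mem_nhds hx)).mdifferentiableAt (by simp)
  have h2 : VectorField.mlieBracket 𝓘(ℂ, E) (S.tmul (s a.1) (t a.2)) (S.tmul (s b.1) (t b.2)) x =
      ∑ d, (𝒬).c a b d x • S.tmul (s d.1) (t d.2) x :=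
    (frame_sum_coeff (S.isLocalFrameOn_tmul hO hs ht) hx _).symm
  have h3 : ∀ a b : Fin p × Fin q, nablaV (fun y => nablaV (t j) y (S.tmul (s b.1) (t b.2) y)) x
      (S.tmul (s a.1) (t a.2) x) = ∑ i, (mvfderiv 𝓘(ℂ, E) ((𝒬).γ b i j) x (S.tmul (s a.1) (t a.2) x) +
        ∑ k, (𝒬).γ a i k x * (𝒬).γ b k j x) • t i x := by
    intro a b
    have h4 : CMDiffAt ω (T% (fun y => nablaV (t j) y (S.tmul (s b.1) (t b.2) y))) x :=
      contMDiffAt_covDeriv nablaV hV (ht.contMDiffAt hO hx j)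
        (S.holo_iso x _ _ (hs.contMDiffAt hO hx b.1) (ht.contMDiffAt hO hx b.2))
    rw [covDeriv_congr nablaV (w' := fun y => ∑ i, (𝒬).γ b i j y • t i y)
      (h4.mdifferentiableAt (by simp))
      (MDifferentiableAt.sum_section fun i _ => (hγ _ _ _).smul_section (htm _))
      (by filter_upwards [hO.mem_nhds hx] with y hy using S.nablaV_frame hU hV hO hs ht hy b j),
      covDeriv_sum_smul nablaV (fun i => hγ b i j) htm]
    simp only [S.nablaV_frame hU hV hO hs ht hx, Finset.sum_add_distrib, add_smul,
      Finset.smul_sum, smul_smul, Finset.sum_smul]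
    rw [add_comm, Finset.sum_comm]
    simp only [mul_comm]
  rw [curvOp, h3, h3, h2, map_sum]
  simp only [map_smul, S.nablaV_frame hU hV hO hs ht hx]
  rw [← Finset.sum_sub_distrib]
  simp only [Finset.smul_sum, smul_smul]
  rw [Finset.sum_comm, ← Finset.sum_sub_distrib]
  refine Finset.sum_congr rfl fun i _ => ?_
  rw [← Finset.sum_smul, ← sub_smul, ← sub_smul, FrameData.R, Finset.sum_sub_distrib]
  congr 1
  simp only [frameData]
  ring

end ParaconformalStructure

end

/-! ### Polarisation -/

section

section Polarisation

variable {V : Type*} [AddCommGroup V] [Module ℂ V] {ι : Type*} [Fintype ι] (b : Basis ι ℂ V)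

lemma repr_parallel {v w : V} {c : ℂ} (h : w = c • v) (i j : ι) :
    b.repr w i * b.repr v j = b.repr w j * b.repr v i := by
  rw [h]; simp; ring

lemma sum_repr_mul_repr (L : V →ₗ[ℂ] V) (v : V) (i : ι) :
    ∑ j, b.repr v j * b.repr (L (b j)) i = b.repr (L v) i := by
  have : L v = ∑ j, b.repr v j • L (b j) := by
    conv_lhs => rw [← b.sum_repr v, map_sum]
    simp
  rw [this]; simp

include b in
/-- A trace-free bilinear map `B` with `B v v` proportional to `v` vanishes on the diagonal. The
proportionality `(B v v)ⁱ vʲ = (B v v)ʲ vⁱ` is polarised once and then traced over `w` and `j`. -/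
lemma bilin_diag_eq_zero (B : V →ₗ[ℂ] V →ₗ[ℂ] V) (hB : ∀ v, ∃ c : ℂ, B v v = c • v)
    (h1 : ∀ v, ∑ i, b.repr (B (b i) v) i = 0) (h2 : ∀ v, ∑ i, b.repr (B v (b i)) i = 0) (v : V) :
    B v v = 0 := by
  classical
  -- the linear term in `s` of the proportionality at `v + s • w`
  have key : ∀ (w : V) (i j : ι),
      (b.repr (B w v) i + b.repr (B v w) i) * b.repr v j + b.repr (B v v) i * b.repr w j =
      (b.repr (B w v) j + b.repr (B v w) j) * b.repr v i + b.repr (B v v) j * b.repr w i := by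
    intro w i j
    have hs : ∀ s : ℂ, _ := fun s =>
      repr_parallel b (hB (v + s • w)).choose_spec i j
    have e1 := hs 1
    have e2 := hs (-1)
    have e3 := hs 2
    have e4 := hs (-2)
    simp only [map_add, map_smul, LinearMap.add_apply, LinearMap.smul_apply, Finsupp.add_apply,
      Finsupp.smul_apply, smul_eq_mul] at e1 e2 e3 e4
    -- the four values determine the coefficients of the polynomial in `s`
    linear_combination (2 / 3 : ℂ) * (e1 - e2) - (1 / 12 : ℂ) * (e3 - e4)
  have hcard : ∀ i : ι, ((Fintype.card ι : ℂ) + 1) * b.repr (B v v) i = 0 := by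
    intro i
    have h := Finset.sum_congr rfl fun (j : ι) (_ : j ∈ Finset.univ) => key (b j) i j
    have e1 : ∑ j, (b.repr (B (b j) v) i + b.repr (B v (b j)) i) * b.repr v j =
        2 * b.repr (B v v) i := by
      have h3 := sum_repr_mul_repr b (B.flip v) v i
      have h4 := sum_repr_mul_repr b (B v) v i
      rw [LinearMap.flip_apply] at h3
      rw [two_mul]
      nth_rewrite 1 [← h3]
      rw [← h4, ← Finset.sum_add_distrib]
      exact Finset.sum_congr rfl fun j _ => by rw [LinearMap.flip_apply]; ring
    simp only [Finset.sum_add_distrib, e1] at h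
    simp only [add_mul, Finset.sum_add_distrib, ← Finset.sum_mul, h1, h2, Basis.repr_self,
      Finsupp.single_apply] at h
    simp at h
    linear_combination h
  apply b.repr.injective
  ext i
  have hne : ((Fintype.card ι : ℂ) + 1) ≠ 0 := Nat.cast_add_one_ne_zero _
  simpa [hne] using hcard i

include b in
/-- If a trilinear map `K` satisfies `K v v v = c • v` for all `v`, then the factor `c` is determined
by the traces of `K`, by the argument of `bilin_diag_eq_zero`. -/
lemma trilin_diag_eq (K : V →ₗ[ℂ] V →ₗ[ℂ] V →ₗ[ℂ] V) (hK : ∀ v, ∃ c : ℂ, K v v v = c • v) (v : V) :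
    ((Fintype.card ι : ℂ) + 2) • K v v v = (∑ i, b.repr (K (b i) v v) i +
      ∑ i, b.repr (K v (b i) v) i + ∑ i, b.repr (K v v (b i)) i) • v := by
  classical
  -- the linear term in `s` of the proportionality at `v + s • w`
  have key : ∀ (w : V) (i j : ι),
      (b.repr (K w v v) i + b.repr (K v w v) i + b.repr (K v v w) i) * b.repr v j +
        b.repr (K v v v) i * b.repr w j =
      (b.repr (K w v v) j + b.repr (K v w v) j + b.repr (K v v w) j) * b.repr v i +
        b.repr (K v v v) j * b.repr w i := by
    intro w i j
    have hs : ∀ s : ℂ, _ := fun s =>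
      repr_parallel b (hK (v + s • w)).choose_spec i j
    have e1 := hs 1
    have e2 := hs (-1)
    have e3 := hs 2
    have e4 := hs (-2)
    simp only [map_add, map_smul, LinearMap.add_apply, LinearMap.smul_apply, Finsupp.add_apply,
      Finsupp.smul_apply, smul_eq_mul] at e1 e2 e3 e4
    linear_combination (2 / 3 : ℂ) * (e1 - e2) - (1 / 12 : ℂ) * (e3 - e4)
  apply b.repr.injective
  ext i
  have h := Finset.sum_congr rfl fun (j : ι) (_ : j ∈ Finset.univ) => key (b j) i j
  have e1 : ∑ j, (b.repr (K (b j) v v) i + b.repr (K v (b j) v) i + b.repr (K v v (b j)) i) *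
      b.repr v j = 3 * b.repr (K v v v) i := by
    have h3 := sum_repr_mul_repr b ((K.flip v).flip v) v i
    have h4 := sum_repr_mul_repr b ((K v).flip v) v i
    have h5 := sum_repr_mul_repr b (K v v) v i
    simp only [LinearMap.flip_apply] at h3 h4
    rw [show (3 : ℂ) * b.repr (K v v v) i =
      b.repr (K v v v) i + b.repr (K v v v) i + b.repr (K v v v) i by ring]
    nth_rewrite 1 [← h3]
    nth_rewrite 1 [← h4]
    rw [← h5, ← Finset.sum_add_distrib, ← Finset.sum_add_distrib]
    exact Finset.sum_congr rfl fun j _ => by ring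
  simp only [Finset.sum_add_distrib, e1] at h
  simp only [add_mul, Finset.sum_add_distrib, ← Finset.sum_mul, Basis.repr_self,
    Finsupp.single_apply] at h
  simp at h
  simp only [map_smul, Finsupp.smul_apply, smul_eq_mul]
  linear_combination h

/-- A symmetric additive function of three variables which vanishes on the diagonal is zero. -/
lemma trilin_eq_zero_of_diag (f : V → V → V → V)
    (hadd : ∀ a b c d, f (a + b) c d = f a c d + f b c d)
    (h12 : ∀ a b c, f a b c = f b a c) (h23 : ∀ a b c, f a b c = f a c b)
    (hdiag : ∀ v, f v v v = 0) (u v w : V) : f u v w = 0 := by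
  have hadd2 : ∀ a b c d, f c (a + b) d = f c a d + f c b d := by
    intro a b c d; rw [h12, hadd, h12 a, h12 b]
  have hadd3 : ∀ a b c d, f c d (a + b) = f c d a + f c d b := by
    intro a b c d; rw [h23, hadd2, h23 c a, h23 c b]
  have e1 := hdiag (u + v + w)
  have e2 := hdiag (u + v)
  have e3 := hdiag (v + w)
  have e4 := hdiag (u + w)
  simp only [hadd, hadd2, hadd3, hdiag, zero_add, add_zero] at e1 e2 e3 e4
  have p1 : f u w v = f u v w := h23 u w v
  have p2 : f v u w = f u v w := h12 v u w
  have p3 : f v w u = f u v w := by rw [h23, p2]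
  have p4 : f w u v = f u v w := by rw [h12, p1]
  have p5 : f w v u = f u v w := by rw [h23, p4]
  rw [p1, p2, p3, p4, p5] at e1
  have h6 : (6 : ℂ) • f u v w = 0 := by
    linear_combination (norm := module) e1 - e2 - e3 - e4
  exact (smul_eq_zero.1 h6).resolve_left (by norm_num)

end Polarisation

end

/-! ### The torsion on the subspaces `U ⊗ v` -/

section

section TensorAlgebra

variable {U V : Type*} [AddCommGroup U] [Module ℂ U] [AddCommGroup V] [Module ℂ V]

/-- Contraction of `U ⊗ V` with a linear form on `V`. -/
def contractRight (φ : Dual ℂ V) : U ⊗[ℂ] V →ₗ[ℂ] U :=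
  (TensorProduct.rid ℂ U).toLinearMap ∘ₗ LinearMap.lTensor U φ

/-- Contraction of `U ⊗ V` with a linear form on `U`. -/
def contractLeft (ψ : Dual ℂ U) : U ⊗[ℂ] V →ₗ[ℂ] V :=
  (TensorProduct.lid ℂ V).toLinearMap ∘ₗ LinearMap.rTensor V ψ

@[simp] lemma contractRight_tmul (φ : Dual ℂ V) (u : U) (v : V) :
    contractRight φ (u ⊗ₜ[ℂ] v) = φ v • u := by
  simp [contractRight]

@[simp] lemma contractLeft_tmul (ψ : Dual ℂ U) (u : U) (v : V) :
    contractLeft ψ (u ⊗ₜ[ℂ] v) = ψ u • v := by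
  simp [contractLeft]

variable {ι κ : Type*} [Fintype ι] [Fintype κ] (b : Basis ι ℂ U) (b' : Basis κ ℂ V)

include b' in
lemma eq_zero_of_contractRight {τ : U ⊗[ℂ] V} (h : ∀ φ, contractRight φ τ = 0) : τ = 0 := by
  have key : ∀ τ : U ⊗[ℂ] V, ∑ j, contractRight (b'.coord j) τ ⊗ₜ[ℂ] b' j = τ := by
    intro τ
    induction τ using TensorProduct.induction_on with
    | zero => simp
    | tmul u v =>
      simp only [contractRight_tmul, Basis.coord_apply, smul_tmul, ← tmul_sum, b'.sum_repr]
    | add x y hx hy =>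
      simp only [map_add, add_tmul, Finset.sum_add_distrib, hx, hy]
  rw [← key τ]
  simp [h]

include b in
lemma eq_zero_of_contractLeft {τ : U ⊗[ℂ] V} (h : ∀ ψ, contractLeft ψ τ = 0) : τ = 0 := by
  have key : ∀ τ : U ⊗[ℂ] V, ∑ j, b j ⊗ₜ[ℂ] contractLeft (b.coord j) τ = τ := by
    intro τ
    induction τ using TensorProduct.induction_on with
    | zero => simp
    | tmul u v =>
      simp only [contractLeft_tmul, Basis.coord_apply, ← smul_tmul, ← sum_tmul, b.sum_repr]
    | add x y hx hy =>
      simp only [map_add, tmul_add, Finset.sum_add_distrib, hx, hy]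
  rw [← key τ]
  simp [h]

include b in
lemma trace_eq_sum_repr (f : U →ₗ[ℂ] U) : LinearMap.trace ℂ U f = ∑ i, b.repr (f (b i)) i := by
  classical
  rw [LinearMap.trace_eq_matrix_trace ℂ b, Matrix.trace]
  simp [LinearMap.toMatrix_apply]

/-- On a plane, a skew bilinear map with values in the plane is determined by its trace. -/
lemma skew_eq_zero_of_trace (b : Basis (Fin 2) ℂ U) (B : U →ₗ[ℂ] U →ₗ[ℂ] U)
    (hskew : ∀ u v, B u v = - B v u) (htr : ∀ v, LinearMap.trace ℂ U (B.flip v) = 0) : B = 0 := by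
  have hd : ∀ u, B u u = 0 := by
    intro u
    have h := hskew u u
    have h2 : (2 : ℂ) • B u u = 0 := by rw [two_smul]; nth_rewrite 1 [h]; simp
    exact (smul_eq_zero.1 h2).resolve_left (by norm_num)
  have h0 := htr (b 0)
  have h1 := htr (b 1)
  rw [trace_eq_sum_repr b] at h0 h1
  simp only [Fin.sum_univ_two, LinearMap.flip_apply, hd, map_zero, Finsupp.zero_apply, zero_add,
    add_zero] at h0 h1
  have h01 : B (b 0) (b 1) = 0 := by
    apply b.repr.injective
    ext i
    fin_cases i
    · simpa using h1
    · rw [hskew, map_neg]; simpa using h0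
  refine b.ext fun i => b.ext fun j => ?_
  fin_cases i <;> fin_cases j
  · exact hd _
  · exact h01
  · rw [hskew]; simp [h01]
  · exact hd _

end TensorAlgebra

open ParaconformalStructure

variable {E : Type*} [NormedAddCommGroup E] [NormedSpace ℂ E] [FiniteDimensional ℂ E]
  [CompleteSpace E]
  {M : Type*} [TopologicalSpace M] [ChartedSpace E M] [IsManifold 𝓘(ℂ, E) ω M]
  {F₁ : Type*} [NormedAddCommGroup F₁] [NormedSpace ℂ F₁] [FiniteDimensional ℂ F₁]
  {U : M → Type*} [TopologicalSpace (TotalSpace F₁ U)]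
  [∀ x, AddCommGroup (U x)] [∀ x, Module ℂ (U x)] [∀ x, TopologicalSpace (U x)]
  [∀ x, IsTopologicalAddGroup (U x)] [∀ x, ContinuousSMul ℂ (U x)]
  [FiberBundle F₁ U] [VectorBundle ℂ F₁ U] [ContMDiffVectorBundle ω F₁ U 𝓘(ℂ, E)]
  {F₂ : Type*} [NormedAddCommGroup F₂] [NormedSpace ℂ F₂] [FiniteDimensional ℂ F₂]
  {V : M → Type*} [TopologicalSpace (TotalSpace F₂ V)]
  [∀ x, AddCommGroup (V x)] [∀ x, Module ℂ (V x)] [∀ x, TopologicalSpace (V x)]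
  [∀ x, IsTopologicalAddGroup (V x)] [∀ x, ContinuousSMul ℂ (V x)]
  [FiberBundle F₂ V] [VectorBundle ℂ F₂ V] [ContMDiffVectorBundle ω F₂ V 𝓘(ℂ, E)]
  {p q : ℕ} (S : ParaconformalStructure E F₁ U F₂ V p q)
  (nablaU : CovariantDerivative 𝓘(ℂ, E) F₁ U) (nablaV : CovariantDerivative 𝓘(ℂ, E) F₂ V)

/-- The fibre of a vector bundle has a basis indexed by `Fin r`, `r` the rank. -/
lemma exists_fibreBasis {F : Type*} [NormedAddCommGroup F] [NormedSpace ℂ F] [FiniteDimensional ℂ F]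
    {W : M → Type*} [TopologicalSpace (TotalSpace F W)]
    [∀ x, AddCommGroup (W x)] [∀ x, Module ℂ (W x)] [∀ x, TopologicalSpace (W x)]
    [FiberBundle F W] [VectorBundle ℂ F W] {r : ℕ} (hr : finrank ℂ F = r) (x : M) :
    Nonempty (Basis (Fin r) ℂ (W x)) := by
  subst hr
  exact ⟨(trivializationAt F W x).basisAt (finBasis ℂ F)
    (FiberBundle.mem_baseSet_trivializationAt F W x)⟩

/-- Near every point there are frames indexed by `Fin r`, `r` the rank. -/
lemma exists_localFrame {F : Type*} [NormedAddCommGroup F] [NormedSpace ℂ F]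
    [FiniteDimensional ℂ F] {W : M → Type*} [TopologicalSpace (TotalSpace F W)]
    [∀ x, AddCommGroup (W x)] [∀ x, Module ℂ (W x)] [∀ x, TopologicalSpace (W x)]
    [FiberBundle F W] [VectorBundle ℂ F W] [ContMDiffVectorBundle ω F W 𝓘(ℂ, E)]
    {r : ℕ} (hr : finrank ℂ F = r) (x : M) :
    ∃ (O : Set M) (s : Fin r → Π y : M, W y), IsOpen O ∧ x ∈ O ∧
      IsLocalFrameOn 𝓘(ℂ, E) F ω s O := by
  subst hr
  exact ⟨_, _, (trivializationAt F W x).open_baseSet,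
    FiberBundle.mem_baseSet_trivializationAt F W x,
    (trivializationAt F W x).isLocalFrameOn_localFrame_baseSet (I := 𝓘(ℂ, E)) (n := ω)
      (finBasis ℂ F)⟩

namespace ParaconformalStructure

/-- The torsion vanishes on the subspaces `U ⊗ v`. -/
def TorsionFlatAt (x : M) : Prop :=
  ∀ (u₁ u₂ : U x) (v : V x), S.torsion nablaU nablaV x (u₁ ⊗ₜ v) (u₂ ⊗ₜ v) = 0

/-- The curvature of `V` along `U ⊗ v`, applied to `v`, is a multiple of `v`. -/
def CurvatureParallelAt (x : M) : Prop :=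
  ∀ (u₁ u₂ : U x) (v : V x), ∃ c : ℂ,
    curvature nablaV x ((S.iso x).symm (u₁ ⊗ₜ v)) ((S.iso x).symm (u₂ ⊗ₜ v)) v = c • v

lemma torsion_skew (x : M) (a b : U x ⊗[ℂ] V x) :
    S.torsion nablaU nablaV x a b = - S.torsion nablaU nablaV x b a := by
  have h := CovariantDerivative.torsion_antisymm (S.induced nablaU nablaV) ((S.iso x).symm a)
    ((S.iso x).symm b)
  exact (congrArg (S.iso x) h).trans (map_neg _ _)

/-- The component `T⁺` is the polarisation of the torsion on `U ⊗ v`. -/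
lemma torsionPlus_eq_zero_iff (x : M) :
    (∀ (u₁ u₂ : U x) (v₁ v₂ : V x), S.torsionPlus nablaU nablaV x u₁ u₂ v₁ v₂ = 0) ↔
      S.TorsionFlatAt nablaU nablaV x := by
  constructor
  · intro h u₁ u₂ v
    have h1 := h u₁ u₂ v v
    rw [torsionPlus, ← two_smul ℂ, smul_smul] at h1
    simpa using h1
  · intro h u₁ u₂ v₁ v₂
    have h1 := h u₁ u₂ (v₁ + v₂)
    simp only [tmul_add, map_add, LinearMap.add_apply, h u₁ u₂ v₁, h u₁ u₂ v₂, zero_add,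
      add_zero] at h1
    rw [torsionPlus, add_comm (S.torsion nablaU nablaV x (u₁ ⊗ₜ v₁) (u₂ ⊗ₜ v₂)), h1, smul_zero]

variable {S nablaU nablaV} (hT : S.TorsionTraceFree nablaU nablaV)
include hT

/-- For `p = 2` the trace-free condition implies that the torsion vanishes on `U ⊗ v`: contracted
with a linear form on `V` it is a skew map on a plane, with values in the plane. -/
lemma TorsionTraceFree.torsionFlatAt_of_two (hp : p = 2) (x : M) :
    S.TorsionFlatAt nablaU nablaV x := by
  intro u₁ u₂ v
  obtain ⟨b⟩ := exists_fibreBasis (W := U) (S.rank_left.trans hp) x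
  obtain ⟨b'⟩ := exists_fibreBasis (W := V) S.rank_right x
  refine eq_zero_of_contractRight b' fun φ => ?_
  let m : U x →ₗ[ℂ] U x ⊗[ℂ] V x := (TensorProduct.mk ℂ (U x) (V x)).flip v
  let B : U x →ₗ[ℂ] U x →ₗ[ℂ] U x :=
    ((S.torsion nablaU nablaV x).compl₁₂ m m).compr₂ (contractRight φ)
  have hB : B = 0 := by
    refine skew_eq_zero_of_trace b B (fun u w => ?_) fun w => ?_
    · simp only [B, LinearMap.compr₂_apply, LinearMap.compl₁₂_apply]
      rw [S.torsion_skew, map_neg]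
    · exact (hT x (m w)).1 v φ
  exact congrArg (fun B : U x →ₗ[ℂ] U x →ₗ[ℂ] U x => B u₁ u₂) hB

/-- If the torsion maps `U ⊗ v` to `U ⊗ v` for all `v`, it vanishes there. -/
lemma TorsionTraceFree.torsionFlatAt (x : M)
    (h : ∀ (u₁ u₂ : U x) (v : V x), ∃ u : U x,
      S.torsion nablaU nablaV x (u₁ ⊗ₜ v) (u₂ ⊗ₜ v) = u ⊗ₜ v) :
    S.TorsionFlatAt nablaU nablaV x := by
  intro u₁ u₂ v
  obtain ⟨b⟩ := exists_fibreBasis (W := U) S.rank_left x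
  obtain ⟨b'⟩ := exists_fibreBasis (W := V) S.rank_right x
  refine eq_zero_of_contractLeft b fun ψ => ?_
  let B : V x →ₗ[ℂ] V x →ₗ[ℂ] V x :=
    ((S.torsion nablaU nablaV x).compl₁₂ (TensorProduct.mk ℂ (U x) (V x) u₁)
      (TensorProduct.mk ℂ (U x) (V x) u₂)).compr₂ (contractLeft ψ)
  refine bilin_diag_eq_zero b' B (fun v => ?_) (fun v => ?_) (fun v => ?_) v
  · obtain ⟨u, hu⟩ := h u₁ u₂ v
    exact ⟨ψ u, (congrArg (contractLeft ψ) hu).trans (contractLeft_tmul _ _ _)⟩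
  · rw [← (hT x (u₂ ⊗ₜ v)).2 u₁ ψ, trace_eq_sum_repr b']
    rfl
  · have h1 := (hT x (u₁ ⊗ₜ v)).2 u₂ ψ
    rw [trace_eq_sum_repr b'] at h1
    rw [← neg_eq_zero, ← Finset.sum_neg_distrib, ← h1]
    refine Finset.sum_congr rfl fun i _ => ?_
    have h2 := S.torsion_skew nablaU nablaV x (u₁ ⊗ₜ v) (u₂ ⊗ₜ b' i)
    have h3 : B v (b' i) = - contractLeft ψ (S.torsion nablaU nablaV x (u₂ ⊗ₜ b' i) (u₁ ⊗ₜ v)) :=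
      (congrArg (contractLeft ψ) h2).trans (map_neg _ _)
    rw [h3, map_neg, Finsupp.neg_apply, neg_neg]
    rfl

end ParaconformalStructure

end

/-! ### Right-flatness on the subspaces `U ⊗ v` -/

section

open ParaconformalStructure

/-- A sum over the six permutations of three letters. -/
lemma sum_perm_three {G : Type*} [AddCommMonoid G] (f : Equiv.Perm (Fin 3) → G) :
    ∑ σ, f σ = f 1 + f (Equiv.swap 0 1) + f (Equiv.swap 0 2) + f (Equiv.swap 1 2) +
      f (Equiv.swap 0 1 * Equiv.swap 1 2) + f (Equiv.swap 1 2 * Equiv.swap 0 1) := by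
  have h : (Finset.univ : Finset (Equiv.Perm (Fin 3))) = {1, Equiv.swap 0 1, Equiv.swap 0 2,
      Equiv.swap 1 2, Equiv.swap 0 1 * Equiv.swap 1 2, Equiv.swap 1 2 * Equiv.swap 0 1} := by
    decide
  rw [h, Finset.sum_insert (by decide), Finset.sum_insert (by decide), Finset.sum_insert (by decide),
    Finset.sum_insert (by decide), Finset.sum_insert (by decide), Finset.sum_singleton]
  simp only [add_assoc]

section Curvature

variable {E : Type*} [NormedAddCommGroup E] [NormedSpace ℂ E] [FiniteDimensional ℂ E]
  [CompleteSpace E]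
  {M : Type*} [TopologicalSpace M] [ChartedSpace E M] [IsManifold 𝓘(ℂ, E) ω M]
  {F : Type*} [NormedAddCommGroup F] [NormedSpace ℂ F] [FiniteDimensional ℂ F]
  {V : M → Type*} [TopologicalSpace (TotalSpace F V)]
  [∀ x, AddCommGroup (V x)] [∀ x, Module ℂ (V x)] [∀ x, TopologicalSpace (V x)]
  [∀ x, IsTopologicalAddGroup (V x)] [∀ x, ContinuousSMul ℂ (V x)]
  [FiberBundle F V] [VectorBundle ℂ F V] [ContMDiffVectorBundle ω F V 𝓘(ℂ, E)]
  {nabla : CovariantDerivative 𝓘(ℂ, E) F V}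

/-- The curvature of a holomorphic connection is a tensor. -/
lemma exists_curvature_eq (h : IsHolomorphicConnection nabla) (x : M) :
    ∃ L : TangentSpace 𝓘(ℂ, E) x →ₗ[ℂ] TangentSpace 𝓘(ℂ, E) x →ₗ[ℂ] V x →ₗ[ℂ] V x,
      ∀ X Y w, curvature nabla x X Y w = L X Y w := by
  obtain ⟨O₁, e, hO₁, hx₁, he⟩ := exists_localFrame (E := E) (F := E)
    (W := (TangentSpace 𝓘(ℂ, E) : M → Type _)) rfl x
  obtain ⟨O₂, t, hO₂, hx₂, ht⟩ := exists_localFrame (E := E) (F := F) (W := V) rfl x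
  have he' := he.mono (inter_subset_left (t := O₂))
  have ht' := ht.mono (inter_subset_right (s := O₁))
  refine ⟨∑ a, ∑ b, ∑ j, (he'.coeff a x).smulRight ((he'.coeff b x).smulRight
    ((ht'.coeff j x).smulRight (curvOp nabla (e a) (e b) (t j) x))), fun X Y w => ?_⟩
  rw [curvature_eq_sum h (hO₁.inter hO₂) he' ht' ⟨hx₁, hx₂⟩]
  simp only [LinearMap.sum_apply, LinearMap.smulRight_apply, LinearMap.smul_apply, Finset.smul_sum]

end Curvature

variable {E : Type*} [NormedAddCommGroup E] [NormedSpace ℂ E] [FiniteDimensional ℂ E]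
  [CompleteSpace E]
  {M : Type*} [TopologicalSpace M] [ChartedSpace E M] [IsManifold 𝓘(ℂ, E) ω M]
  {F₁ : Type*} [NormedAddCommGroup F₁] [NormedSpace ℂ F₁] [FiniteDimensional ℂ F₁]
  {U : M → Type*} [TopologicalSpace (TotalSpace F₁ U)]
  [∀ x, AddCommGroup (U x)] [∀ x, Module ℂ (U x)] [∀ x, TopologicalSpace (U x)]
  [∀ x, IsTopologicalAddGroup (U x)] [∀ x, ContinuousSMul ℂ (U x)]
  [FiberBundle F₁ U] [VectorBundle ℂ F₁ U] [ContMDiffVectorBundle ω F₁ U 𝓘(ℂ, E)]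
  {F₂ : Type*} [NormedAddCommGroup F₂] [NormedSpace ℂ F₂] [FiniteDimensional ℂ F₂]
  {V : M → Type*} [TopologicalSpace (TotalSpace F₂ V)]
  [∀ x, AddCommGroup (V x)] [∀ x, Module ℂ (V x)] [∀ x, TopologicalSpace (V x)]
  [∀ x, IsTopologicalAddGroup (V x)] [∀ x, ContinuousSMul ℂ (V x)]
  [FiberBundle F₂ V] [VectorBundle ℂ F₂ V] [ContMDiffVectorBundle ω F₂ V 𝓘(ℂ, E)]
  {p q : ℕ} (S : ParaconformalStructure E F₁ U F₂ V p q)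
  (nablaU : CovariantDerivative 𝓘(ℂ, E) F₁ U) (nablaV : CovariantDerivative 𝓘(ℂ, E) F₂ V)

namespace ParaconformalStructure

variable {nablaV}
/-- The curvature evaluated on `u₁ ⊗ a`, `u₂ ⊗ b` and `c` is trilinear in `a`, `b`, `c`. -/
lemma exists_curvature_tmul_eq (hV : IsHolomorphicConnection nablaV) (x : M) (u₁ u₂ : U x) :
    ∃ K : V x →ₗ[ℂ] V x →ₗ[ℂ] V x →ₗ[ℂ] V x, ∀ a b c,
      curvature nablaV x ((S.iso x).symm (u₁ ⊗ₜ a)) ((S.iso x).symm (u₂ ⊗ₜ b)) c = K a b c := by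
  obtain ⟨L, hL⟩ := exists_curvature_eq hV x
  refine ⟨L.compl₁₂ ((S.iso x).symm.toLinearMap ∘ₗ TensorProduct.mk ℂ (U x) (V x) u₁)
    ((S.iso x).symm.toLinearMap ∘ₗ TensorProduct.mk ℂ (U x) (V x) u₂), fun a b c => ?_⟩
  rw [hL]; rfl

/-- The tensor `W⁺` is symmetric, hence determined by its values on the diagonal. For three lower
arguments `v` it is the curvature along `U ⊗ v`, applied to `v`, minus a multiple of `v`; if this
curvature itself is a multiple of `v`, traces show that it is the multiple which is subtracted. -/
lemma weylPlus_eq_zero_iff (hV : IsHolomorphicConnection nablaV) (x : M) :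
    (∀ (u₁ u₂ : U x) (v₁ v₂ v₃ : V x), S.weylPlus nablaV x u₁ u₂ v₁ v₂ v₃ = 0) ↔
      S.CurvatureParallelAt nablaV x := by
  have hq : ((q : ℂ) + 2) ≠ 0 := by exact_mod_cast Nat.succ_ne_zero (q + 1)
  let b := (trivializationAt F₂ V x).basisAt (finBasis ℂ F₂)
    (FiberBundle.mem_baseSet_trivializationAt F₂ V x)
  have hb : (Fintype.card (Fin (finrank ℂ F₂)) : ℂ) = q := by rw [Fintype.card_fin, S.rank_right]
  have hsym : ∀ (u₁ u₂ : U x) (K : V x →ₗ[ℂ] V x →ₗ[ℂ] V x →ₗ[ℂ] V x) (_ : ∀ a b c,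
      curvature nablaV x ((S.iso x).symm (u₁ ⊗ₜ a)) ((S.iso x).symm (u₂ ⊗ₜ b)) c = K a b c)
      (v₁ v₂ v₃ : V x), S.curvatureSym nablaV x u₁ u₂ ![v₁, v₂, v₃] = (1 / 6 : ℂ) •
        (K v₁ v₂ v₃ + K v₂ v₁ v₃ + K v₃ v₂ v₁ + K v₁ v₃ v₂ + K v₂ v₃ v₁ + K v₃ v₁ v₂) := by
    intro u₁ u₂ K hK v₁ v₂ v₃
    rw [curvatureSym, sum_perm_three]
    simp only [hK]
    rfl
  have hdiag : ∀ (u₁ u₂ : U x) (K : V x →ₗ[ℂ] V x →ₗ[ℂ] V x →ₗ[ℂ] V x) (_ : ∀ a b c,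
      curvature nablaV x ((S.iso x).symm (u₁ ⊗ₜ a)) ((S.iso x).symm (u₂ ⊗ₜ b)) c = K a b c)
      (v : V x), S.weylPlus nablaV x u₁ u₂ v v v = K v v v - (1 / (q + 2) : ℂ) •
        (∑ i, b.repr (K (b i) v v) i + ∑ i, b.repr (K v (b i) v) i +
          ∑ i, b.repr (K v v (b i)) i) • v := by
    intro u₁ u₂ K hK v
    have htr : S.curvatureSymTrace nablaV x u₁ u₂ v v = (1 / 3 : ℂ) *
        (∑ i, b.repr (K (b i) v v) i + ∑ i, b.repr (K v (b i) v) i +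
          ∑ i, b.repr (K v v (b i)) i) := by
      change ∑ i, b.repr (S.curvatureSym nablaV x u₁ u₂ ![b i, v, v]) i = _
      rw [← Finset.sum_add_distrib, ← Finset.sum_add_distrib, Finset.mul_sum]
      refine Finset.sum_congr rfl fun i _ => ?_
      rw [hsym u₁ u₂ K hK]
      simp only [map_smul, map_add, Finsupp.smul_apply, Finsupp.add_apply, smul_eq_mul]
      ring
    rw [weylPlus, htr, hsym u₁ u₂ K hK]
    module
  constructor
  · intro h u₁ u₂ v
    obtain ⟨K, hK⟩ := S.exists_curvature_tmul_eq hV x u₁ u₂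
    have h1 := h u₁ u₂ v v v
    rw [hdiag u₁ u₂ K hK, sub_eq_zero, smul_smul] at h1
    exact ⟨_, (hK v v v).trans h1⟩
  · intro h u₁ u₂
    obtain ⟨K, hK⟩ := S.exists_curvature_tmul_eq hV x u₁ u₂
    have hs := hsym u₁ u₂ K hK
    have ht : ∀ v w, S.curvatureSymTrace nablaV x u₁ u₂ v w =
        ∑ i, b.repr (S.curvatureSym nablaV x u₁ u₂ ![b i, v, w]) i := fun v w => rfl
    have ht_comm : ∀ v w, S.curvatureSymTrace nablaV x u₁ u₂ v w =
        S.curvatureSymTrace nablaV x u₁ u₂ w v := by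
      intro v w
      rw [ht, ht]
      refine Finset.sum_congr rfl fun i _ => ?_
      rw [hs, hs]
      congr 3
      abel
    have ht_add : ∀ v v' w, S.curvatureSymTrace nablaV x u₁ u₂ (v + v') w =
        S.curvatureSymTrace nablaV x u₁ u₂ v w + S.curvatureSymTrace nablaV x u₁ u₂ v' w := by
      intro v v' w
      rw [ht, ht, ht, ← Finset.sum_add_distrib]
      refine Finset.sum_congr rfl fun i _ => ?_
      rw [hs, hs, hs]
      simp only [map_smul, map_add, LinearMap.add_apply, Finsupp.smul_apply, Finsupp.add_apply,
        smul_eq_mul]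
      ring
    refine trilin_eq_zero_of_diag (fun v₁ v₂ v₃ => S.weylPlus nablaV x u₁ u₂ v₁ v₂ v₃)
      (fun v v' w z => ?_) (fun v w z => ?_) (fun v w z => ?_) fun v => ?_
    · simp only [weylPlus, ht_add, hs, map_add, LinearMap.add_apply]
      module
    · simp only [weylPlus, hs, ht_comm w v]
      module
    · simp only [weylPlus, hs, ht_comm z w]
      module
    · have h1 := trilin_diag_eq b K (fun v => by
        obtain ⟨c, hc⟩ := h u₁ u₂ v
        exact ⟨c, (hK v v v).symm.trans hc⟩) v
      rw [hb] at h1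
      change S.weylPlus nablaV x u₁ u₂ v v v = 0
      rw [hdiag u₁ u₂ K hK, ← h1, smul_smul, one_div, inv_mul_cancel₀ hq, one_smul, sub_self]

variable (nablaV) in
/-- Right-flatness, in terms of the restrictions of torsion and curvature to `U ⊗ v`. -/
lemma isRightFlatOn_iff (hV : IsHolomorphicConnection nablaV) (O : Set M) :
    S.IsRightFlatOn nablaU nablaV O ↔ ∀ x ∈ O, (2 < p → S.TorsionFlatAt nablaU nablaV x) ∧
      (p = 2 → S.CurvatureParallelAt nablaV x) := by
  refine forall₂_congr fun x _ => ?_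
  rw [S.torsionPlus_eq_zero_iff, S.weylPlus_eq_zero_iff hV]

end ParaconformalStructure

end

/-! ### Components along the subspaces `U ⊗ v` -/

section

open ParaconformalStructure

variable {E : Type*} [NormedAddCommGroup E] [NormedSpace ℂ E] [FiniteDimensional ℂ E]
  [CompleteSpace E]
  {M : Type*} [TopologicalSpace M] [ChartedSpace E M] [IsManifold 𝓘(ℂ, E) ω M]
  {F₁ : Type*} [NormedAddCommGroup F₁] [NormedSpace ℂ F₁] [FiniteDimensional ℂ F₁]
  {U : M → Type*} [TopologicalSpace (TotalSpace F₁ U)]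
  [∀ x, AddCommGroup (U x)] [∀ x, Module ℂ (U x)] [∀ x, TopologicalSpace (U x)]
  [∀ x, IsTopologicalAddGroup (U x)] [∀ x, ContinuousSMul ℂ (U x)]
  [FiberBundle F₁ U] [VectorBundle ℂ F₁ U] [ContMDiffVectorBundle ω F₁ U 𝓘(ℂ, E)]
  {F₂ : Type*} [NormedAddCommGroup F₂] [NormedSpace ℂ F₂] [FiniteDimensional ℂ F₂]
  {V : M → Type*} [TopologicalSpace (TotalSpace F₂ V)]
  [∀ x, AddCommGroup (V x)] [∀ x, Module ℂ (V x)] [∀ x, TopologicalSpace (V x)]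
  [∀ x, IsTopologicalAddGroup (V x)] [∀ x, ContinuousSMul ℂ (V x)]
  [FiberBundle F₂ V] [VectorBundle ℂ F₂ V] [ContMDiffVectorBundle ω F₂ V 𝓘(ℂ, E)]
  {p q : ℕ} (S : ParaconformalStructure E F₁ U F₂ V p q)
  {nablaU : CovariantDerivative 𝓘(ℂ, E) F₁ U} {nablaV : CovariantDerivative 𝓘(ℂ, E) F₂ V}

namespace ParaconformalStructure

variable (nablaV) in
/-- The curvature of `V` along `U ⊗ v`, applied to `v`, vanishes. -/
def CurvatureFlatAt (x : M) : Prop :=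
  ∀ (u₁ u₂ : U x) (v : V x),
    curvature nablaV x ((S.iso x).symm (u₁ ⊗ₜ v)) ((S.iso x).symm (u₂ ⊗ₜ v)) v = 0

lemma CurvatureFlatAt.parallel {x : M} (h : S.CurvatureFlatAt nablaV x) :
    S.CurvatureParallelAt nablaV x :=
  fun u₁ u₂ v => ⟨0, by rw [h, zero_smul]⟩

variable {O : Set M} {s : Fin p → Π y : M, U y} {t : Fin q → Π y : M, V y}
  (hU : IsHolomorphicConnection nablaU) (hV : IsHolomorphicConnection nablaV)
  (hO : IsOpen O) (hs : IsLocalFrameOn 𝓘(ℂ, E) F₁ ω s O) (ht : IsLocalFrameOn 𝓘(ℂ, E) F₂ ω t O)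

local notation "𝒬" => frameData S hU hV hO hs ht

section Expansion

include hV hO hs

lemma torsion_tmul_eq_sum {x : M} (hx : x ∈ O) (u₁ u₂ : U x) (v : V x) :
    S.torsion nablaU nablaV x (u₁ ⊗ₜ v) (u₂ ⊗ₜ v) =
      ∑ A, ∑ B, hs.coeff A x u₁ • hs.coeff B x u₂ •
        S.torsion nablaU nablaV x (s A x ⊗ₜ v) (s B x ⊗ₜ v) := by
  conv_lhs => rw [← frame_sum_coeff hs hx u₁, ← frame_sum_coeff hs hx u₂]
  simp only [sum_tmul, ← smul_tmul', map_sum, map_smul, LinearMap.sum_apply, LinearMap.smul_apply,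
    Finset.smul_sum]
  rw [Finset.sum_comm]
  exact Finset.sum_congr rfl fun A _ => Finset.sum_congr rfl fun B _ => smul_comm _ _ _

lemma curvature_tmul_eq_sum {x : M} (hx : x ∈ O) (u₁ u₂ : U x) (v : V x) :
    curvature nablaV x ((S.iso x).symm (u₁ ⊗ₜ v)) ((S.iso x).symm (u₂ ⊗ₜ v)) v =
      ∑ A, ∑ B, hs.coeff A x u₁ • hs.coeff B x u₂ •
        curvature nablaV x ((S.iso x).symm (s A x ⊗ₜ v)) ((S.iso x).symm (s B x ⊗ₜ v)) v := by
  obtain ⟨L, hL⟩ := exists_curvature_eq hV x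
  conv_lhs => rw [← frame_sum_coeff hs hx u₁, ← frame_sum_coeff hs hx u₂]
  simp only [hL, sum_tmul, ← smul_tmul', map_sum, map_smul, LinearMap.sum_apply,
    LinearMap.smul_apply, Finset.smul_sum]
  rw [Finset.sum_comm]
  exact Finset.sum_congr rfl fun A _ => Finset.sum_congr rfl fun B _ => smul_comm _ _ _

end Expansion

include hU hV hO hs ht

/-- The functions `Tlam` are the components of the torsion along `U ⊗ v`. -/
lemma torsion_eq_sum_Tlam {x : M} (hx : x ∈ O) (A B : Fin p) (l : Fin q → ℂ) :
    S.torsion nablaU nablaV x (s A x ⊗ₜ ∑ i, l i • t i x) (s B x ⊗ₜ ∑ i, l i • t i x) =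
      ∑ d, (𝒬).Tlam (coneModel q) A B d (x, l) • (s d.1 x ⊗ₜ[ℂ] t d.2 x) := by
  simp only [tmul_sum, tmul_smul, map_sum, map_smul, LinearMap.sum_apply, LinearMap.smul_apply]
  simp only [fun i j => S.torsion_frame hU hV hO hs ht hx (A, i) (B, j), FrameData.Tlam,
    Finset.sum_smul, Finset.smul_sum, smul_smul]
  rw [Finset.sum_comm (s := (Finset.univ : Finset (Fin p × Fin q)))]
  rw [Finset.sum_comm]
  refine Finset.sum_congr rfl fun i _ => ?_
  rw [Finset.sum_comm (s := (Finset.univ : Finset (Fin p × Fin q)))]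
  refine Finset.sum_congr rfl fun j _ => Finset.sum_congr rfl fun d _ => ?_
  simp only [coneModel]
  ring_nf

lemma curvature_frame {x : M} (hx : x ∈ O) (a b : Fin p × Fin q) (j : Fin q) :
    curvature nablaV x (S.tmul (s a.1) (t a.2) x) (S.tmul (s b.1) (t b.2) x) (t j x) =
      ∑ i, (𝒬).R a b i j x • t i x := by
  classical
  have he := S.isLocalFrameOn_tmul hO hs ht
  have h1 : ∀ a b : Fin p × Fin q, he.coeff b x (S.tmul (s a.1) (t a.2) x) =
      if b = a then 1 else 0 := fun a b => frame_coeff_self he hx b a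
  rw [curvature_eq_sum hV hO he ht hx, ← S.curvOp_frame hU hV hO hs ht hx]
  simp [h1, frame_coeff_self ht hx]

/-- The functions `r` are the components of the curvature along `U ⊗ v`, applied to `v`. -/
lemma curvature_eq_sum_r {x : M} (hx : x ∈ O) (A B : Fin p) (l : Fin q → ℂ) :
    curvature nablaV x ((S.iso x).symm (s A x ⊗ₜ ∑ i, l i • t i x))
      ((S.iso x).symm (s B x ⊗ₜ ∑ i, l i • t i x)) (∑ i, l i • t i x) =
      ∑ i, (𝒬).r (coneModel q) A B i (x, l) • t i x := by
  obtain ⟨L, hL⟩ := exists_curvature_eq hV x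
  have h1 : ∀ i j m, L ((S.iso x).symm (s A x ⊗ₜ t i x)) ((S.iso x).symm (s B x ⊗ₜ t j x)) (t m x) =
      ∑ k, (𝒬).R (A, i) (B, j) k m x • t k x := fun i j m =>
    (hL _ _ _).symm.trans (S.curvature_frame hU hV hO hs ht hx (A, i) (B, j) m)
  simp only [hL, tmul_sum, tmul_smul, map_sum, map_smul, LinearMap.sum_apply, LinearMap.smul_apply,
    h1, FrameData.r, Finset.sum_smul, Finset.smul_sum, Finset.mul_sum, smul_smul]
  have : ∀ f : Fin q → Fin q → Fin q → Fin q → V x,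
      ∑ m, ∑ j, ∑ i, ∑ k, f i j m k = ∑ k, ∑ i, ∑ j, ∑ m, f i j m k := by
    intro f
    calc _ = ∑ m, ∑ i, ∑ j, ∑ k, f i j m k :=
          Finset.sum_congr rfl fun m _ => Finset.sum_comm
      _ = ∑ i, ∑ m, ∑ j, ∑ k, f i j m k := Finset.sum_comm
      _ = ∑ i, ∑ j, ∑ m, ∑ k, f i j m k := Finset.sum_congr rfl fun m _ => Finset.sum_comm
      _ = ∑ i, ∑ j, ∑ k, ∑ m, f i j m k := Finset.sum_congr rfl fun m _ =>
          Finset.sum_congr rfl fun m _ => Finset.sum_comm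
      _ = ∑ i, ∑ k, ∑ j, ∑ m, f i j m k := Finset.sum_congr rfl fun m _ => Finset.sum_comm
      _ = _ := Finset.sum_comm
  rw [this]
  refine Finset.sum_congr rfl fun k _ => Finset.sum_congr rfl fun i _ =>
    Finset.sum_congr rfl fun j _ => Finset.sum_congr rfl fun m _ => ?_
  simp only [coneModel]
  ring_nf

lemma torsionFlatAt_iff {x : M} (hx : x ∈ O) : S.TorsionFlatAt nablaU nablaV x ↔
    ∀ A B d l, (𝒬).Tlam (coneModel q) A B d (x, l) = 0 := by
  constructor
  · intro h A B d l
    have h1 := S.torsion_eq_sum_Tlam hU hV hO hs ht hx A B l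
    rw [h] at h1
    have hb := ((hs.toBasisAt hx).tensorProduct (ht.toBasisAt hx)).linearIndependent
    rw [Fintype.linearIndependent_iff] at hb
    refine hb (fun d => (𝒬).Tlam (coneModel q) A B d (x, l)) (h1.trans ?_).symm d
    refine Finset.sum_congr rfl fun d _ => congrArg _ ?_
    rw [Basis.tensorProduct_apply', hs.toBasisAt_coe, ht.toBasisAt_coe]
  · intro h u₁ u₂ v
    rw [S.torsion_tmul_eq_sum hV hO hs hx]
    refine Finset.sum_eq_zero fun A _ => Finset.sum_eq_zero fun B _ => ?_
    rw [← frame_sum_coeff ht hx v, S.torsion_eq_sum_Tlam hU hV hO hs ht hx]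
    simp [h]

lemma curvatureFlatAt_iff {x : M} (hx : x ∈ O) : S.CurvatureFlatAt nablaV x ↔
    ∀ A B i l, (𝒬).r (coneModel q) A B i (x, l) = 0 := by
  constructor
  · intro h A B i l
    have h1 := S.curvature_eq_sum_r hU hV hO hs ht hx A B l
    rw [h] at h1
    have h2 := frame_coeff_sum ht hx (fun i => (𝒬).r (coneModel q) A B i (x, l)) i
    rw [← h1, map_zero] at h2
    exact h2.symm
  · intro h u₁ u₂ v
    rw [S.curvature_tmul_eq_sum hV hO hs hx]
    refine Finset.sum_eq_zero fun A _ => Finset.sum_eq_zero fun B _ => ?_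
    rw [← frame_sum_coeff ht hx v, S.curvature_eq_sum_r hU hV hO hs ht hx]
    simp [h]

lemma curvatureParallelAt_iff {x : M} (hx : x ∈ O) : S.CurvatureParallelAt nablaV x ↔
    ∀ A B i j l, (𝒬).r (coneModel q) A B i (x, l) * l j =
      (𝒬).r (coneModel q) A B j (x, l) * l i := by
  constructor
  · intro h A B i j l
    have h1 := S.curvature_eq_sum_r hU hV hO hs ht hx A B l
    obtain ⟨c, hc⟩ := h (s A x) (s B x) (∑ i, l i • t i x)
    rw [h1] at hc
    have h2 : ∀ i, (𝒬).r (coneModel q) A B i (x, l) = c * l i := by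
      intro i
      have h3 := congrArg (ht.coeff i x) hc
      rwa [map_smul, frame_coeff_sum ht hx, frame_coeff_sum ht hx, smul_eq_mul] at h3
    rw [h2, h2]; ring
  · intro h u₁ u₂ v
    have key : ∀ A B, ∃ c : ℂ, curvature nablaV x ((S.iso x).symm (s A x ⊗ₜ v))
        ((S.iso x).symm (s B x ⊗ₜ v)) v = c • v := by
      intro A B
      obtain ⟨l, rfl⟩ : ∃ l : Fin q → ℂ, v = ∑ i, l i • t i x :=
        ⟨_, (frame_sum_coeff ht hx v).symm⟩
      rw [S.curvature_eq_sum_r hU hV hO hs ht hx]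
      by_cases hl : l = 0
      · refine ⟨0, ?_⟩
        subst hl
        simp [FrameData.r, coneModel]
      · obtain ⟨j, hj⟩ := Function.ne_iff.1 hl
        refine ⟨(𝒬).r (coneModel q) A B j (x, l) / l j, ?_⟩
        rw [Finset.smul_sum]
        refine Finset.sum_congr rfl fun i _ => ?_
        rw [smul_smul, div_mul_eq_mul_div, ← h A B i j l, mul_div_cancel_right₀ _ hj]
    choose c hc using key
    refine ⟨∑ A, ∑ B, hs.coeff A x u₁ * (hs.coeff B x u₂ * c A B), ?_⟩
    rw [S.curvature_tmul_eq_sum hV hO hs hx]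
    simp only [hc, Finset.sum_smul, smul_smul]

/-- The full trace of the torsion vanishes, as its trace over `U` does. -/
lemma sum_T_eq_zero (hT : S.TorsionTraceFree nablaU nablaV) {x : M} (hx : x ∈ O)
    (b : Fin p × Fin q) : ∑ d, (𝒬).T d b d x = 0 := by
  classical
  rw [Fintype.sum_prod_type, Finset.sum_comm]
  refine Finset.sum_eq_zero fun j _ => ?_
  have h1 := (hT x (s b.1 x ⊗ₜ t b.2 x)).1 (t j x) ((ht.toBasisAt hx).coord j)
  rw [trace_eq_sum_repr (hs.toBasisAt hx)] at h1
  rw [← h1]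
  refine Finset.sum_congr rfl fun A _ => ?_
  have h2 : (((TensorProduct.rid ℂ (U x)).toLinearMap ∘ₗ
        LinearMap.lTensor (U x) ((ht.toBasisAt hx).coord j) ∘ₗ
          (S.torsion nablaU nablaV x).flip (s b.1 x ⊗ₜ t b.2 x) ∘ₗ
          (TensorProduct.mk ℂ (U x) (V x)).flip (t j x)) ((hs.toBasisAt hx) A)) =
      contractRight ((ht.toBasisAt hx).coord j)
        (S.torsion nablaU nablaV x (s A x ⊗ₜ t j x) (s b.1 x ⊗ₜ t b.2 x)) := by
    rw [hs.toBasisAt_coe]; rfl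
  have h3 : ∀ i : Fin q, (ht.toBasisAt hx).coord j (t i x) = if i = j then 1 else 0 := by
    intro i
    rw [← ht.toBasisAt_coe hx i, Basis.coord_apply, Basis.repr_self, Finsupp.single_apply]
  have h4 : ∀ C : Fin p, (hs.toBasisAt hx).repr (s C x) A = if C = A then 1 else 0 := by
    intro C
    rw [← hs.toBasisAt_coe hx C, Basis.repr_self, Finsupp.single_apply]
  rw [h2, S.torsion_frame hU hV hO hs ht hx (A, j) b, Fintype.sum_prod_type]
  simp only [map_sum, map_smul, contractRight_tmul, h3, h4, Finsupp.coe_finsetSum,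
    Finset.sum_apply, Finsupp.smul_apply]
  simp

end ParaconformalStructure

end

/-! ### Frames adapted to the scale -/

section

open ParaconformalStructure

/-- The top exterior power is a line, spanned by the exterior product of a basis. -/
lemma exists_eq_smul_iMulti {W : Type*} [AddCommGroup W] [Module ℂ W] {r : ℕ}
    (b : Basis (Fin r) ℂ W) (τ : ⋀[ℂ]^r W) :
    ∃ c : ℂ, τ = c • exteriorPower.ιMulti ℂ r (fun i => b i) := by
  classical
  have key : exteriorPower.ιMulti ℂ r = (LinearMap.toSpanSingleton ℂ (⋀[ℂ]^r W)
      (exteriorPower.ιMulti ℂ r (fun i => b i))).compAlternatingMap b.det := by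
    refine Basis.ext_alternating b fun v hv => ?_
    let σ : Equiv.Perm (Fin r) := Equiv.ofBijective v (Finite.injective_iff_bijective.1 hv)
    have h1 := (exteriorPower.ιMulti ℂ r).map_perm (fun i => b i) σ
    have h2 := b.det.map_perm (fun i => b i) σ
    change exteriorPower.ιMulti ℂ r ((fun i => b i) ∘ σ) = b.det ((fun i => b i) ∘ σ) •
      exteriorPower.ιMulti ℂ r (fun i => b i)
    have h3 : (b.det fun i => b i) = 1 := b.det_self
    rw [h1, h2, h3, smul_assoc, one_smul]
  have hτ : τ ∈ Submodule.span ℂ (Set.range (exteriorPower.ιMulti ℂ r (M := W))) := by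
    rw [exteriorPower.ιMulti_span]; trivial
  induction hτ using Submodule.span_induction with
  | mem y hy =>
    obtain ⟨v, rfl⟩ := hy
    exact ⟨b.det v, congrArg (fun f : W [⋀^Fin r]→ₗ[ℂ] (⋀[ℂ]^r W) => f v) key⟩
  | zero => exact ⟨0, by rw [zero_smul]⟩
  | add y z _ _ hy hz =>
    obtain ⟨c, rfl⟩ := hy
    obtain ⟨d, rfl⟩ := hz
    exact ⟨c + d, by rw [add_smul]⟩
  | smul a y _ hy =>
    obtain ⟨c, rfl⟩ := hy
    exact ⟨a * c, by rw [mul_smul]⟩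

section AdaptedFrame

variable {E : Type*} [NormedAddCommGroup E] [NormedSpace ℂ E] [FiniteDimensional ℂ E]
  [CompleteSpace E]
  {M : Type*} [TopologicalSpace M] [ChartedSpace E M] [IsManifold 𝓘(ℂ, E) ω M]
  {F : Type*} [NormedAddCommGroup F] [NormedSpace ℂ F] [FiniteDimensional ℂ F]
  {W : M → Type*} [TopologicalSpace (TotalSpace F W)]
  [∀ x, AddCommGroup (W x)] [∀ x, Module ℂ (W x)] [∀ x, TopologicalSpace (W x)]
  [∀ x, IsTopologicalAddGroup (W x)] [∀ x, ContinuousSMul ℂ (W x)]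
  [FiberBundle F W] [VectorBundle ℂ F W] [ContMDiffVectorBundle ω F W 𝓘(ℂ, E)]

lemma coeff_mono {r : ℕ} {O O' : Set M} {s : Fin r → Π y : M, W y}
    (hs : IsLocalFrameOn 𝓘(ℂ, E) F ω s O) (h : O' ⊆ O) {y : M} (hy : y ∈ O') (i : Fin r) :
    (hs.mono h).coeff i y = hs.coeff i y := by
  simp only [IsLocalFrameOn.coeff, hy, h hy, dite_true]; rfl

/-- If `ε` is a parallel, non-vanishing section of the top exterior power, there are local frames
`s` with `s₁ ∧ … ∧ s_r = ε`; in such a frame, the connection form is trace-free. -/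
lemma exists_adaptedFrame {r : ℕ} (hr : finrank ℂ F = r) (hr0 : 0 < r)
    (nabla : CovariantDerivative 𝓘(ℂ, E) F W) {ε : ∀ x, ⋀[ℂ]^r (W x)} (hε0 : ∀ x, ε x ≠ 0)
    (hε : ∀ x, IsHolomorphicTopAt E F r ε x) (hpar : IsParallelTop nabla ε) (x : M) :
    ∃ (O : Set M) (s : Fin r → Π y : M, W y) (hs : IsLocalFrameOn 𝓘(ℂ, E) F ω s O),
      IsOpen O ∧ x ∈ O ∧ ∀ y ∈ O, ∀ X, ∑ i, hs.coeff i y (nabla (s i) y X) = 0 := by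
  classical
  obtain ⟨O, u, hO, hxO, hu⟩ := exists_localFrame (E := E) (F := F) (W := W) hr x
  have hf : ∀ y : M, ∃ c : ℂ, y ∈ O →
      ε y = c • exteriorPower.ιMulti ℂ r (fun i => u i y) := by
    intro y
    by_cases hy : y ∈ O
    · obtain ⟨c, hc⟩ := exists_eq_smul_iMulti (hu.toBasisAt hy) (ε y)
      refine ⟨c, fun _ => ?_⟩
      simpa only [hu.toBasisAt_coe] using hc
    · exact ⟨0, fun h => absurd h hy⟩
  choose f hf using hf
  have hf0 : ∀ y ∈ O, f y ≠ 0 := by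
    intro y hy h0
    have h1 := hf y hy
    rw [h0, zero_smul] at h1
    exact hε0 y h1
  have hfO : ∀ y ∈ O, CMDiffAt ω f y := fun y hy =>
    hε y u (fun i => hu.contMDiffAt hO hy i) (hu.linearIndependent hy) f
      (by filter_upwards [hO.mem_nhds hy] with z hz using hf z hz)
  -- rescaling one member of the frame makes the exterior product equal to `ε`
  let i₀ : Fin r := ⟨0, hr0⟩
  let g : Fin r → M → ℂ := fun i => if i = i₀ then f else fun _ => 1
  have hg0 : ∀ i, ∀ y ∈ O, g i y ≠ 0 := by
    intro i y hy
    simp only [g]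
    split_ifs
    · exact hf0 y hy
    · exact one_ne_zero
  have hg : ∀ i, ∀ y ∈ O, CMDiffAt ω (g i) y := by
    intro i y hy
    simp only [g]
    split_ifs
    · exact hfO y hy
    · exact contMDiffAt_const
  let s : Fin r → Π y : M, W y := fun i y => g i y • u i y
  have hs : IsLocalFrameOn 𝓘(ℂ, E) F ω s O := by
    have hb : ∀ y (hy : y ∈ O), (fun i => s i y) =
        (hu.toBasisAt hy).isUnitSMul (fun i => (hg0 i y hy).isUnit) := by
      intro y hy
      funext i
      simp [s, Basis.isUnitSMul_apply]
    refine ⟨fun {y} hy => ?_, fun {y} hy => ?_, fun i y hy => ?_⟩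
    · rw [hb y hy]; exact Basis.linearIndependent _
    · rw [hb y hy, Basis.span_eq]
    · exact ((hg i y hy).smul_section (hu.contMDiffAt hO hy i)).contMDiffWithinAt
  have hsε : ∀ y ∈ O, exteriorPower.ιMulti ℂ r (fun i => s i y) = ε y := by
    intro y hy
    have h1 := (exteriorPower.ιMulti ℂ r).map_smul_univ (fun i => g i y) (fun i => u i y)
    have h2 : ∏ i, g i y = f y := by
      rw [Finset.prod_eq_single i₀ (fun i _ hi => by simp [g, hi]) (by simp)]
      simp [g]
    rw [h2] at h1
    exact h1.trans (hf y hy).symm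
  refine ⟨O, s, hs, hO, hxO, fun y hy X => ?_⟩
  have h1 := hpar y s (fun _ => 1) (fun i => hs.contMDiffAt hO hy i) contMDiffAt_const
    (by filter_upwards [hO.mem_nhds hy] with z hz; rw [one_smul]; exact hsε z hz) X
  have h2 : ∀ i, exteriorPower.ιMulti ℂ r
      (Function.update (fun j => s j y) i (nabla (s i) y X)) =
      hs.coeff i y (nabla (s i) y X) • ε y := by
    intro i
    have h3 := (exteriorPower.ιMulti ℂ r).map_update_sum Finset.univ i
      (fun j => hs.coeff j y (nabla (s i) y X) • s j y) (fun j => s j y)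
    rw [frame_sum_coeff hs hy] at h3
    rw [h3, Finset.sum_eq_single i]
    · rw [AlternatingMap.map_update_smul, Function.update_eq_self i (fun j => s j y), hsε y hy]
    · intro j _ hji
      rw [AlternatingMap.map_update_smul, AlternatingMap.map_update_self _ _ hji.symm, smul_zero]
    · simp
  have h4 : mvfderiv 𝓘(ℂ, E) (fun _ : M => (1 : ℂ)) y X = 0 := by
    rw [mvfderiv_const]; rfl
  rw [Finset.sum_congr rfl fun i _ => h2 i, ← Finset.sum_smul, h4, zero_smul] at h1
  exact (smul_eq_zero.1 h1).resolve_right (hε0 y)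

end AdaptedFrame

variable {E : Type*} [NormedAddCommGroup E] [NormedSpace ℂ E] [FiniteDimensional ℂ E]
  [CompleteSpace E]
  {M : Type*} [TopologicalSpace M] [ChartedSpace E M] [IsManifold 𝓘(ℂ, E) ω M]
  {F₁ : Type*} [NormedAddCommGroup F₁] [NormedSpace ℂ F₁] [FiniteDimensional ℂ F₁]
  {U : M → Type*} [TopologicalSpace (TotalSpace F₁ U)]
  [∀ x, AddCommGroup (U x)] [∀ x, Module ℂ (U x)] [∀ x, TopologicalSpace (U x)]
  [∀ x, IsTopologicalAddGroup (U x)] [∀ x, ContinuousSMul ℂ (U x)]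
  [FiberBundle F₁ U] [VectorBundle ℂ F₁ U] [ContMDiffVectorBundle ω F₁ U 𝓘(ℂ, E)]
  {F₂ : Type*} [NormedAddCommGroup F₂] [NormedSpace ℂ F₂] [FiniteDimensional ℂ F₂]
  {V : M → Type*} [TopologicalSpace (TotalSpace F₂ V)]
  [∀ x, AddCommGroup (V x)] [∀ x, Module ℂ (V x)] [∀ x, TopologicalSpace (V x)]
  [∀ x, IsTopologicalAddGroup (V x)] [∀ x, ContinuousSMul ℂ (V x)]
  [FiberBundle F₂ V] [VectorBundle ℂ F₂ V] [ContMDiffVectorBundle ω F₂ V 𝓘(ℂ, E)]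
  {p q : ℕ} {S : ParaconformalStructure E F₁ U F₂ V p q}
  {nablaU : CovariantDerivative 𝓘(ℂ, E) F₁ U} {nablaV : CovariantDerivative 𝓘(ℂ, E) F₂ V}
  {ε : Scale E F₁ U p}

namespace ParaconformalStructure

/-- Over an open set where the structure is right-flat, torsion and curvature both vanish along the
twistor distribution. For `p > 2` the definition only concerns the torsion, and for `p = 2` only the
curvature, up to multiples of `v`; openness is needed because the proof differentiates. -/
theorem IsScaleConnection.isRightFlatOn_iff (hp : 2 ≤ p) (hq : 2 ≤ q)
    (h : S.IsScaleConnection nablaU nablaV ε) {O : Set M} (hO : IsOpen O) :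
    S.IsRightFlatOn nablaU nablaV O ↔
      ∀ x ∈ O, S.TorsionFlatAt nablaU nablaV x ∧ S.CurvatureFlatAt nablaV x := by
  rw [S.isRightFlatOn_iff nablaU nablaV h.holo_right O]
  constructor
  swap
  · exact fun H x hx => ⟨fun _ => (H x hx).1, fun _ => (H x hx).2.parallel⟩
  intro H
  have hT : ∀ x ∈ O, S.TorsionFlatAt nablaU nablaV x := by
    intro x hx
    rcases hp.lt_or_eq with h2 | h2
    · exact (H x hx).1 h2
    · exact h.traceFree.torsionFlatAt_of_two h2.symm x
  intro x hx
  refine ⟨hT x hx, ?_⟩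
  obtain ⟨O₁, s, hs₁, hO₁, hx₁, htr₁⟩ := exists_adaptedFrame S.rank_left (by omega) nablaU
    ε.ne_zero ε.holo h.parallel_left x
  obtain ⟨O₂, t, ht₂, hO₂, hx₂, htr₂⟩ := exists_adaptedFrame S.rank_right (by omega) nablaV
    (ε := S.primedScale ε) (fun y => (S.volIso y).map_ne_zero_iff.2 (ε.ne_zero y))
    (fun y => S.holo_volIso y _ (ε.holo y)) h.parallel_right x
  let O' := O ∩ (O₁ ∩ O₂)
  have hO' : IsOpen O' := hO.inter (hO₁.inter hO₂)
  have hxO' : x ∈ O' := ⟨hx, hx₁, hx₂⟩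
  have hs : IsLocalFrameOn 𝓘(ℂ, E) F₁ ω s O' := hs₁.mono fun y hy => hy.2.1
  have ht : IsLocalFrameOn 𝓘(ℂ, E) F₂ ω t O' := ht₂.mono fun y hy => hy.2.2
  let Q := S.frameData h.holo_left h.holo_right hO' hs ht
  have hQT : ∀ y ∈ O', ∀ A B d l, Q.Tlam (coneModel q) A B d (y, l) = 0 := fun y hy =>
    (S.torsionFlatAt_iff h.holo_left h.holo_right hO' hs ht hy).1 (hT y hy.1)
  have hQr : ∀ y ∈ O', ∀ A B i j l,
      Q.r (coneModel q) A B i (y, l) * l j = Q.r (coneModel q) A B j (y, l) * l i := by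
    intro y hy
    rcases hp.lt_or_eq with h2 | h2
    · exact fun A B i j l => Q.r_parallel h2 hQT hy A B i j l
    · exact (S.curvatureParallelAt_iff h.holo_left h.holo_right hO' hs ht hy).1
        ((H y hy.1).2 h2.symm)
  rw [S.curvatureFlatAt_iff h.holo_left h.holo_right hO' hs ht hxO']
  refine Q.r_eq_zero hQT hQr (fun y hy a => ?_) (fun y hy a => ?_) (fun y hy b => ?_) hxO'
  · refine Eq.trans (Finset.sum_congr rfl fun i _ => ?_) (htr₁ y hy.2.1 (S.tmul (s a.1) (t a.2) y))
    rw [← coeff_mono hs₁ (fun y hy => hy.2.1) hy]; rfl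
  · refine Eq.trans (Finset.sum_congr rfl fun i _ => ?_) (htr₂ y hy.2.2 (S.tmul (s a.1) (t a.2) y))
    rw [← coeff_mono ht₂ (fun y hy => hy.2.2) hy]; rfl
  · exact S.sum_T_eq_zero h.holo_left h.holo_right hO' hs ht h.traceFree hy b

end ParaconformalStructure

end

/-! ### Lax tuples -/

section

open ParaconformalStructure

lemma smul_homogeneous {q : ℕ} (k : Fin q) {m : Fin q → ℂ} (hm : m k ≠ 0) :
    m = m k • homogeneous k (fun i => m i / m k) := by
  funext i
  simp only [Pi.smul_apply, homogeneous, smul_eq_mul]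
  split_ifs with h
  · rw [h, mul_one]
  · rw [mul_div_cancel₀ _ hm]

lemma homogeneous_self {q : ℕ} (k : Fin q) (l : {i : Fin q // i ≠ k} → ℂ) :
    homogeneous k l k = 1 := by simp [homogeneous]

/-- A homogeneous function on `ℂ^q` which vanishes on an affine chart of projective space vanishes
identically. -/
lemma eq_zero_of_homogeneous {q : ℕ} (k : Fin q) {f : (Fin q → ℂ) → ℂ} (hf : Continuous f) (n : ℕ)
    (hom : ∀ c l, f (c • l) = c ^ n * f l) (h : ∀ l, f (homogeneous k l) = 0) (m : Fin q → ℂ) :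
    f m = 0 := by
  have hd : Dense {m : Fin q → ℂ | m k ≠ 0} :=
    (dense_compl_singleton (0 : ℂ)).preimage (isOpenMap_eval k)
  have : f = fun _ => 0 := by
    refine hf.ext_on hd continuous_const fun m hm => ?_
    rw [smul_homogeneous k hm, hom, h, mul_zero]
  exact congrFun this m

variable {E : Type*} [NormedAddCommGroup E] [NormedSpace ℂ E] [FiniteDimensional ℂ E]
  [CompleteSpace E]
  {M : Type*} [TopologicalSpace M] [ChartedSpace E M] [IsManifold 𝓘(ℂ, E) ω M]
  {p q : ℕ} {O : Set M}

namespace FrameData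

variable (Q : FrameData E p q O)

lemma Tlam_smul (A B : Fin p) (d : Fin p × Fin q) (x : M) (c : ℂ) (l : Fin q → ℂ) :
    Q.Tlam (coneModel q) A B d (x, c • l) = c ^ 2 * Q.Tlam (coneModel q) A B d (x, l) := by
  simp only [Tlam, Finset.mul_sum, coneModel, Pi.smul_apply, smul_eq_mul]
  refine Finset.sum_congr rfl fun i _ => Finset.sum_congr rfl fun j _ => ?_
  ring

lemma r_smul (A B : Fin p) (i : Fin q) (x : M) (c : ℂ) (l : Fin q → ℂ) :
    Q.r (coneModel q) A B i (x, c • l) = c ^ 3 * Q.r (coneModel q) A B i (x, l) := by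
  simp only [r, Finset.mul_sum, coneModel, Pi.smul_apply, smul_eq_mul]
  refine Finset.sum_congr rfl fun i _ => Finset.sum_congr rfl fun j _ =>
    Finset.sum_congr rfl fun m _ => ?_
  ring

lemma continuous_Tlam (A B : Fin p) (d : Fin p × Fin q) (x : M) :
    Continuous fun l => Q.Tlam (coneModel q) A B d (x, l) := by
  simp only [Tlam, coneModel]
  fun_prop

lemma continuous_r (A B : Fin p) (i : Fin q) (x : M) :
    Continuous fun l => Q.r (coneModel q) A B i (x, l) := by
  simp only [r, coneModel]
  fun_prop

end FrameData

variable
  {F₁ : Type*} [NormedAddCommGroup F₁] [NormedSpace ℂ F₁] [FiniteDimensional ℂ F₁]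
  {U : M → Type*} [TopologicalSpace (TotalSpace F₁ U)]
  [∀ x, AddCommGroup (U x)] [∀ x, Module ℂ (U x)] [∀ x, TopologicalSpace (U x)]
  [∀ x, IsTopologicalAddGroup (U x)] [∀ x, ContinuousSMul ℂ (U x)]
  [FiberBundle F₁ U] [VectorBundle ℂ F₁ U] [ContMDiffVectorBundle ω F₁ U 𝓘(ℂ, E)]
  {F₂ : Type*} [NormedAddCommGroup F₂] [NormedSpace ℂ F₂] [FiniteDimensional ℂ F₂]
  {V : M → Type*} [TopologicalSpace (TotalSpace F₂ V)]
  [∀ x, AddCommGroup (V x)] [∀ x, Module ℂ (V x)] [∀ x, TopologicalSpace (V x)]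
  [∀ x, IsTopologicalAddGroup (V x)] [∀ x, ContinuousSMul ℂ (V x)]
  [FiberBundle F₂ V] [VectorBundle ℂ F₂ V] [ContMDiffVectorBundle ω F₂ V 𝓘(ℂ, E)]
  {S : ParaconformalStructure E F₁ U F₂ V p q}
  {nablaU : CovariantDerivative 𝓘(ℂ, E) F₁ U} {nablaV : CovariantDerivative 𝓘(ℂ, E) F₂ V}
  {ε : Scale E F₁ U p}

namespace ParaconformalStructure

variable {s : Fin p → Π y : M, U y} {t : Fin q → Π y : M, V y}

section Frames

variable (S) (hU : IsHolomorphicConnection nablaU) (hV : IsHolomorphicConnection nablaV)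
  (hO : IsOpen O) (hs : IsLocalFrameOn 𝓘(ℂ, E) F₁ ω s O) (ht : IsLocalFrameOn 𝓘(ℂ, E) F₂ ω t O)

local notation "𝒬" => frameData S hU hV hO hs ht

/-- If the torsion components along `π` are proportional to `π`, the torsion maps `U ⊗ v` to
itself. -/
lemma exists_torsion_eq_tmul {x : M} (hx : x ∈ O) (h : ∀ A B D i j l,
      (𝒬).Tlam (coneModel q) A B (D, i) (x, l) * l j =
        (𝒬).Tlam (coneModel q) A B (D, j) (x, l) * l i) (u₁ u₂ : U x) (v : V x) :
    ∃ u : U x, S.torsion nablaU nablaV x (u₁ ⊗ₜ v) (u₂ ⊗ₜ v) = u ⊗ₜ v := by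
  have key : ∀ A B, ∃ u : U x,
      S.torsion nablaU nablaV x (s A x ⊗ₜ v) (s B x ⊗ₜ v) = u ⊗ₜ v := by
    intro A B
    obtain ⟨l, rfl⟩ : ∃ l : Fin q → ℂ, v = ∑ i, l i • t i x :=
      ⟨_, (frame_sum_coeff ht hx v).symm⟩
    rw [S.torsion_eq_sum_Tlam hU hV hO hs ht hx]
    by_cases hl : l = 0
    · refine ⟨0, ?_⟩
      subst hl
      simp [FrameData.Tlam, coneModel]
    · obtain ⟨j, hj⟩ := Function.ne_iff.1 hl
      refine ⟨∑ D, ((𝒬).Tlam (coneModel q) A B (D, j) (x, l) / l j) • s D x, ?_⟩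
      rw [sum_tmul, Fintype.sum_prod_type]
      refine Finset.sum_congr rfl fun D _ => ?_
      rw [tmul_sum]
      refine Finset.sum_congr rfl fun i _ => ?_
      rw [tmul_smul, ← smul_tmul', smul_smul]
      congr 1
      rw [mul_div_assoc', mul_comm (l i), ← h A B D i j l]
      exact (mul_div_cancel_right₀ _ hj).symm
  choose u hu using key
  refine ⟨∑ A, ∑ B, hs.coeff A x u₁ • hs.coeff B x u₂ • u A B, ?_⟩
  rw [S.torsion_tmul_eq_sum hV hO hs hx]
  simp only [hu, sum_tmul, ← smul_tmul']

/-- If torsion and curvature along `π` are proportional to `π`, the structure is right-flat: the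
torsion then vanishes since it is trace-free, and the curvature condition is that of `W⁺ = 0`. -/
lemma isRightFlatOn_of_parallel (hT : S.TorsionTraceFree nablaU nablaV)
    (h1 : ∀ x ∈ O, ∀ A B D i j l, (𝒬).Tlam (coneModel q) A B (D, i) (x, l) * l j =
        (𝒬).Tlam (coneModel q) A B (D, j) (x, l) * l i)
    (h2 : ∀ x ∈ O, ∀ A B i j l, (𝒬).r (coneModel q) A B i (x, l) * l j =
        (𝒬).r (coneModel q) A B j (x, l) * l i) : S.IsRightFlatOn nablaU nablaV O := by
  rw [S.isRightFlatOn_iff nablaU nablaV hV]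
  exact fun x hx => ⟨fun _ => hT.torsionFlatAt x
    (S.exists_torsion_eq_tmul hU hV hO hs ht hx (h1 x hx)),
    fun _ => (S.curvatureParallelAt_iff hU hV hO hs ht hx).2 (h2 x hx)⟩

lemma laxField_eq (k : Fin q) (A : Fin p) :
    S.laxField nablaV s ht k A = (𝒬).fieldV (affineModel k) A := by
  funext y
  refine Finset.sum_congr rfl fun i _ => congrArg (fun w => homogeneous k y.2 i • w) ?_
  refine Prod.ext (α := E) (β := {i : Fin q // i ≠ k} → ℂ) ?_ ?_
  · exact ((𝒬).fst_fieldD (affineModel k) (A, i) y).symm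
  · refine Eq.trans ?_ ((𝒬).snd_fieldD (affineModel k) (A, i) y).symm
    funext j
    simp only [laxD, Pi.neg_apply, Finset.sum_apply, Pi.smul_apply, smul_eq_mul, affineModel,
      projConnection, FrameData.gl, mul_sub, Finset.sum_sub_distrib]
    congr 1
    simp [homogeneous, j.2, frameData, connectionCoeff, mul_comm]

lemma isLaxTuple_iff (k : Fin q) (C : Fin p → Fin p → Fin p → M × ({i : Fin q // i ≠ k} → ℂ) → ℂ) :
    S.IsLaxTuple nablaV s ht k C ↔ ∀ A B, ∀ y : M × ({i : Fin q // i ≠ k} → ℂ), y.1 ∈ O →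
      VectorField.mlieBracket (𝓘(ℂ, E).prod 𝓘(ℂ, {i : Fin q // i ≠ k} → ℂ))
        ((𝒬).fieldV (affineModel k) A) ((𝒬).fieldV (affineModel k) B) y =
        ∑ D, C A B D y • (𝒬).fieldV (affineModel k) D y := by
  simp only [IsLaxTuple, S.laxField_eq hU hV hO hs ht, mem_prod, mem_univ, and_true]

include hU hV hO hs in
/-- If the brackets of the Lax tuple are combinations of the tuple, then the structure is
right-flat. The tuple only sees `π` with `πᵏ ≠ 0`; the other `π` are reached by continuity. -/
lemma isRightFlatOn_of_lax (hT : S.TorsionTraceFree nablaU nablaV) (k : Fin q)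
    (h : ∀ A B, ∀ y : M × ({i : Fin q // i ≠ k} → ℂ), y.1 ∈ O → ∃ c : Fin p → ℂ,
      VectorField.mlieBracket (𝓘(ℂ, E).prod 𝓘(ℂ, {i : Fin q // i ≠ k} → ℂ))
        (S.laxField nablaV s ht k A) (S.laxField nablaV s ht k B) y =
        ∑ D, c D • S.laxField nablaV s ht k D y) : S.IsRightFlatOn nablaU nablaV O := by
  simp only [S.laxField_eq hU hV hO hs ht] at h
  refine S.isRightFlatOn_of_parallel hU hV hO hs ht hT (fun x hx A B D i j l => ?_)
    (fun x hx A B i j l => ?_)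
  · refine sub_eq_zero.1 (eq_zero_of_homogeneous k (f := fun l =>
      (𝒬).Tlam (coneModel q) A B (D, i) (x, l) * l j -
        (𝒬).Tlam (coneModel q) A B (D, j) (x, l) * l i) ?_ 3 (fun c l => ?_) (fun l => ?_) l)
    · exact (((𝒬).continuous_Tlam A B _ x).mul (continuous_apply j)).sub
        (((𝒬).continuous_Tlam A B _ x).mul (continuous_apply i))
    · simp only [FrameData.Tlam_smul, Pi.smul_apply, smul_eq_mul]
      ring
    · obtain ⟨c, hc⟩ := h A B (x, l) hx
      have h1 : ∀ d, (𝒬).Tlam (coneModel q) A B d (x, homogeneous k l) =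
        ((𝒬).C (affineModel k) A B d.1 (x, l) - c d.1) * homogeneous k l d.2 :=
        (((𝒬).mlieBracket_fieldV_eq_iff (affineModel k) A B (y := (x, l)) hx c).1 hc).1
      simp only [h1]
      ring
  · refine sub_eq_zero.1 (eq_zero_of_homogeneous k (f := fun l =>
      (𝒬).r (coneModel q) A B i (x, l) * l j -
        (𝒬).r (coneModel q) A B j (x, l) * l i) ?_ 4 (fun c l => ?_) (fun l => ?_) l)
    · exact (((𝒬).continuous_r A B _ x).mul (continuous_apply j)).sub
        (((𝒬).continuous_r A B _ x).mul (continuous_apply i))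
    · simp only [FrameData.r_smul, Pi.smul_apply, smul_eq_mul]
      ring
    · obtain ⟨c, hc⟩ := h A B (x, l) hx
      have h1 : ∀ i, (𝒬).r (coneModel q) A B i (x, homogeneous k l) =
          (𝒬).r (coneModel q) A B k (x, homogeneous k l) * homogeneous k l i :=
        (sum_smul_affine_dl _ l).1
          (((𝒬).mlieBracket_fieldV_eq_iff (affineModel k) A B (y := (x, l)) hx c).1 hc).2
      rw [h1 i, h1 j]
      ring

/-- Over a right-flat open set, the brackets of the fields `v_A` of any fibre model
are combinations of the fields `v_A`. -/
lemma mlieBracket_fieldV_of_rightFlat (hp : 2 ≤ p) (hq : 2 ≤ q)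
    (h : S.IsScaleConnection nablaU nablaV ε) (hf : S.IsRightFlatOn nablaU nablaV O)
    {P : Type*} [NormedAddCommGroup P] [NormedSpace ℂ P] [CompleteSpace P] (m : FibreModel q P)
    (A B : Fin p) {y : M × P} (hy : y.1 ∈ O) :
    VectorField.mlieBracket (𝓘(ℂ, E).prod 𝓘(ℂ, P)) ((𝒬).fieldV m A) ((𝒬).fieldV m B) y =
      ∑ D, (𝒬).C m A B D y • (𝒬).fieldV m D y := by
  obtain ⟨h1, h2⟩ := (h.isRightFlatOn_iff hp hq hO).1 hf y.1 hy
  rw [S.torsionFlatAt_iff hU hV hO hs ht hy] at h1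
  rw [S.curvatureFlatAt_iff hU hV hO hs ht hy] at h2
  refine ((𝒬).mlieBracket_fieldV_eq_iff m A B hy _).2 ⟨fun d => ?_, ?_⟩
  · rw [sub_self, zero_mul]
    exact h1 A B d fun i => m.lam i y.2
  · refine Finset.sum_eq_zero fun i _ => ?_
    have : (𝒬).r m A B i y = 0 := h2 A B i fun i => m.lam i y.2
    rw [this, zero_smul]

end Frames

/-- The description of right-flatness by Lax tuples, and the polynomiality of the coefficients. -/
theorem IsScaleConnection.lax (hp : 2 ≤ p) (hq : 2 ≤ q)
    (h : S.IsScaleConnection nablaU nablaV ε) (hO : IsOpen O)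
    (hs : IsLocalFrameOn 𝓘(ℂ, E) F₁ ω s O) (ht : IsLocalFrameOn 𝓘(ℂ, E) F₂ ω t O) (k : Fin q) :
    ((∃ C, S.IsLaxTuple nablaV s ht k C) ↔ S.IsRightFlatOn nablaU nablaV O) ∧
      ∀ C, S.IsLaxTuple nablaV s ht k C →
        ∃ P : Fin p → Fin p → Fin p → M → MvPolynomial {i : Fin q // i ≠ k} ℂ,
          (∀ A B D x, (P A B D x).totalDegree ≤ 2) ∧
          (∀ A B D m, CMDiff[O] ω (fun x => (P A B D x).coeff m)) ∧
          ∀ A B D, ∀ x ∈ O, ∀ l, C A B D (x, l) = MvPolynomial.eval l (P A B D x) := by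
  let Q := S.frameData h.holo_left h.holo_right hO hs ht
  refine ⟨⟨?_, fun hf => ⟨Q.C (affineModel k), ?_⟩⟩, fun C hC => ⟨laxPoly Q k, ?_, ?_, ?_⟩⟩
  · rintro ⟨C, hC⟩
    exact S.isRightFlatOn_of_lax h.holo_left h.holo_right hO hs ht h.traceFree k
      fun A B y hy => ⟨_, hC A B y ⟨hy, mem_univ _⟩⟩
  · rw [S.isLaxTuple_iff h.holo_left h.holo_right hO hs ht]
    exact fun A B y hy => S.mlieBracket_fieldV_of_rightFlat h.holo_left h.holo_right hO hs ht hp hq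
      h hf (affineModel k) A B hy
  · exact fun A B D x => totalDegree_laxPoly Q A B D x
  · exact fun A B D m => contMDiffOn_coeff_laxPoly Q A B D m
  · intro A B D x hx l
    rw [S.isLaxTuple_iff h.holo_left h.holo_right hO hs ht] at hC
    rw [eval_laxPoly]
    exact coeff_eq_of_mlieBracket Q (y := (x, l)) hx (hC A B (x, l) hx) D

end ParaconformalStructure

end

/-! ### Coordinates on the total space -/

section

open ParaconformalStructure

section General

variable {E' : Type*} [NormedAddCommGroup E'] [NormedSpace ℂ E']
    {H' : Type*} [TopologicalSpace H'] {I : ModelWithCorners ℂ E' H'}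
    {N : Type*} [TopologicalSpace N] [ChartedSpace H' N]
    {E'' : Type*} [NormedAddCommGroup E''] [NormedSpace ℂ E'']
    {H'' : Type*} [TopologicalSpace H''] {J : ModelWithCorners ℂ E'' H''}
    {N' : Type*} [TopologicalSpace N'] [ChartedSpace H'' N']
    {E₃ : Type*} [NormedAddCommGroup E₃] [NormedSpace ℂ E₃]
    {H₃ : Type*} [TopologicalSpace H₃] {K : ModelWithCorners ℂ E₃ H₃}
    {N₃ : Type*} [TopologicalSpace N₃] [ChartedSpace H₃ N₃]

/-- The chain rule at a point which is only propositionally equal to `f x`. -/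
lemma mfderiv_mfderiv_apply {f : N → N'} {g : N' → N₃} {x : N} {y : N'} (hy : f x = y)
    (hg : MDifferentiableAt J K g y) (hf : MDifferentiableAt I J f x) (v : TangentSpace I x) :
    mfderiv J K g y (mfderiv I J f x v) = mfderiv I K (g ∘ f) x v := by
  subst hy
  rw [mfderiv_comp x hg hf]; rfl

/-- Local inverses have invertible derivatives. -/
lemma isInvertible_mfderiv {f : N → N'} {g : N' → N} {z : N} (hf : MDifferentiableAt I J f z)
    (hg : MDifferentiableAt J I g (f z)) (hgf : ∀ᶠ w in 𝓝 z, g (f w) = w)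
    (hfg : ∀ᶠ w in 𝓝 (f z), f (g w) = w) : (mfderiv I J f z).IsInvertible := by
  refine ContinuousLinearMap.IsInvertible.of_inverse (g := mfderiv J I g (f z)) ?_ ?_
  · ext v
    refine (mfderiv_mfderiv_apply hgf.self_of_nhds hf hg v).trans ?_
    have h1 : f ∘ g =ᶠ[𝓝 (f z)] id := hfg
    exact (congrArg (fun L : E'' →L[ℂ] E'' => L v) h1.mfderiv_eq).trans
      (congrArg (fun L : E'' →L[ℂ] E'' => L v) mfderiv_id)
  · ext v
    refine (mfderiv_mfderiv_apply rfl hg hf v).trans ?_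
    have h1 : g ∘ f =ᶠ[𝓝 z] id := hgf
    exact (congrArg (fun L : E' →L[ℂ] E' => L v) h1.mfderiv_eq).trans
      (congrArg (fun L : E' →L[ℂ] E' => L v) mfderiv_id)

/-- The derivative of a map to `ℂ^q` is computed componentwise. -/
lemma mfderiv_pi_apply {ι : Type*} [Fintype ι] {f : N → ι → ℂ} {x : N}
    (hf : MDifferentiableAt I 𝓘(ℂ, ι → ℂ) f x) (v : TangentSpace I x) (i : ι) :
    (mfderiv I 𝓘(ℂ, ι → ℂ) f x v : ι → ℂ) i = mvfderiv I (fun y => f y i) x v := by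
  have h1 := mfderiv_mfderiv_apply (f := f)
    (g := (ContinuousLinearMap.proj i : (ι → ℂ) →L[ℂ] ℂ)) (K := 𝓘(ℂ, ℂ)) rfl
    (ContinuousLinearMap.differentiableAt _).mdifferentiableAt hf v
  have h2 : mfderiv 𝓘(ℂ, ι → ℂ) 𝓘(ℂ, ℂ) (ContinuousLinearMap.proj i : (ι → ℂ) →L[ℂ] ℂ) (f x) =
      (ContinuousLinearMap.proj i : (ι → ℂ) →L[ℂ] ℂ) := by
    rw [mfderiv_eq_fderiv, ContinuousLinearMap.fderiv]
  exact (congrArg (fun L : (ι → ℂ) →L[ℂ] ℂ => L (mfderiv I 𝓘(ℂ, ι → ℂ) f x v)) h2).symm.trans h1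

variable [I.Boundaryless] [CompleteSpace E'] [IsManifold I ω N]

/-- If the brackets of the fields `X A` lie in `D`, so do the brackets of their combinations. -/
lemma mlieBracket_sum_mem {ι : Type*} [Fintype ι] {X : ι → Π z : N, TangentSpace I z} {z : N}
    (D : Submodule ℂ (TangentSpace I z)) (hX : ∀ A, MDiffAt (T% (X A)) z) (hXD : ∀ A, X A z ∈ D)
    (hXX : ∀ A B, VectorField.mlieBracket I (X A) (X B) z ∈ D)
    {ξ η : Π z : N, TangentSpace I z} {f g : ι → N → ℂ} (hf : ∀ A, MDiffAt (f A) z)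
    (hg : ∀ A, MDiffAt (g A) z) (hξ : ∀ᶠ w in 𝓝 z, ξ w = ∑ A, f A w • X A w)
    (hη : ∀ᶠ w in 𝓝 z, η w = ∑ A, g A w • X A w) :
    VectorField.mlieBracket I ξ η z ∈ D := by
  classical
  have key : ∀ (Y : Π z : N, TangentSpace I z) (f : ι → N → ℂ), (∀ A, MDiffAt (f A) z) →
      (∀ A, VectorField.mlieBracket I (X A) Y z ∈ D) →
      VectorField.mlieBracket I (fun w => ∑ A, f A w • X A w) Y z ∈ D := by
    intro Y f hf hY
    have : ∀ s : Finset ι,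
        VectorField.mlieBracket I (fun w => ∑ A ∈ s, f A w • X A w) Y z ∈ D := by
      intro s
      induction s using Finset.induction with
      | empty =>
        have h0 : (fun w => ∑ A ∈ (∅ : Finset ι), f A w • X A w) =
            (0 : Π z : N, TangentSpace I z) := by funext w; simp
        rw [h0, VectorField.mlieBracket_zero_left]
        exact D.zero_mem
      | insert a s ha ih =>
        have h1 : (fun w => ∑ A ∈ insert a s, f A w • X A w) =
            f a • X a + fun w => ∑ A ∈ s, f A w • X A w := by
          funext w; simp [Finset.sum_insert ha]
        have h2 : MDiffAt (T% (fun w => ∑ A ∈ s, f A w • X A w)) z :=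
          MDifferentiableAt.sum_section fun A _ => (hf A).smul_section (hX A)
        rw [h1, VectorField.mlieBracket_add_left ((hf a).smul_section (hX a)) h2,
          VectorField.mlieBracket_smul_left (hf a) (hX a)]
        exact D.add_mem (D.add_mem (D.smul_mem _ (hXD a)) (D.smul_mem _ (hY a))) ih
    exact this Finset.univ
  rw [Filter.EventuallyEq.mlieBracket_vectorField_eq hξ hη]
  refine key _ f hf fun A => ?_
  rw [VectorField.mlieBracket_swap_apply]
  refine D.neg_mem (key _ g hg fun B => ?_)
  rw [VectorField.mlieBracket_swap_apply]
  exact D.neg_mem (hXX A B)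

end General

section BundleChart

variable {E : Type*} [NormedAddCommGroup E] [NormedSpace ℂ E] [FiniteDimensional ℂ E]
  [CompleteSpace E]
  {M : Type*} [TopologicalSpace M] [ChartedSpace E M] [IsManifold 𝓘(ℂ, E) ω M]
  {F : Type*} [NormedAddCommGroup F] [NormedSpace ℂ F] [FiniteDimensional ℂ F]
  {V : M → Type*} [TopologicalSpace (TotalSpace F V)]
  [∀ x, AddCommGroup (V x)] [∀ x, Module ℂ (V x)] [∀ x, TopologicalSpace (V x)]
  [∀ x, IsTopologicalAddGroup (V x)] [∀ x, ContinuousSMul ℂ (V x)]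
  [FiberBundle F V] [VectorBundle ℂ F V] [ContMDiffVectorBundle ω F V 𝓘(ℂ, E)]
  {nabla : CovariantDerivative 𝓘(ℂ, E) F V} {q : ℕ}
  {O : Set M} {t : Fin q → Π y : M, V y}

/-- The coordinates `(x, π)` on the total space given by a frame. -/
def bundleChart (ht : IsLocalFrameOn 𝓘(ℂ, E) F ω t O) (z : TotalSpace F V) : M × (Fin q → ℂ) :=
  (z.proj, fun i => ht.coeff i z.proj z.2)

variable (F) in
/-- The point `∑ πⁱ tᵢ(x)` of the total space. -/
def bundleChartSymm (t : Fin q → Π y : M, V y) (y : M × (Fin q → ℂ)) : TotalSpace F V :=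
  ⟨y.1, ∑ i, y.2 i • t i y.1⟩

variable (hO : IsOpen O) (ht : IsLocalFrameOn 𝓘(ℂ, E) F ω t O)

lemma bundleChart_symm {y : M × (Fin q → ℂ)} (hy : y.1 ∈ O) :
    bundleChart ht (bundleChartSymm F t y) = y :=
  Prod.ext rfl (funext fun i => frame_coeff_sum ht hy y.2 i)

lemma bundleChartSymm_chart {z : TotalSpace F V} (hz : z.proj ∈ O) :
    bundleChartSymm F t (bundleChart ht z) = z := by
  obtain ⟨x, v⟩ := z
  exact congrArg (TotalSpace.mk x) (frame_sum_coeff ht hz v)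

include hO

lemma contMDiffAt_bundleChart {z : TotalSpace F V} (hz : z.proj ∈ O) :
    ContMDiffAt (𝓘(ℂ, E).prod 𝓘(ℂ, F)) (𝓘(ℂ, E).prod 𝓘(ℂ, Fin q → ℂ)) ω (bundleChart ht) z := by
  refine ContMDiffAt.prodMk (contMDiff_proj V).contMDiffAt (contMDiffAt_pi_space.2 fun i => ?_)
  exact contMDiffAt_frameCoeff (J := 𝓘(ℂ, E).prod 𝓘(ℂ, F)) ht hO (b := fun z : TotalSpace F V => z.proj)
    (t := fun z => z.2) hz contMDiffAt_id i

include ht in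
lemma contMDiffAt_bundleChartSymm {y : M × (Fin q → ℂ)} (hy : y.1 ∈ O) :
    ContMDiffAt (𝓘(ℂ, E).prod 𝓘(ℂ, Fin q → ℂ)) (𝓘(ℂ, E).prod 𝓘(ℂ, F)) ω
      (bundleChartSymm F t) y := by
  rw [Bundle.contMDiffAt_totalSpace]
  refine ⟨contMDiffAt_fst, ?_⟩
  let e := trivializationAt F V y.1
  have he : y.1 ∈ e.baseSet := FiberBundle.mem_baseSet_trivializationAt F V y.1
  have h1 : ∀ i, CMDiffAt ω (fun x => (e ⟨x, t i x⟩).2) y.1 := fun i =>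
    (Bundle.contMDiffAt_section _).1 (ht.contMDiffAt hO hy i)
  have h2 : ContMDiffAt (𝓘(ℂ, E).prod 𝓘(ℂ, Fin q → ℂ)) 𝓘(ℂ, F) ω
      (fun z : M × (Fin q → ℂ) => ∑ i, z.2 i • (e ⟨z.1, t i z.1⟩).2) y := by
    refine contMDiffAt_finsetSum fun i _ => ?_
    have h4 : ContMDiffAt (𝓘(ℂ, E).prod 𝓘(ℂ, Fin q → ℂ)) 𝓘(ℂ, ℂ) ω
        (fun z : M × (Fin q → ℂ) => z.2 i) y := (contMDiffAt_pi_space.1 contMDiffAt_snd) i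
    exact h4.smul ((h1 i).comp y contMDiffAt_fst)
  refine h2.congr_of_eventuallyEq ?_
  filter_upwards [continuous_fst.continuousAt (e.open_baseSet.mem_nhds he)] with z hz
  have hz' : z.1 ∈ e.baseSet := hz
  have h3 : e.linearMapAt ℂ z.1 (∑ i, z.2 i • t i z.1) =
      ∑ i, z.2 i • e.linearMapAt ℂ z.1 (t i z.1) := by
    rw [map_sum]
    exact Finset.sum_congr rfl fun i _ => map_smul _ _ _
  simp only [e.linearMapAt_apply, if_pos hz'] at h3
  exact h3

lemma eventually_proj_mem {z : TotalSpace F V} (hz : z.proj ∈ O) : ∀ᶠ w in 𝓝 z, w.proj ∈ O :=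
  (FiberBundle.continuous_proj F V).continuousAt (hO.mem_nhds hz)

lemma isInvertible_mfderiv_bundleChart {z : TotalSpace F V} (hz : z.proj ∈ O) :
    (mfderiv (𝓘(ℂ, E).prod 𝓘(ℂ, F)) (𝓘(ℂ, E).prod 𝓘(ℂ, Fin q → ℂ)) (bundleChart ht)
      z).IsInvertible := by
  refine isInvertible_mfderiv (g := bundleChartSymm F t)
    ((contMDiffAt_bundleChart hO ht hz).mdifferentiableAt (by simp))
    ((contMDiffAt_bundleChartSymm hO ht hz).mdifferentiableAt (by simp)) ?_ ?_
  · filter_upwards [eventually_proj_mem hO hz] with w hw using bundleChartSymm_chart ht hw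
  · filter_upwards [continuous_fst.continuousAt (hO.mem_nhds (show (bundleChart ht z).1 ∈ O from hz))]
      with w hw using bundleChart_symm ht hw

/-- Vertical vectors in the coordinates given by a frame. -/
lemma mfderiv_bundleChart_vertical {z : TotalSpace F V} (hz : z.proj ∈ O) (w : V z.proj) :
    mfderiv (𝓘(ℂ, E).prod 𝓘(ℂ, F)) (𝓘(ℂ, E).prod 𝓘(ℂ, Fin q → ℂ)) (bundleChart ht) z
      (vertical z w) = ((0 : E), fun i => ht.coeff i z.proj w) := by
  let c : ℂ → M × (Fin q → ℂ) := fun τ =>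
    (z.proj, (fun i => ht.coeff i z.proj z.2) + τ • fun i => ht.coeff i z.proj w)
  have hc2 : HasFDerivAt (fun τ : ℂ => (fun i => ht.coeff i z.proj z.2) +
      τ • fun i => ht.coeff i z.proj w)
      ((ContinuousLinearMap.id ℂ ℂ).smulRight fun i => ht.coeff i z.proj w) 0 :=
    ((hasFDerivAt_id (0 : ℂ)).smul_const _).const_add _
  have hc : HasMFDerivAt 𝓘(ℂ, ℂ) (𝓘(ℂ, E).prod 𝓘(ℂ, Fin q → ℂ)) c 0
      ((0 : ℂ →L[ℂ] E).prod ((ContinuousLinearMap.id ℂ ℂ).smulRight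
        fun i => ht.coeff i z.proj w)) :=
    HasMFDerivAt.prodMk (hasMFDerivAt_const z.proj (0 : ℂ)) hc2.hasMFDerivAt
  have hcz : ∀ τ : ℂ, (⟨z.proj, z.snd + τ • w⟩ : TotalSpace F V) = bundleChartSymm F t (c τ) := by
    intro τ
    refine congrArg (TotalSpace.mk z.proj) ?_
    conv_lhs => rw [← frame_sum_coeff ht hz (z.snd + τ • w)]
    simp [c]
  have hm : MDifferentiableAt 𝓘(ℂ, ℂ) (𝓘(ℂ, E).prod 𝓘(ℂ, F))
      (fun τ : ℂ => (⟨z.proj, z.snd + τ • w⟩ : TotalSpace F V)) 0 := by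
    rw [funext hcz]
    have h5 : MDifferentiableAt (𝓘(ℂ, E).prod 𝓘(ℂ, Fin q → ℂ)) (𝓘(ℂ, E).prod 𝓘(ℂ, F))
        (bundleChartSymm F t) (c 0) :=
      (contMDiffAt_bundleChartSymm hO ht (y := c 0) hz).mdifferentiableAt (by simp)
    exact h5.comp (0 : ℂ) hc.mdifferentiableAt
  have h4 : (⟨z.proj, z.snd + (0 : ℂ) • w⟩ : TotalSpace F V) = z := by simp
  have hΦ := (contMDiffAt_bundleChart hO ht hz).mdifferentiableAt (n := ω) (by simp)
  refine (mfderiv_mfderiv_apply (f := fun τ : ℂ => (⟨z.proj, z.snd + τ • w⟩ : TotalSpace F V))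
    h4 hΦ hm (1 : ℂ)).trans ?_
  have h3 : bundleChart ht ∘ (fun τ : ℂ => (⟨z.proj, z.snd + τ • w⟩ : TotalSpace F V)) = c := by
    funext τ
    rw [Function.comp_apply, hcz, bundleChart_symm ht hz]
  rw [h3]
  refine (congrArg (fun L : ℂ →L[ℂ] E × (Fin q → ℂ) => L 1) hc.mfderiv).trans ?_
  refine Prod.ext rfl (funext fun i => ?_)
  change (1 : ℂ) * ht.coeff i z.proj w = _
  rw [one_mul]

/-- Horizontal lifts in the coordinates given by a frame. -/
lemma mfderiv_bundleChart_horizontalLift {z : TotalSpace F V} (hz : z.proj ∈ O)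
    (X : TangentSpace 𝓘(ℂ, E) z.proj) :
    mfderiv (𝓘(ℂ, E).prod 𝓘(ℂ, F)) (𝓘(ℂ, E).prod 𝓘(ℂ, Fin q → ℂ)) (bundleChart ht) z
      (horizontalLift nabla z X) =
      ((X : E), fun i => - ∑ j, ht.coeff i z.proj (nabla (t j) z.proj X) *
        ht.coeff j z.proj z.2) := by
  let s : Π y : M, V y := FiberBundle.extend F z.snd
  have hs : CMDiffAt ω (T% s) z.proj := FiberBundle.contMDiffAt_extend 𝓘(ℂ, E) F z.snd
  have hsz : s z.proj = z.2 := FiberBundle.extend_apply_self F z.2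
  have hc : ∀ i, CMDiffAt ω (fun y => ht.coeff i y (s y)) z.proj := fun i =>
    contMDiffAt_frameCoeff (J := 𝓘(ℂ, E)) ht hO (b := fun x : M => x) hz hs i
  have ht' : ∀ i, MDiffAt (T% (t i)) z.proj := fun i =>
    (ht.contMDiffAt hO hz i).mdifferentiableAt (by simp)
  have hv := mfderiv_bundleChart_vertical hO ht hz (nabla s z.proj X)
  have hds : mfderiv (𝓘(ℂ, E).prod 𝓘(ℂ, F)) (𝓘(ℂ, E).prod 𝓘(ℂ, Fin q → ℂ)) (bundleChart ht) z
      (mfderiv 𝓘(ℂ, E) (𝓘(ℂ, E).prod 𝓘(ℂ, F)) (T% s) z.proj X) =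
      ((X : E), fun i => mvfderiv 𝓘(ℂ, E) (fun y => ht.coeff i y (s y)) z.proj X) := by
    have h4 : (⟨z.proj, s z.proj⟩ : TotalSpace F V) = z := by rw [hsz]
    have hΦ := (contMDiffAt_bundleChart hO ht hz).mdifferentiableAt (n := ω) (by simp)
    have hs' := hs.mdifferentiableAt (n := ω) (by simp)
    refine (mfderiv_mfderiv_apply (f := T% s) h4 hΦ hs' X).trans ?_
    have hm : MDifferentiableAt 𝓘(ℂ, E) 𝓘(ℂ, Fin q → ℂ) (fun y i => ht.coeff i y (s y)) z.proj :=
      (contMDiffAt_pi_space.2 hc).mdifferentiableAt (by simp)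
    have h1 := mfderiv_prodMk (mdifferentiableAt_id (I := 𝓘(ℂ, E)) (x := z.proj)) hm
    refine (congrArg (fun L : E →L[ℂ] E × (Fin q → ℂ) => L X) h1).trans ?_
    refine Prod.ext ?_ (funext fun i => ?_)
    · exact congrArg (fun L : E →L[ℂ] E => L X) mfderiv_id
    · exact mfderiv_pi_apply hm X i
  have hns : nabla s z.proj X = ∑ j, (ht.coeff j z.proj z.2 • nabla (t j) z.proj X +
      mvfderiv 𝓘(ℂ, E) (fun y => ht.coeff j y (s y)) z.proj X • t j z.proj) := by
    have h1 : MDiffAt (T% (fun y => ∑ j, ht.coeff j y (s y) • t j y)) z.proj :=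
      MDifferentiableAt.sum_section fun i _ =>
        ((hc i).mdifferentiableAt (by simp)).smul_section (ht' i)
    rw [covDeriv_congr nabla (hs.mdifferentiableAt (by simp)) h1
      (ht.eventually_eq_sum_coeff_smul s (hO.mem_nhds hz)),
      covDeriv_sum_smul nabla (fun i => (hc i).mdifferentiableAt (by simp)) ht', hsz]
  refine (map_sub (mfderiv (𝓘(ℂ, E).prod 𝓘(ℂ, F)) (𝓘(ℂ, E).prod 𝓘(ℂ, Fin q → ℂ))
    (bundleChart ht) z) _ _).trans ?_
  refine (congrArg₂ (fun a b : E × (Fin q → ℂ) => a - b) hds hv).trans ?_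
  refine Prod.ext (sub_zero (X : E)) (funext fun i => ?_)
  change mvfderiv 𝓘(ℂ, E) (fun y => ht.coeff i y (s y)) z.proj X -
    ht.coeff i z.proj (nabla s z.proj X) = _
  rw [hns, Finset.sum_add_distrib, map_add, frame_coeff_sum ht hz, map_sum]
  simp only [map_smul, smul_eq_mul]
  rw [sub_add_cancel_right]
  simp only [mul_comm]

end BundleChart

end

/-! ### Involutivity on the total space -/

section

open ParaconformalStructure

section Span

variable {E : Type*} [NormedAddCommGroup E] [NormedSpace ℂ E] [FiniteDimensional ℂ E]
    [CompleteSpace E]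
    {M : Type*} [TopologicalSpace M] [ChartedSpace E M] [IsManifold 𝓘(ℂ, E) ω M]
    {p q : ℕ} {O : Set M} (Q : FrameData E p q O)
    {E' : Type*} [NormedAddCommGroup E'] [NormedSpace ℂ E'] [CompleteSpace E']
    {H' : Type*} [TopologicalSpace H'] {I : ModelWithCorners ℂ E' H'} [I.Boundaryless]
    {N : Type*} [TopologicalSpace N] [ChartedSpace H' N] [IsManifold I ω N]
    {pr : N → M} (hpr : ContMDiff I 𝓘(ℂ, E) ω pr)
    {X : Fin p → Π z : N, TangentSpace I z} {μ : Fin q → N → ℂ} {k : Fin q} {z : N}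

include hpr in
/-- Where the projections to `M` of the fields `X A` are `∑ i, μᵢ e_{Ai}` with `μ_k ≠ 0`, a
holomorphic vector field with values in their span is a combination of them with holomorphic
coefficients. -/
lemma exists_coeff_of_mem_span (hz : pr z ∈ O)
    (hX : ∀ᶠ w in 𝓝 z, ∀ A, mfderiv I 𝓘(ℂ, E) pr w (X A w) = ∑ i, μ i w • Q.e (A, i) (pr w))
    (hμ : ContMDiffAt I 𝓘(ℂ, ℂ) ω (μ k) z) (hμ0 : μ k z ≠ 0)
    {ξ : Π z : N, TangentSpace I z} (hξ : CMDiffAt ω (T% ξ) z)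
    (hD : ∀ᶠ w in 𝓝 z, ξ w ∈ Submodule.span ℂ (range fun A => X A w)) :
    ∃ f : Fin p → N → ℂ, (∀ A, ContMDiffAt I 𝓘(ℂ, ℂ) ω (f A) z) ∧
      ∀ᶠ w in 𝓝 z, ξ w = ∑ A, f A w • X A w := by
  have h1 : ContMDiffAt I (𝓘(ℂ, E).prod 𝓘(ℂ, E)) ω
      (fun w => (TotalSpace.mk' E (pr w) (mfderiv I 𝓘(ℂ, E) pr w (ξ w)) : TangentBundle 𝓘(ℂ, E) M))
      z := by
    have h2 : ContMDiff I.tangent 𝓘(ℂ, E).tangent ω (tangentMap I 𝓘(ℂ, E) pr) :=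
      hpr.contMDiff_tangentMap (m := ω) le_top
    exact (h2 ⟨z, ξ z⟩).comp z hξ
  refine ⟨fun A w => Q.frame.coeff (A, k) (pr w) (mfderiv I 𝓘(ℂ, E) pr w (ξ w)) * (μ k w)⁻¹,
    fun A => ?_, ?_⟩
  · exact (contMDiffAt_frameCoeff Q.frame Q.isOpen hz h1 (A, k)).mul
      (((contDiffAt_inv ℂ hμ0).contMDiffAt).comp z hμ)
  · filter_upwards [hX, hD, hμ.continuousAt.eventually_ne hμ0,
      hpr.continuous.continuousAt (Q.isOpen.mem_nhds hz)] with w hX hD hμ0 hw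
    obtain ⟨c, hc⟩ := (Submodule.mem_span_range_iff_exists_fun ℂ).1 hD
    have h3 : mfderiv I 𝓘(ℂ, E) pr w (ξ w) =
        ∑ a : Fin p × Fin q, (c a.1 * μ a.2 w) • Q.e a (pr w) := by
      rw [← hc, map_sum, Fintype.sum_prod_type]
      refine Finset.sum_congr rfl fun A _ => ?_
      rw [map_smul, hX, Finset.smul_sum]
      exact Finset.sum_congr rfl fun i _ => smul_smul _ _ _
    rw [← hc] at h3 ⊢
    refine Finset.sum_congr rfl fun A _ => ?_
    rw [h3, frame_coeff_sum Q.frame hw (fun a : Fin p × Fin q => c a.1 * μ a.2 w),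
      mul_inv_cancel_right₀ hμ0]

include hpr in
/-- In this situation, the span is closed under brackets at `z` if it contains the brackets
`[X A, X B]`. -/
lemma mlieBracket_mem_span (hz : pr z ∈ O)
    (hX : ∀ᶠ w in 𝓝 z, ∀ A, mfderiv I 𝓘(ℂ, E) pr w (X A w) = ∑ i, μ i w • Q.e (A, i) (pr w))
    (hμ : ContMDiffAt I 𝓘(ℂ, ℂ) ω (μ k) z) (hμ0 : μ k z ≠ 0)
    (hXm : ∀ A, MDiffAt (T% (X A)) z)
    (hXX : ∀ A B, VectorField.mlieBracket I (X A) (X B) z ∈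
      Submodule.span ℂ (range fun A => X A z))
    {ξ η : Π z : N, TangentSpace I z} (hξ : CMDiffAt ω (T% ξ) z) (hη : CMDiffAt ω (T% η) z)
    (hξD : ∀ᶠ w in 𝓝 z, ξ w ∈ Submodule.span ℂ (range fun A => X A w))
    (hηD : ∀ᶠ w in 𝓝 z, η w ∈ Submodule.span ℂ (range fun A => X A w)) :
    VectorField.mlieBracket I ξ η z ∈ Submodule.span ℂ (range fun A => X A z) := by
  obtain ⟨f, hf, hξf⟩ := exists_coeff_of_mem_span Q hpr hz hX hμ hμ0 hξ hξD
  obtain ⟨g, hg, hηg⟩ := exists_coeff_of_mem_span Q hpr hz hX hμ hμ0 hη hηD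
  exact mlieBracket_sum_mem (Submodule.span ℂ (range fun A => X A z)) hXm (fun A => Submodule.subset_span ⟨A, rfl⟩) hXX
    (fun A => (hf A).mdifferentiableAt (by simp)) (fun A => (hg A).mdifferentiableAt (by simp))
    hξf hηg

end Span

variable {E : Type*} [NormedAddCommGroup E] [NormedSpace ℂ E] [FiniteDimensional ℂ E]
  [CompleteSpace E]
  {M : Type*} [TopologicalSpace M] [ChartedSpace E M] [IsManifold 𝓘(ℂ, E) ω M]
  {p q : ℕ} {O : Set M}
  {F₁ : Type*} [NormedAddCommGroup F₁] [NormedSpace ℂ F₁] [FiniteDimensional ℂ F₁]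
  {U : M → Type*} [TopologicalSpace (TotalSpace F₁ U)]
  [∀ x, AddCommGroup (U x)] [∀ x, Module ℂ (U x)] [∀ x, TopologicalSpace (U x)]
  [∀ x, IsTopologicalAddGroup (U x)] [∀ x, ContinuousSMul ℂ (U x)]
  [FiberBundle F₁ U] [VectorBundle ℂ F₁ U] [ContMDiffVectorBundle ω F₁ U 𝓘(ℂ, E)]
  {F₂ : Type*} [NormedAddCommGroup F₂] [NormedSpace ℂ F₂] [FiniteDimensional ℂ F₂]
  {V : M → Type*} [TopologicalSpace (TotalSpace F₂ V)]
  [∀ x, AddCommGroup (V x)] [∀ x, Module ℂ (V x)] [∀ x, TopologicalSpace (V x)]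
  [∀ x, IsTopologicalAddGroup (V x)] [∀ x, ContinuousSMul ℂ (V x)]
  [FiberBundle F₂ V] [VectorBundle ℂ F₂ V] [ContMDiffVectorBundle ω F₂ V 𝓘(ℂ, E)]
  {S : ParaconformalStructure E F₁ U F₂ V p q}
  {nablaU : CovariantDerivative 𝓘(ℂ, E) F₁ U} {nablaV : CovariantDerivative 𝓘(ℂ, E) F₂ V}
  {ε : Scale E F₁ U p}

namespace ParaconformalStructure

variable {s : Fin p → Π y : M, U y} {t : Fin q → Π y : M, V y}

section Frames

variable (S) (hU : IsHolomorphicConnection nablaU) (hV : IsHolomorphicConnection nablaV)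
  (hO : IsOpen O) (hs : IsLocalFrameOn 𝓘(ℂ, E) F₁ ω s O) (ht : IsLocalFrameOn 𝓘(ℂ, E) F₂ ω t O)

local notation "𝒬" => frameData S hU hV hO hs ht

/-- The fields `v_u` in the coordinates given by frames. -/
lemma mfderiv_bundleChart_twistorField {z : TotalSpace F₂ V} (hz : z.proj ∈ O)
    (u : Π y : M, U y) :
    mfderiv (𝓘(ℂ, E).prod 𝓘(ℂ, F₂)) (𝓘(ℂ, E).prod 𝓘(ℂ, Fin q → ℂ)) (bundleChart ht) z
      (S.twistorField nablaV u z) =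
      ∑ A, hs.coeff A z.proj (u z.proj) • (𝒬).fieldV (coneModel q) A (bundleChart ht z) := by
  have hX : (S.iso z.proj).symm (u z.proj ⊗ₜ z.snd) = ∑ A, hs.coeff A z.proj (u z.proj) •
      ∑ j, ht.coeff j z.proj z.2 • S.tmul (s A) (t j) z.proj := by
    conv_lhs => rw [← frame_sum_coeff hs hz (u z.proj), ← frame_sum_coeff ht hz z.snd]
    simp only [sum_tmul, ← smul_tmul', map_sum, map_smul, tmul_sum, tmul_smul, tmul,
      Finset.smul_sum]
    rw [Finset.sum_comm]
    exact Finset.sum_congr rfl fun A _ => Finset.sum_congr rfl fun j _ => smul_comm _ _ _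
  refine (mfderiv_bundleChart_horizontalLift hO ht hz _).trans ?_
  refine Prod.ext (α := E) (β := Fin q → ℂ) ?_ ?_
  · refine hX.trans ?_
    refine Eq.trans ?_ (map_sum (ContinuousLinearMap.fst ℂ E (Fin q → ℂ)) _ _).symm
    exact Finset.sum_congr rfl fun A _ => congrArg (hs.coeff A z.proj (u z.proj) • ·)
      ((𝒬).fst_fieldV (coneModel q) A (bundleChart ht z)).symm
  · refine Eq.trans ?_ (map_sum (ContinuousLinearMap.snd ℂ E (Fin q → ℂ)) _ _).symm
    have h1 : ∀ A, (ContinuousLinearMap.snd ℂ E (Fin q → ℂ)) (hs.coeff A z.proj (u z.proj) •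
        (𝒬).fieldV (coneModel q) A (bundleChart ht z)) = hs.coeff A z.proj (u z.proj) •
        -∑ i, ht.coeff i z.proj z.2 • ∑ j, (𝒬).gl (coneModel q) (A, i) j (bundleChart ht z) •
          Pi.single j (1 : ℂ) := fun A => congrArg (hs.coeff A z.proj (u z.proj) • ·)
      ((𝒬).snd_fieldV (coneModel q) A (bundleChart ht z))
    refine Eq.trans ?_ (Finset.sum_congr rfl fun A _ => (h1 A).symm)
    funext i
    have h2 : ∀ j, ht.coeff i z.proj (nablaV (t j) z.proj
        ((S.iso z.proj).symm (u z.proj ⊗ₜ z.snd))) = ∑ A, ∑ k, hs.coeff A z.proj (u z.proj) *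
          (ht.coeff k z.proj z.2 * (𝒬).γ (A, k) i j z.proj) := by
      intro j
      rw [hX]
      simp only [map_sum, map_smul, smul_eq_mul, Finset.mul_sum]
      rfl
    simp only [h2, Finset.sum_apply, Pi.smul_apply, Pi.neg_apply, smul_eq_mul, Pi.single_apply,
      mul_ite, mul_one, mul_zero, Finset.sum_ite_eq, Finset.mem_univ, if_true, FrameData.gl,
      mul_neg, Finset.sum_neg_distrib, Finset.mul_sum, Finset.sum_mul]
    congr 1
    rw [Finset.sum_comm]
    refine Finset.sum_congr rfl fun A _ => ?_
    rw [Finset.sum_comm]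
    refine Finset.sum_congr rfl fun k _ => Finset.sum_congr rfl fun j _ => ?_
    simp only [coneModel, bundleChart]
    ring

lemma mfderiv_bundleChart_twistorField_frame {z : TotalSpace F₂ V} (hz : z.proj ∈ O)
    (A : Fin p) :
    mfderiv (𝓘(ℂ, E).prod 𝓘(ℂ, F₂)) (𝓘(ℂ, E).prod 𝓘(ℂ, Fin q → ℂ)) (bundleChart ht) z
      (S.twistorField nablaV (s A) z) =
      (𝒬).fieldV (coneModel q) A (bundleChart ht z) := by
  classical
  rw [S.mfderiv_bundleChart_twistorField hU hV hO hs ht hz, Finset.sum_eq_single A]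
  · rw [frame_coeff_self hs hz, if_pos rfl, one_smul]
  · intro B _ hB
    rw [frame_coeff_self hs hz, if_neg hB, zero_smul]
  · simp

include hU hV hO hs ht

lemma mpullback_fieldV {z : TotalSpace F₂ V} (hz : z.proj ∈ O) (A : Fin p) :
    VectorField.mpullback (𝓘(ℂ, E).prod 𝓘(ℂ, F₂)) (𝓘(ℂ, E).prod 𝓘(ℂ, Fin q → ℂ)) (bundleChart ht)
      ((𝒬).fieldV (coneModel q) A) z = S.twistorField nablaV (s A) z := by
  rw [VectorField.mpullback_apply,
    ← S.mfderiv_bundleChart_twistorField_frame hU hV hO hs ht hz]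
  exact (isInvertible_mfderiv_bundleChart hO ht hz).inverse_apply_self _

lemma contMDiffAt_twistorField {z : TotalSpace F₂ V} (hz : z.proj ∈ O) (A : Fin p) :
    CMDiffAt ω (T% (S.twistorField nablaV (s A))) z := by
  have h1 : IsManifold (𝓘(ℂ, E).prod 𝓘(ℂ, F₂)) 1 (TotalSpace F₂ V) := .of_le (n := ω) le_top
  have h2 : IsManifold (𝓘(ℂ, E).prod 𝓘(ℂ, Fin q → ℂ)) 1 (M × (Fin q → ℂ)) := .of_le (n := ω) le_top
  have h3 := ContMDiffAt.mpullback_vectorField_preimage (f := bundleChart ht) (x₀ := z) (m := ω)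
    (n := ω) ((𝒬).contMDiffAt_fieldV (coneModel q) A (y := bundleChart ht z) hz)
    (contMDiffAt_bundleChart hO ht hz) (isInvertible_mfderiv_bundleChart hO ht hz) le_top
  refine h3.congr_of_eventuallyEq ?_
  filter_upwards [eventually_proj_mem hO hz] with w hw
  rw [S.mpullback_fieldV hU hV hO hs ht hw]

/-- The bracket of the fields `v_A` in the coordinates given by frames. -/
lemma mfderiv_bundleChart_mlieBracket {z : TotalSpace F₂ V} (hz : z.proj ∈ O) (A B : Fin p) :
    mfderiv (𝓘(ℂ, E).prod 𝓘(ℂ, F₂)) (𝓘(ℂ, E).prod 𝓘(ℂ, Fin q → ℂ)) (bundleChart ht) z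
      (VectorField.mlieBracket (𝓘(ℂ, E).prod 𝓘(ℂ, F₂)) (S.twistorField nablaV (s A))
        (S.twistorField nablaV (s B)) z) =
      VectorField.mlieBracket (𝓘(ℂ, E).prod 𝓘(ℂ, Fin q → ℂ)) ((𝒬).fieldV (coneModel q) A)
        ((𝒬).fieldV (coneModel q) B) (bundleChart ht z) := by
  have h1 : IsManifold (𝓘(ℂ, E).prod 𝓘(ℂ, F₂)) (minSmoothness ℂ 3) (TotalSpace F₂ V) :=
    .of_le (n := ω) le_top
  have h2 : IsManifold (𝓘(ℂ, E).prod 𝓘(ℂ, Fin q → ℂ)) (minSmoothness ℂ 3) (M × (Fin q → ℂ)) :=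
    .of_le (n := ω) le_top
  have hev : ∀ A, S.twistorField nablaV (s A) =ᶠ[𝓝 z]
      VectorField.mpullback (𝓘(ℂ, E).prod 𝓘(ℂ, F₂)) (𝓘(ℂ, E).prod 𝓘(ℂ, Fin q → ℂ)) (bundleChart ht)
        ((𝒬).fieldV (coneModel q) A) := by
    intro A
    filter_upwards [eventually_proj_mem hO hz] with w hw
    rw [S.mpullback_fieldV hU hV hO hs ht hw]
  rw [Filter.EventuallyEq.mlieBracket_vectorField_eq (hev A) (hev B),
    ← VectorField.mpullback_mlieBracket (n := ω)
      (((𝒬).contMDiffAt_fieldV (coneModel q) A (y := bundleChart ht z) hz).mdifferentiableAt (by simp))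
      (((𝒬).contMDiffAt_fieldV (coneModel q) B (y := bundleChart ht z) hz).mdifferentiableAt (by simp))
      (contMDiffAt_bundleChart hO ht hz) le_top, VectorField.mpullback_apply]
  exact (isInvertible_mfderiv_bundleChart hO ht hz).self_apply_inverse _

lemma distribution_eq_span {z : TotalSpace F₂ V} (hz : z.proj ∈ O) :
    S.distribution nablaV z =
      Submodule.span ℂ (range fun A => S.twistorField nablaV (s A) z) := by
  refine le_antisymm (Submodule.span_le.2 ?_) (Submodule.span_mono ?_)
  · rintro _ ⟨u, rfl⟩
    have h1 : S.twistorField nablaV u z =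
        ∑ A, hs.coeff A z.proj (u z.proj) • S.twistorField nablaV (s A) z := by
      apply (isInvertible_mfderiv_bundleChart hO ht hz).injective
      rw [S.mfderiv_bundleChart_twistorField hU hV hO hs ht hz, map_sum]
      refine Finset.sum_congr rfl fun A _ => ?_
      rw [map_smul, S.mfderiv_bundleChart_twistorField_frame hU hV hO hs ht hz]
    change S.twistorField nablaV u z ∈ _
    rw [h1]
    exact Submodule.sum_mem _ fun A _ => Submodule.smul_mem _ _ (Submodule.subset_span ⟨A, rfl⟩)
  · rintro _ ⟨A, rfl⟩
    exact ⟨s A, rfl⟩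

lemma mfderiv_proj_twistorField {z : TotalSpace F₂ V} (hz : z.proj ∈ O) (A : Fin p) :
    mfderiv (𝓘(ℂ, E).prod 𝓘(ℂ, F₂)) 𝓘(ℂ, E) (fun z : TotalSpace F₂ V => z.proj) z
      (S.twistorField nablaV (s A) z) =
      ∑ i, ht.coeff i z.proj z.2 • (𝒬).e (A, i) z.proj := by
  have h1 := mfderiv_mfderiv_apply (f := bundleChart ht) (g := (Prod.fst : M × (Fin q → ℂ) → M))
    (K := 𝓘(ℂ, E)) rfl mdifferentiableAt_fst
    ((contMDiffAt_bundleChart hO ht hz).mdifferentiableAt (by simp)) (S.twistorField nablaV (s A) z)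
  refine h1.symm.trans ?_
  rw [S.mfderiv_bundleChart_twistorField_frame hU hV hO hs ht hz]
  refine (congrArg (fun L : E × (Fin q → ℂ) →L[ℂ] E => L ((𝒬).fieldV (coneModel q) A
    (bundleChart ht z))) (mfderiv_fst (I := 𝓘(ℂ, E)) (I' := 𝓘(ℂ, Fin q → ℂ))
      (x := bundleChart ht z))).trans ?_
  exact (𝒬).fst_fieldV (coneModel q) A (bundleChart ht z)

lemma distribution_eq_bot {z : TotalSpace F₂ V} (hz : z.proj ∈ O) (h0 : z.2 = 0) :
    S.distribution nablaV z = ⊥ := by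
  rw [S.distribution_eq_span hU hV hO hs ht hz, Submodule.span_eq_bot]
  rintro _ ⟨A, rfl⟩
  apply (isInvertible_mfderiv_bundleChart hO ht hz).injective
  change mfderiv (𝓘(ℂ, E).prod 𝓘(ℂ, F₂)) (𝓘(ℂ, E).prod 𝓘(ℂ, Fin q → ℂ)) (bundleChart ht) z
    (S.twistorField nablaV (s A) z) = _
  rw [S.mfderiv_bundleChart_twistorField_frame hU hV hO hs ht hz, map_zero]
  refine Finset.sum_eq_zero fun i _ => ?_
  have : (coneModel q).lam i (bundleChart ht z).2 = 0 := by
    simp [coneModel, bundleChart, h0]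
  rw [this, zero_smul]

end Frames

/-- The twistor distribution on the total space of `V` is involutive exactly for right-flat
structures. -/
theorem IsScaleConnection.isInvolutiveOn_iff (hp : 2 ≤ p) (hq : 2 ≤ q)
    (h : S.IsScaleConnection nablaU nablaV ε) :
    IsInvolutiveOn (𝓘(ℂ, E).prod 𝓘(ℂ, F₂)) (S.distribution nablaV) univ ↔
      S.IsRightFlat nablaU nablaV := by
  have hU := h.holo_left
  have hV := h.holo_right
  constructor
  · intro hD x _
    obtain ⟨O₁, s, hO₁, hx₁, hs₁⟩ := exists_localFrame (E := E) (F := F₁) (W := U) S.rank_left x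
    obtain ⟨O₂, t, hO₂, hx₂, ht₂⟩ := exists_localFrame (E := E) (F := F₂) (W := V) S.rank_right x
    have hO := hO₁.inter hO₂
    have hs := hs₁.mono (inter_subset_left (t := O₂))
    have ht := ht₂.mono (inter_subset_right (s := O₁))
    have hop : IsOpen {z : TotalSpace F₂ V | z.proj ∈ O₁ ∩ O₂} :=
      hO.preimage (FiberBundle.continuous_proj F₂ V)
    have key : ∀ A B, ∀ y ∈ O₁ ∩ O₂, ∀ l : Fin q → ℂ, ∃ c : Fin p → ℂ,
        (∀ d, (S.frameData hU hV hO hs ht).Tlam (coneModel q) A B d (y, l) = c d.1 * l d.2) ∧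
        ∀ i, (S.frameData hU hV hO hs ht).r (coneModel q) A B i (y, l) = 0 := by
      intro A B y hy l
      let z := bundleChartSymm F₂ t (y, l)
      have hz : z.proj ∈ O₁ ∩ O₂ := hy
      have h1 := hD _ hop (subset_univ _) (S.twistorField nablaV (s A)) (S.twistorField nablaV (s B))
        (fun z hz => (S.contMDiffAt_twistorField hU hV hO hs ht hz A).contMDiffWithinAt)
        (fun z hz => (S.contMDiffAt_twistorField hU hV hO hs ht hz B).contMDiffWithinAt)
        (fun z hz => Submodule.subset_span ⟨s A, rfl⟩)
        (fun z hz => Submodule.subset_span ⟨s B, rfl⟩) z hz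
      rw [S.distribution_eq_span hU hV hO hs ht hz] at h1
      obtain ⟨c, hc⟩ := (Submodule.mem_span_range_iff_exists_fun ℂ).1 h1
      have h2 := S.mfderiv_bundleChart_mlieBracket hU hV hO hs ht hz A B
      rw [← hc, map_sum] at h2
      simp only [map_smul, S.mfderiv_bundleChart_twistorField_frame hU hV hO hs ht hz] at h2
      have h3 : bundleChart ht z = (y, l) := bundleChart_symm ht hy
      rw [h3] at h2
      obtain ⟨h4, h5⟩ := ((S.frameData hU hV hO hs ht).mlieBracket_fieldV_eq_iff (coneModel q) A B
        (y := (y, l)) hy c).1 h2.symm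
      refine ⟨fun D => (S.frameData hU hV hO hs ht).C (coneModel q) A B D (y, l) - c D, h4,
        fun i => ?_⟩
      have h6 := congrFun h5 i
      simpa [coneModel, Finset.sum_apply, Pi.single_apply] using h6
    refine S.isRightFlatOn_of_parallel hU hV hO hs ht h.traceFree (fun y hy A B D i j l => ?_)
      (fun y hy A B i j l => ?_) x ⟨hx₁, hx₂⟩
    · obtain ⟨c, hc, -⟩ := key A B y hy l
      rw [hc, hc]; ring
    · obtain ⟨c, -, hr⟩ := key A B y hy l
      rw [hr, hr]; ring
  · intro hf O' hO' _ ξ η hξ hη hξD hηD z hz'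
    obtain ⟨O₁, s, hO₁, hx₁, hs₁⟩ := exists_localFrame (E := E) (F := F₁) (W := U) S.rank_left z.proj
    obtain ⟨O₂, t, hO₂, hx₂, ht₂⟩ := exists_localFrame (E := E) (F := F₂) (W := V) S.rank_right z.proj
    have hO := hO₁.inter hO₂
    have hs := hs₁.mono (inter_subset_left (t := O₂))
    have ht := ht₂.mono (inter_subset_right (s := O₁))
    have hz : z.proj ∈ O₁ ∩ O₂ := ⟨hx₁, hx₂⟩
    by_cases h0 : z.2 = 0
    · -- both fields vanish along the zero section
      have hbot := S.distribution_eq_bot hU hV hO hs ht hz h0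
      have hξ0 : ξ z = 0 := (Submodule.mem_bot ℂ).1 (hbot ▸ hξD z hz')
      have hη0 : η z = 0 := (Submodule.mem_bot ℂ).1 (hbot ▸ hηD z hz')
      rw [← VectorField.mlieBracketWithin_univ,
        VectorField.mlieBracketWithin_eq_zero_of_eq_zero hξ0 hη0]
      exact Submodule.zero_mem _
    · obtain ⟨k, hk⟩ : ∃ k, ht.coeff k z.proj z.2 ≠ 0 := by
        by_contra! hall
        apply h0
        rw [← frame_sum_coeff ht hz z.2]
        simp [hall]
      rw [S.distribution_eq_span hU hV hO hs ht hz]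
      have hmem : ∀ ζ : Π z : TotalSpace F₂ V, TangentSpace (𝓘(ℂ, E).prod 𝓘(ℂ, F₂)) z,
          (∀ z ∈ O', ζ z ∈ S.distribution nablaV z) →
          ∀ᶠ w in 𝓝 z, ζ w ∈ Submodule.span ℂ (range fun A => S.twistorField nablaV (s A) w) := by
        intro ζ hζ
        filter_upwards [eventually_proj_mem hO hz, hO'.mem_nhds hz'] with w hw hw'
        rw [← S.distribution_eq_span hU hV hO hs ht hw]
        exact hζ w hw'
      refine mlieBracket_mem_span (S.frameData hU hV hO hs ht) (contMDiff_proj V) (k := k)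
        (μ := fun i w => ht.coeff i w.proj w.2) hz ?_ ?_ hk ?_ ?_
        (hξ.contMDiffAt (hO'.mem_nhds hz')) (hη.contMDiffAt (hO'.mem_nhds hz'))
        (hmem ξ hξD) (hmem η hηD)
      · filter_upwards [eventually_proj_mem hO hz] with w hw A
        exact S.mfderiv_proj_twistorField hU hV hO hs ht hw A
      · exact contMDiffAt_frameCoeff (J := 𝓘(ℂ, E).prod 𝓘(ℂ, F₂)) ht hO
          (b := fun z : TotalSpace F₂ V => z.proj) (t := fun z => z.2) hz contMDiffAt_id k
      · exact fun A => (S.contMDiffAt_twistorField hU hV hO hs ht hz A).mdifferentiableAt (by simp)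
      · intro A B
        have h1 : VectorField.mlieBracket (𝓘(ℂ, E).prod 𝓘(ℂ, F₂)) (S.twistorField nablaV (s A))
            (S.twistorField nablaV (s B)) z = ∑ D, (S.frameData hU hV hO hs ht).C (coneModel q) A B D
              (bundleChart ht z) • S.twistorField nablaV (s D) z := by
          apply (isInvertible_mfderiv_bundleChart hO ht hz).injective
          rw [S.mfderiv_bundleChart_mlieBracket hU hV hO hs ht hz,
            S.mlieBracket_fieldV_of_rightFlat hU hV hO hs ht hp hq h
              (fun x _ => hf x (mem_univ x)) (coneModel q) A B (y := bundleChart ht z) hz, map_sum]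
          refine Finset.sum_congr rfl fun D _ => ?_
          rw [map_smul, S.mfderiv_bundleChart_twistorField_frame hU hV hO hs ht hz]
        rw [h1]
        exact Submodule.sum_mem _ fun D _ => Submodule.smul_mem _ _ (Submodule.subset_span ⟨D, rfl⟩)

end ParaconformalStructure

end

/-! ### Involutivity on the projective bundle -/

section

open ParaconformalStructure

section Projection

variable {q : ℕ} (k : Fin q)

/-- The derivative of `π ↦ (πⁱ / πᵏ)` at a point with `πᵏ = 1`. -/
lemma hasFDerivAt_affine {m : Fin q → ℂ} (hm : m k = 1) :
    ∃ L : (Fin q → ℂ) →L[ℂ] ({i : Fin q // i ≠ k} → ℂ),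
      HasFDerivAt (fun l : Fin q → ℂ => fun i : {i : Fin q // i ≠ k} => l i / l k) L m ∧
      ∀ w i, L w i = w i - m i * w k := by
  have h1 : ∀ i : {i : Fin q // i ≠ k}, HasFDerivAt (fun l : Fin q → ℂ => l i / l k)
      ((ContinuousLinearMap.proj (R := ℂ) (φ := fun _ : Fin q => ℂ) i.1) -
        m i • (ContinuousLinearMap.proj (R := ℂ) (φ := fun _ : Fin q => ℂ) k)) m := by
    intro i
    have h2 := hasFDerivAt_apply (𝕜 := ℂ) i.1 m
    have h3 := (hasDerivAt_inv (x := m k) (by rw [hm]; exact one_ne_zero)).comp_hasFDerivAt m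
      (hasFDerivAt_apply (𝕜 := ℂ) k m)
    have h4 := h2.mul h3
    simp only [Function.comp_apply, hm] at h4
    refine (h4.congr_fderiv ?_)
    ext w
    simp
    ring
  refine ⟨_, hasFDerivAt_pi.2 h1, fun w i => ?_⟩
  simp

end Projection

variable {E : Type*} [NormedAddCommGroup E] [NormedSpace ℂ E] [FiniteDimensional ℂ E]
  [CompleteSpace E]
  {M : Type*} [TopologicalSpace M] [ChartedSpace E M] [IsManifold 𝓘(ℂ, E) ω M]
  {p q : ℕ} {O : Set M}
  {F₁ : Type*} [NormedAddCommGroup F₁] [NormedSpace ℂ F₁] [FiniteDimensional ℂ F₁]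
  {U : M → Type*} [TopologicalSpace (TotalSpace F₁ U)]
  [∀ x, AddCommGroup (U x)] [∀ x, Module ℂ (U x)] [∀ x, TopologicalSpace (U x)]
  [∀ x, IsTopologicalAddGroup (U x)] [∀ x, ContinuousSMul ℂ (U x)]
  [FiberBundle F₁ U] [VectorBundle ℂ F₁ U] [ContMDiffVectorBundle ω F₁ U 𝓘(ℂ, E)]
  {F₂ : Type*} [NormedAddCommGroup F₂] [NormedSpace ℂ F₂] [FiniteDimensional ℂ F₂]
  {V : M → Type*} [TopologicalSpace (TotalSpace F₂ V)]
  [∀ x, AddCommGroup (V x)] [∀ x, Module ℂ (V x)] [∀ x, TopologicalSpace (V x)]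
  [∀ x, IsTopologicalAddGroup (V x)] [∀ x, ContinuousSMul ℂ (V x)]
  [FiberBundle F₂ V] [VectorBundle ℂ F₂ V] [ContMDiffVectorBundle ω F₂ V 𝓘(ℂ, E)]
  {S : ParaconformalStructure E F₁ U F₂ V p q}
  {nablaU : CovariantDerivative 𝓘(ℂ, E) F₁ U} {nablaV : CovariantDerivative 𝓘(ℂ, E) F₂ V}
  {ε : Scale E F₁ U p}

namespace FrameData

variable (Q : FrameData E p q O)

/-- The projection to an affine chart maps the fields `v_A` on the cone to the fields `v_A` in the
affine coordinates. -/
lemma mfderiv_affine_fieldV (k : Fin q) (A : Fin p) (y : M × ({i : Fin q // i ≠ k} → ℂ)) :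
    MDifferentiableAt (𝓘(ℂ, E).prod 𝓘(ℂ, Fin q → ℂ)) (𝓘(ℂ, E).prod 𝓘(ℂ, {i : Fin q // i ≠ k} → ℂ))
      (fun z : M × (Fin q → ℂ) => (z.1, fun i : {i : Fin q // i ≠ k} => z.2 i / z.2 k))
      (y.1, homogeneous k y.2) ∧
    mfderiv (𝓘(ℂ, E).prod 𝓘(ℂ, Fin q → ℂ)) (𝓘(ℂ, E).prod 𝓘(ℂ, {i : Fin q // i ≠ k} → ℂ))
      (fun z : M × (Fin q → ℂ) => (z.1, fun i : {i : Fin q // i ≠ k} => z.2 i / z.2 k))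
      (y.1, homogeneous k y.2) (Q.fieldV (coneModel q) A (y.1, homogeneous k y.2)) =
    Q.fieldV (affineModel k) A y := by
  obtain ⟨L, hL, hLw⟩ := hasFDerivAt_affine k (homogeneous_self k y.2)
  have h1 : HasMFDerivAt (𝓘(ℂ, E).prod 𝓘(ℂ, Fin q → ℂ))
      (𝓘(ℂ, E).prod 𝓘(ℂ, {i : Fin q // i ≠ k} → ℂ))
      (fun z : M × (Fin q → ℂ) => (z.1, fun i : {i : Fin q // i ≠ k} => z.2 i / z.2 k))
      (y.1, homogeneous k y.2) ((ContinuousLinearMap.fst ℂ E (Fin q → ℂ)).prod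
        (L.comp (ContinuousLinearMap.snd ℂ E (Fin q → ℂ)))) :=
    HasMFDerivAt.prodMk (hasMFDerivAt_fst (I := 𝓘(ℂ, E)) (I' := 𝓘(ℂ, Fin q → ℂ))
        ((y.1, homogeneous k y.2) : M × (Fin q → ℂ)))
      (HasMFDerivAt.comp (I' := 𝓘(ℂ, Fin q → ℂ)) (f := (Prod.snd : M × (Fin q → ℂ) → (Fin q → ℂ)))
        (g := fun (l : Fin q → ℂ) (i : {i : Fin q // i ≠ k}) => l i / l k)
        ((y.1, homogeneous k y.2) : M × (Fin q → ℂ)) hL.hasMFDerivAt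
        (hasMFDerivAt_snd (I := 𝓘(ℂ, E)) (I' := 𝓘(ℂ, Fin q → ℂ))
          ((y.1, homogeneous k y.2) : M × (Fin q → ℂ))))
  refine ⟨h1.mdifferentiableAt, ?_⟩
  refine (congrArg (fun L : (E × (Fin q → ℂ)) →L[ℂ] E × ({i : Fin q // i ≠ k} → ℂ) =>
    L (Q.fieldV (coneModel q) A (y.1, homogeneous k y.2))) h1.mfderiv).trans ?_
  refine Prod.ext (α := E) (β := {i : Fin q // i ≠ k} → ℂ) ?_ ?_
  · exact (Q.fst_fieldV (coneModel q) A (y.1, homogeneous k y.2)).trans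
      (Q.fst_fieldV (affineModel k) A y).symm
  · refine Eq.trans ?_ (Q.snd_fieldV (affineModel k) A y).symm
    refine (congrArg L (Q.snd_fieldV (coneModel q) A (y.1, homogeneous k y.2))).trans ?_
    funext n
    rw [hLw]
    have hn : homogeneous k y.2 n = y.2 n := by simp [homogeneous, n.2]
    have hgl : ∀ a i, Q.gl (coneModel q) a i (y.1, homogeneous k y.2) =
        Q.gl (affineModel k) a i y := fun a i => rfl
    have hlam : ∀ i, (coneModel q).lam i (homogeneous k y.2) = (affineModel k).lam i y.2 :=
      fun i => rfl
    have hc : ∀ i (l : Fin q → ℂ), (coneModel q).dl i l = Pi.single i 1 := fun i l => rfl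
    have ha : ∀ i (l : {i : Fin q // i ≠ k} → ℂ), (affineModel k).dl i l =
      fun n => (if i = n.1 then 1 else 0) - (if i = k then 1 else 0) * l n := fun i l => rfl
    simp only [hn, hgl, hlam, hc, ha, Pi.neg_apply, Finset.sum_apply, Pi.smul_apply, smul_eq_mul,
      Pi.single_apply, mul_sub, mul_ite, mul_one, mul_zero, ite_mul, one_mul, zero_mul,
      Finset.sum_sub_distrib, Finset.sum_ite_eq, Finset.sum_ite_eq', Finset.mem_univ, if_true,
      mul_neg, Finset.mul_sum, neg_sub, sub_neg_eq_add]
    rw [neg_add_eq_sub]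
    congr 1
    exact Finset.sum_congr rfl fun i _ => by ring

end FrameData

namespace ParaconformalStructure

variable {s : Fin p → Π y : M, U y} {t : Fin q → Π y : M, V y}

section Frames

variable (S) (hU : IsHolomorphicConnection nablaU) (hV : IsHolomorphicConnection nablaV)
  (hO : IsOpen O) (hs : IsLocalFrameOn 𝓘(ℂ, E) F₁ ω s O) (ht : IsLocalFrameOn 𝓘(ℂ, E) F₂ ω t O)

local notation "𝒬" => frameData S hU hV hO hs ht

include hU hV hO hs

/-- The projected distribution is spanned by the Lax tuple. -/
lemma projDistribution_eq_span (k : Fin q) {y : M × ({i : Fin q // i ≠ k} → ℂ)} (hy : y.1 ∈ O) :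
    S.projDistribution nablaV ht k y =
      Submodule.span ℂ (range fun A => S.laxField nablaV s ht k A y) := by
  have hz : (affineLift F₂ t k y).proj ∈ O := hy
  have hΦ : bundleChart ht (affineLift F₂ t k y) = (y.1, homogeneous k y.2) :=
    bundleChart_symm ht (y := (y.1, homogeneous k y.2)) hy
  have key : ∀ A, mfderiv (𝓘(ℂ, E).prod 𝓘(ℂ, F₂)) (𝓘(ℂ, E).prod 𝓘(ℂ, {i : Fin q // i ≠ k} → ℂ))
      (affineProj ht k) (affineLift F₂ t k y) (S.twistorField nablaV (s A) (affineLift F₂ t k y)) =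
      S.laxField nablaV s ht k A y := by
    intro A
    obtain ⟨h1, h2⟩ := (𝒬).mfderiv_affine_fieldV k A y
    rw [S.laxField_eq hU hV hO hs ht]
    refine Eq.trans ?_ h2
    have h3 := S.mfderiv_bundleChart_twistorField_frame hU hV hO hs ht hz A
    rw [hΦ] at h3
    rw [← h3]
    exact (mfderiv_mfderiv_apply hΦ h1 ((contMDiffAt_bundleChart hO ht hz).mdifferentiableAt
      (by simp)) _).symm
  rw [projDistribution, S.distribution_eq_span hU hV hO hs ht hz]
  refine (Submodule.map_span _ _).trans (congrArg (Submodule.span ℂ) ?_)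
  exact (range_comp _ _).symm.trans (congrArg range (funext key))

end Frames

/-- The projected distribution does not change on restricting the frame to a smaller open set. -/
lemma projDistribution_mono (hO : IsOpen O) {O' : Set M} (h : O ⊆ O')
    (ht : IsLocalFrameOn 𝓘(ℂ, E) F₂ ω t O') (k : Fin q)
    {y : M × ({i : Fin q // i ≠ k} → ℂ)} (hy : y.1 ∈ O) :
    S.projDistribution nablaV (ht.mono h) k y = S.projDistribution nablaV ht k y := by
  have h1 : affineProj (ht.mono h) k =ᶠ[𝓝 (affineLift F₂ t k y)] affineProj ht k := by
    filter_upwards [eventually_proj_mem hO (z := affineLift F₂ t k y) hy] with z hz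
    simp only [affineProj, coeff_mono ht h hz]
  rw [projDistribution, projDistribution, h1.mfderiv_eq]

/-- The projection of the twistor distribution to `P(V)` is involutive exactly for right-flat
structures. -/
theorem IsScaleConnection.isInvolutiveOnProj_iff (hp : 2 ≤ p) (hq : 2 ≤ q)
    (h : S.IsScaleConnection nablaU nablaV ε) :
    S.IsInvolutiveOnProj nablaV ↔ S.IsRightFlat nablaU nablaV := by
  have hU := h.holo_left
  have hV := h.holo_right
  have hlax : ∀ {O : Set M} (hO : IsOpen O) {s : Fin p → Π y : M, U y} {t : Fin q → Π y : M, V y}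
      (hs : IsLocalFrameOn 𝓘(ℂ, E) F₁ ω s O) (ht : IsLocalFrameOn 𝓘(ℂ, E) F₂ ω t O) (k : Fin q)
      (A : Fin p) (y : M × ({i : Fin q // i ≠ k} → ℂ)), y.1 ∈ O →
      ContMDiffAt (𝓘(ℂ, E).prod 𝓘(ℂ, {i : Fin q // i ≠ k} → ℂ))
        ((𝓘(ℂ, E).prod 𝓘(ℂ, {i : Fin q // i ≠ k} → ℂ)).tangent) ω
        (fun w => (⟨w, S.laxField nablaV s ht k A w⟩ : TangentBundle
          (𝓘(ℂ, E).prod 𝓘(ℂ, {i : Fin q // i ≠ k} → ℂ)) (M × ({i : Fin q // i ≠ k} → ℂ)))) y := by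
    intro O hO s t hs ht k A y hy
    rw [S.laxField_eq hU hV hO hs ht]
    exact FrameData.contMDiffAt_fieldV _ _ A hy
  constructor
  · intro hD x _
    obtain ⟨O₁, s, hO₁, hx₁, hs₁⟩ := exists_localFrame (E := E) (F := F₁) (W := U) S.rank_left x
    obtain ⟨O₂, t, hO₂, hx₂, ht₂⟩ := exists_localFrame (E := E) (F := F₂) (W := V) S.rank_right x
    have hO := hO₁.inter hO₂
    have hs := hs₁.mono (inter_subset_left (t := O₂))
    have ht := ht₂.mono (inter_subset_right (s := O₁))
    let k : Fin q := ⟨0, by omega⟩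
    refine S.isRightFlatOn_of_lax hU hV hO hs ht h.traceFree k (fun A B y hy => ?_) x ⟨hx₁, hx₂⟩
    have hmem : ∀ A, ∀ z ∈ (O₁ ∩ O₂) ×ˢ (univ : Set ({i : Fin q // i ≠ k} → ℂ)),
        S.laxField nablaV s ht k A z ∈ S.projDistribution nablaV ht k z := by
      intro A z hz
      rw [S.projDistribution_eq_span hU hV hO hs ht k hz.1]
      exact Submodule.subset_span ⟨A, rfl⟩
    have h1 := hD _ hO t ht k _ (hO.prod isOpen_univ) subset_rfl (S.laxField nablaV s ht k A)
      (S.laxField nablaV s ht k B)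
      (fun z hz => (hlax hO hs ht k A z hz.1).contMDiffWithinAt)
      (fun z hz => (hlax hO hs ht k B z hz.1).contMDiffWithinAt)
      (hmem A) (hmem B) y ⟨hy, mem_univ _⟩
    rw [S.projDistribution_eq_span hU hV hO hs ht k hy] at h1
    obtain ⟨c, hc⟩ := (Submodule.mem_span_range_iff_exists_fun ℂ).1 h1
    exact ⟨c, hc.symm⟩
  · intro hf O₂ hO₂ t ht₂ k O' hO' hOO' ξ η hξ hη hξD hηD y hy'
    obtain ⟨O₁, s, hO₁, hx₁, hs₁⟩ := exists_localFrame (E := E) (F := F₁) (W := U) S.rank_left y.1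
    have hO := hO₁.inter hO₂
    have hs := hs₁.mono (inter_subset_left (t := O₂))
    have ht := ht₂.mono (inter_subset_right (s := O₁))
    have hy : y.1 ∈ O₁ ∩ O₂ := ⟨hx₁, (hOO' hy').1⟩
    have hspan : ∀ w : M × ({i : Fin q // i ≠ k} → ℂ), w.1 ∈ O₁ ∩ O₂ →
        S.projDistribution nablaV ht₂ k w =
          Submodule.span ℂ (range fun A => S.laxField nablaV s ht k A w) := fun w hw => by
      rw [← S.projDistribution_eq_span hU hV hO hs ht k hw,
        projDistribution_mono hO inter_subset_right ht₂ k hw]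
    have hev : ∀ᶠ w in 𝓝 y, w.1 ∈ O₁ ∩ O₂ := continuous_fst.continuousAt (hO.mem_nhds hy)
    have hmem : ∀ ζ : Π z : M × ({i : Fin q // i ≠ k} → ℂ),
        TangentSpace (𝓘(ℂ, E).prod 𝓘(ℂ, {i : Fin q // i ≠ k} → ℂ)) z,
        (∀ z ∈ O', ζ z ∈ S.projDistribution nablaV ht₂ k z) →
        ∀ᶠ w in 𝓝 y, ζ w ∈ Submodule.span ℂ (range fun A => S.laxField nablaV s ht k A w) := by
      intro ζ hζ
      filter_upwards [hev, hO'.mem_nhds hy'] with w hw hw'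
      rw [← hspan w hw]
      exact hζ w hw'
    rw [hspan y hy]
    refine mlieBracket_mem_span (S.frameData hU hV hO hs ht) contMDiff_fst (k := k)
      (μ := fun i w => homogeneous k w.2 i) hy ?_ ?_ ?_ ?_ ?_
      (hξ.contMDiffAt (hO'.mem_nhds hy')) (hη.contMDiffAt (hO'.mem_nhds hy'))
      (hmem ξ hξD) (hmem η hηD)
    · filter_upwards with w A
      rw [S.laxField_eq hU hV hO hs ht]
      refine (congrArg (fun L : E × ({i : Fin q // i ≠ k} → ℂ) →L[ℂ] E =>
        L ((S.frameData hU hV hO hs ht).fieldV (affineModel k) A w))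
        (mfderiv_fst (I := 𝓘(ℂ, E)) (I' := 𝓘(ℂ, {i : Fin q // i ≠ k} → ℂ)) (x := w))).trans ?_
      exact (S.frameData hU hV hO hs ht).fst_fieldV (affineModel k) A w
    · simp only [homogeneous_self]
      exact contMDiffAt_const
    · simp only [homogeneous_self]
      exact one_ne_zero
    · exact fun A => (hlax hO hs ht k A y hy).mdifferentiableAt (by simp)
    · intro A B
      rw [S.laxField_eq hU hV hO hs ht, S.laxField_eq hU hV hO hs ht,
        S.mlieBracket_fieldV_of_rightFlat hU hV hO hs ht hp hq h (fun x _ => hf x (mem_univ x))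
          (affineModel k) A B hy]
      refine Submodule.sum_mem _ fun D _ => Submodule.smul_mem _ _ (Submodule.subset_span ⟨D, ?_⟩)
      simp only [S.laxField_eq hU hV hO hs ht]

end ParaconformalStructure

end

end Paraconformal

end

theorem mainTheorem2
    {E : Type*} [NormedAddCommGroup E] [NormedSpace ℂ E] [FiniteDimensional ℂ E] [CompleteSpace E]
    {M : Type*} [TopologicalSpace M] [ChartedSpace E M] [IsManifold 𝓘(ℂ, E) ω M]
    {F₁ : Type*} [NormedAddCommGroup F₁] [NormedSpace ℂ F₁] [FiniteDimensional ℂ F₁]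
    {U : M → Type*} [TopologicalSpace (TotalSpace F₁ U)]
    [∀ x, AddCommGroup (U x)] [∀ x, Module ℂ (U x)] [∀ x, TopologicalSpace (U x)]
    [∀ x, IsTopologicalAddGroup (U x)] [∀ x, ContinuousSMul ℂ (U x)]
    [FiberBundle F₁ U] [VectorBundle ℂ F₁ U] [ContMDiffVectorBundle ω F₁ U 𝓘(ℂ, E)]
    {F₂ : Type*} [NormedAddCommGroup F₂] [NormedSpace ℂ F₂] [FiniteDimensional ℂ F₂]
    {V : M → Type*} [TopologicalSpace (TotalSpace F₂ V)]
    [∀ x, AddCommGroup (V x)] [∀ x, Module ℂ (V x)] [∀ x, TopologicalSpace (V x)]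
    [∀ x, IsTopologicalAddGroup (V x)] [∀ x, ContinuousSMul ℂ (V x)]
    [FiberBundle F₂ V] [VectorBundle ℂ F₂ V] [ContMDiffVectorBundle ω F₂ V 𝓘(ℂ, E)]
    {p q : ℕ} (hp : 2 ≤ p) (hq : 2 ≤ q)
    (S : Paraconformal.ParaconformalStructure E F₁ U F₂ V p q)
    (ε : Paraconformal.Scale E F₁ U p)
    (nablaU : CovariantDerivative 𝓘(ℂ, E) F₁ U) (nablaV : CovariantDerivative 𝓘(ℂ, E) F₂ V)
    (hnabla : S.IsScaleConnection nablaU nablaV ε) :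
    (Paraconformal.IsInvolutiveOn (𝓘(ℂ, E).prod 𝓘(ℂ, F₂)) (S.distribution nablaV) univ ↔
      S.IsRightFlat nablaU nablaV) ∧
    (S.IsInvolutiveOnProj nablaV ↔ S.IsRightFlat nablaU nablaV) ∧
    ∀ (O : Set M) (_ : IsOpen O)
      (s : Fin p → Π y : M, U y) (_ : IsLocalFrameOn 𝓘(ℂ, E) F₁ ω s O)
      (t : Fin q → Π y : M, V y) (ht : IsLocalFrameOn 𝓘(ℂ, E) F₂ ω t O) (k : Fin q),
      ((∃ C, S.IsLaxTuple nablaV s ht k C) ↔ S.IsRightFlatOn nablaU nablaV O) ∧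
      ∀ C, S.IsLaxTuple nablaV s ht k C →
        ∃ P : Fin p → Fin p → Fin p → M → MvPolynomial {i : Fin q // i ≠ k} ℂ,
          (∀ A B D x, (P A B D x).totalDegree ≤ 2) ∧
          (∀ A B D m, CMDiff[O] ω (fun x => (P A B D x).coeff m)) ∧
          ∀ A B D, ∀ x ∈ O, ∀ l, C A B D (x, l) = MvPolynomial.eval l (P A B D x) := by
  exact ⟨hnabla.isInvolutiveOn_iff hp hq, hnabla.isInvolutiveOnProj_iff hp hq,
    fun O hO s hs t ht k => hnabla.lax hp hq hO hs ht k⟩
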